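/- **Definitions.** A *permutation* is a pair $\pi=(S,P)$ where $S=S(\pi)$ is a finite set of positive integers and $P:S\to\mathbb N^2$ is an injection such that no two points of $P(S)$ share an $x$- or a $y$-coordinate; its length is $|\pi|=|S|$. It is *reduced* if $S=[n]$ and $P(S)\subseteq[n]\times[n]$, where $n=|\pi|$. A permutation $\sigma$ is a *subpattern* of $\pi$ if there is a map $\phi:S(\sigma)\to S(\pi)$ such that, for all $p,q\in S(\sigma)$ and both coordinates $\alpha\in\{1,2\}$, the $\alpha$-th coordinate of the point of $p$ is smaller than that of the point of $q$ if and only if the same holds for $\phi(p)$ and $\phi(q)$. A *rectangle* is a product of two nonempty discrete intervals; points are degenerate rectangles. A *rectangle family* $\mathcal R=(S,R)$ assigns a rectangle $R(i)$ to every index $i$ in a finite set $S\subseteq\mathbb N$. For distinct $i,j\in S$ and $k\notin S$, the family $\mathcal R[i,j\to k]$ arises from $\mathcal R$ by replacing the rectangles $i$ and $j$ by their bounding box, indexed by $k$. A *decomposition* of $\pi=(S,P)$ is a sequence $\mathcal R_0,\dots,\mathcal R_s$ of rectangle families with $\mathcal R_0=\pi$, $|\mathcal R_s|=1$, and $\mathcal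 R_p=\mathcal R_{p-1}[i_p,j_p\to k_p]$ for $1\le p\le s$, where $\max S<k_1<\dots<k_s$; its *merge sequence* is $(i_1,j_1,k_1),\dots,(i_s,j_s,k_s)$. It is *$d$-wide* if, for every $p$, every rectangle of $\mathcal R_p$ and each $\alpha\in\{1,2\}$, fewer than $d$ other rectangles of $\mathcal R_p$ have an $\alpha$-th side (projection to the $\alpha$-th axis) that intersects the $\alpha$-th side of the given rectangle. **Theorem.** There is a single word-RAM algorithm with the following property. Let $\sigma$ and $\pi$ be reduced permutations, $\ell=|\sigma|$, $n=|\pi|$. Given $\sigma$, $\pi$ and the merge sequence of a $d$-wide decomposition of $\pi$ (the number $d$ itself need not be given), the algorithm decides whether $\sigma$ is a subpattern of $\pi$ in time $(d\ell)^{O(\ell)}\cdot n$, that is, in at most $C\,(d\ell)^{c\ell}\,n$ steps for absolute constants $C,c$; and, if $\ell\ge1$, in time $$O\big((16\,\ell d)^{\ell}\,\ell^2\,n\big)$$ with an absolute constant. Here each operation on machine words costs one unit of time, and it suffices that words have $b\log_2 N$ bits, where $b$ is an absolute constant and $N=(16\ell d)^\ell\ell^2n+n+k_{\max}+2$, with $k_{\max}$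 the largest index $k_p$ in the merge sequence ($0$ if $n=1$). -/

import Mathlib

/-! ### Permutations as labelled point sets -/

/-- A permutation: a finite set `S` of positive labels, each label `i ∈ S` carrying a point `P i`
of `ℕ²` (coordinates indexed by `Fin 2`), the points being in general position. The values of `P`
outside `S` are irrelevant. -/
structure PointPerm where
  S : Finset ℕ
  pos : ∀ i ∈ S, 0 < i
  P : ℕ → Fin 2 → ℕ
  general : ∀ α : Fin 2, Set.InjOn (fun i => P i α) (S : Set ℕ)

namespace PointPerm

def length (π : PointPerm) : ℕ := π.S.card

/-- `S = [n]` and all points lie in `[n] × [n]`, where `n` is the length. -/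
def Reduced (π : PointPerm) : Prop :=
  π.S = Finset.Icc 1 π.length ∧ ∀ i ∈ π.S, ∀ α : Fin 2, π.P i α ∈ Finset.Icc 1 π.length

def IsEmbedding (σ π : PointPerm) (φ : ℕ → ℕ) : Prop :=
  (∀ p ∈ σ.S, φ p ∈ π.S) ∧
    ∀ p ∈ σ.S, ∀ q ∈ σ.S, ∀ α : Fin 2, σ.P p α < σ.P q α ↔ π.P (φ p) α < π.P (φ q) α

def IsSubpattern (σ π : PointPerm) : Prop := ∃ φ : ℕ → ℕ, IsEmbedding σ π φ

end PointPerm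

/-! ### Rectangle families, decompositions, width -/

/-- An axis-parallel rectangle: a nonempty discrete interval in each of the two directions.
In the componentwise order `⊔` is the smallest enclosing rectangle. -/
abbrev Rect : Type := Fin 2 → NonemptyInterval ℕ

/-- Two rectangles `α`-view each other if their `α`-th intervals intersect. -/
def Rect.Views (α : Fin 2) (A B : Rect) : Prop :=
  ∃ x : ℕ, x ∈ A α ∧ x ∈ B α

/-- A finite family of rectangles; the values of `R` outside `S` are irrelevant. -/
structure RectFamily where
  S : Finset ℕ
  R : ℕ → Rect

namespace RectFamily

/-- A permutation as a family of degenerate rectangles. -/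
def ofPerm (π : PointPerm) : RectFamily where
  S := π.S
  R := fun i α => NonemptyInterval.pure (π.P i α)

/-- Replace the rectangles `i` and `j` by their bounding box, which gets the index `k`. -/
def merge (F : RectFamily) (i j k : ℕ) : RectFamily where
  S := insert k ((F.S.erase i).erase j)
  R := Function.update F.R k (F.R i ⊔ F.R j)

open Classical in
/-- The indices of the other rectangles that rectangle `i` `α`-views. -/
noncomputable def viewSet (F : RectFamily) (α : Fin 2) (i : ℕ) : Finset ℕ :=
  (F.S.erase i).filter fun j => Rect.Views α (F.R i) (F.R j)

noncomputable def view (F : RectFamily) (i : ℕ) : ℕ :=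
  max (F.viewSet 0 i).card (F.viewSet 1 i).card

def IsWide (F : RectFamily) (d : ℕ) : Prop := ∀ i ∈ F.S, F.view i < d

end RectFamily

/-- One entry `(i, j, k)` of a merge sequence: rectangles `i` and `j` are merged into `k`. -/
structure MergeStep where
  i : ℕ
  j : ℕ
  k : ℕ

/-- A decomposition `fam 0, …, fam s` of `π`, with its merge sequence `step 0, …, step (s - 1)`;
`step p` leads from `fam p` to `fam (p + 1)`. Values beyond these ranges are irrelevant. -/
structure Decomposition (π : PointPerm) where
  s : ℕ
  fam : ℕ → RectFamily
  step : ℕ → MergeStep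
  start : fam 0 = RectFamily.ofPerm π
  fresh : ∀ p < s, ∀ x ∈ π.S, x < (step p).k
  increasing : ∀ p q, p < q → q < s → (step p).k < (step q).k
  mem_i : ∀ p < s, (step p).i ∈ (fam p).S
  mem_j : ∀ p < s, (step p).j ∈ (fam p).S
  ne : ∀ p < s, (step p).i ≠ (step p).j
  next : ∀ p < s, fam (p + 1) = (fam p).merge (step p).i (step p).j (step p).k
  final : (fam s).S.card = 1

namespace Decomposition

variable {π : PointPerm}

def IsWide (D : Decomposition π) (d : ℕ) : Prop := ∀ p ≤ D.s, (D.fam p).IsWide d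

/-- The largest new label `k` that occurs in the merge sequence (`0` if it is empty). -/
def maxLabel (D : Decomposition π) : ℕ := (Finset.range D.s).sup fun p => (D.step p).k

end Decomposition

/-! ### A word RAM with unit cost

Programs are finite texts in structured form. They work on registers and on arrays of words with
indirect addressing; names of registers and arrays are literals of the program, so that a program
uses a fixed finite number of them. Every value that is computed or read has to fit in a
word of `w` bits: otherwise the program is stuck and has no execution. Every operation
costs one unit of time. -/

structure RamState where
  reg : ℕ → ℕ
  arr : ℕ → ℕ → ℕ

inductive RamExpr where
  | lit (v : ℕ)
  | reg (x : ℕ)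
  | get (a : ℕ) (e : RamExpr)
  | add (e f : RamExpr)
  | sub (e f : RamExpr)
  | mul (e f : RamExpr)
  | div (e f : RamExpr)
  | mod (e f : RamExpr)
  | lt (e f : RamExpr)
  | eq (e f : RamExpr)

namespace RamExpr

/-- Subtraction is truncated, division is rounded down, comparisons return `1` or `0`. -/
def eval (s : RamState) : RamExpr → ℕ
  | lit v => v
  | reg x => s.reg x
  | get a e => s.arr a (e.eval s)
  | add e f => e.eval s + f.eval s
  | sub e f => e.eval s - f.eval s
  | mul e f => e.eval s * f.eval s
  | div e f => e.eval s / f.eval s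
  | mod e f => e.eval s % f.eval s
  | lt e f => if e.eval s < f.eval s then 1 else 0
  | eq e f => if e.eval s = f.eval s then 1 else 0

/-- The number of operations that an evaluation performs. -/
def cost : RamExpr → ℕ
  | lit _ => 1
  | reg _ => 1
  | get _ e => e.cost + 1
  | add e f => e.cost + f.cost + 1
  | sub e f => e.cost + f.cost + 1
  | mul e f => e.cost + f.cost + 1
  | div e f => e.cost + f.cost + 1
  | mod e f => e.cost + f.cost + 1
  | lt e f => e.cost + f.cost + 1
  | eq e f => e.cost + f.cost + 1

/-- All values that occur in the evaluation, including the intermediate ones and the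
addresses, fit in a word of `w` bits. -/
def Fits (w : ℕ) (s : RamState) : RamExpr → Prop
  | lit v => v < 2 ^ w
  | reg x => s.reg x < 2 ^ w
  | get a e => e.Fits w s ∧ s.arr a (e.eval s) < 2 ^ w
  | add e f => e.Fits w s ∧ f.Fits w s ∧ e.eval s + f.eval s < 2 ^ w
  | sub e f => e.Fits w s ∧ f.Fits w s
  | mul e f => e.Fits w s ∧ f.Fits w s ∧ e.eval s * f.eval s < 2 ^ w
  | div e f => e.Fits w s ∧ f.Fits w s
  | mod e f => e.Fits w s ∧ f.Fits w s
  | lt e f => e.Fits w s ∧ f.Fits w s ∧ 1 < 2 ^ w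
  | eq e f => e.Fits w s ∧ f.Fits w s ∧ 1 < 2 ^ w

end RamExpr

inductive RamProg where
  | skip
  /-- register `x` := `e` -/
  | assign (x : ℕ) (e : RamExpr)
  /-- array `a` at address `e` := `f` -/
  | store (a : ℕ) (e f : RamExpr)
  | seq (c c' : RamProg)
  /-- if `e ≠ 0` then `c` else `c'` -/
  | cond (e : RamExpr) (c c' : RamProg)
  /-- while `e ≠ 0` do `c` -/
  | loop (e : RamExpr) (c : RamProg)

def RamState.setReg (s : RamState) (x v : ℕ) : RamState :=
  { s with reg := Function.update s.reg x v }

def RamState.setArr (s : RamState) (a m v : ℕ) : RamState :=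
  { s with arr := Function.update s.arr a (Function.update (s.arr a) m v) }

/-- `RamExec w c s t s'`: with words of `w` bits, program `c` started in state `s` halts after
exactly `t` steps in state `s'`. -/
inductive RamExec (w : ℕ) : RamProg → RamState → ℕ → RamState → Prop where
  | skip (s : RamState) : RamExec w .skip s 1 s
  | assign (s : RamState) (x : ℕ) (e : RamExpr) (he : e.Fits w s) :
      RamExec w (.assign x e) s (e.cost + 1) (s.setReg x (e.eval s))
  | store (s : RamState) (a : ℕ) (e f : RamExpr) (he : e.Fits w s) (hf : f.Fits w s) :
      RamExec w (.store a e f) s (e.cost + f.cost + 1) (s.setArr a (e.eval s) (f.eval s))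
  | seq {c c' : RamProg} {s s' s'' : RamState} {t t' : ℕ}
      (h : RamExec w c s t s') (h' : RamExec w c' s' t' s'') :
      RamExec w (.seq c c') s (t + t') s''
  | cond_true {e : RamExpr} {c c' : RamProg} {s s' : RamState} {t : ℕ}
      (he : e.Fits w s) (h0 : e.eval s ≠ 0) (h : RamExec w c s t s') :
      RamExec w (.cond e c c') s (e.cost + 1 + t) s'
  | cond_false {e : RamExpr} {c c' : RamProg} {s s' : RamState} {t : ℕ}
      (he : e.Fits w s) (h0 : e.eval s = 0) (h : RamExec w c' s t s') :
      RamExec w (.cond e c c') s (e.cost + 1 + t) s'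
  | loop_true {e : RamExpr} {c : RamProg} {s s' s'' : RamState} {t t' : ℕ}
      (he : e.Fits w s) (h0 : e.eval s ≠ 0) (h : RamExec w c s t s')
      (h' : RamExec w (.loop e c) s' t' s'') :
      RamExec w (.loop e c) s (e.cost + 1 + t + t') s''
  | loop_false {e : RamExpr} {c : RamProg} {s : RamState}
      (he : e.Fits w s) (h0 : e.eval s = 0) :
      RamExec w (.loop e c) s (e.cost + 1) s

/-! ### Instances of Permutation Pattern with a merge sequence as machine inputs -/

/-- Register `0` holds `|σ|` and register `1` holds `|π|`. Arrays `0, 1` hold the first and second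
coordinates of the points of `σ` (at the addresses `1, …, |σ|`), arrays `2, 3` those of `π`, and
arrays `4, 5, 6` the three components of the merge sequence (at the addresses `0, …, s - 1`).
Everything else is `0`. In particular the width is not part of the input. -/
def patternInput (σ π : PointPerm) (D : Decomposition π) : RamState where
  reg := fun x => if x = 0 then σ.length else if x = 1 then π.length else 0
  arr := fun a m =>
    if a = 0 then (if m ∈ σ.S then σ.P m 0 else 0)
    else if a = 1 then (if m ∈ σ.S then σ.P m 1 else 0)
    else if a = 2 then (if m ∈ π.S then π.P m 0 else 0)
    else if a = 3 then (if m ∈ π.S then π.P m 1 else 0)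
    else if a = 4 then (if m < D.s then (D.step m).i else 0)
    else if a = 5 then (if m < D.s then (D.step m).j else 0)
    else if a = 6 then (if m < D.s then (D.step m).k else 0)
    else 0

/-- With words of `w` bits, `prog` decides within `T` steps whether `σ` is a subpattern of `π`,
given the merge sequence of `D`; register `0` holds the answer, `1` for yes and `0` for no. -/
def DecidesPattern (prog : RamProg) (w : ℕ) (σ π : PointPerm) (D : Decomposition π)
    (T : ℕ) : Prop :=
  ∃ (t : ℕ) (s' : RamState), RamExec w prog (patternInput σ π D) t s' ∧ t ≤ T ∧
    (σ.IsSubpattern π → s'.reg 0 = 1) ∧ (¬ σ.IsSubpattern π → s'.reg 0 = 0)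

/-! Send each pattern position to a rectangle, or leave it unassigned (label `0`). Such an
assignment is realizable if points can be chosen inside the rectangles in the order that the pattern
prescribes. The last rectangle contains all points, so `σ` is a subpattern of `π` iff the constant
assignment to it is realizable (`isSubpattern_iff`). Realizability is computed by dynamic
programming along the merge sequence, using three facts.

Undoing a merge: an assignment is realizable iff one of the `2 ^ ℓ` distributions of its positions
over the two merged parts is (`Realizable.of_split`, `Realizable.exists_split`).

Components: link two positions if their rectangles view each other in some direction. Rectangles of
unlinked positions have disjoint projections, so once no pair contradicts the pattern, choices made
separately in the components fit together (`realizable_of_comp`). A consistent component consisting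
of points is realizable outright (`realizable_of_points`).

Counting: a connected assignment whose newest rectangle is the one of step `p` is encoded by a
spanning tree that names, for each position, a parent and one of fewer than `2 * d` rectangles
viewed from the parent. Hence there are at most `S = (2 * d * ℓ + 1) ^ ℓ` of them (`card_good_le`).

After splitting at the newest rectangle only older labels remain, so the components of a split
belong to earlier steps (`exists_good_comp`). The program does not know `d`; it generates only the
assignments that it meets. A pass down the merge sequence registers all components that arise, each
once, in a trie and in a bucket for its newest label. A pass up then finds every component already
registered and marks exactly the realizable ones. Each step costs about `S * 2 ^ ℓ * (ℓ + 1) ^ 3`.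

The machine proof uses triples `Run` with a time bound. All memory values stay below some `V` with
`V ^ 64 < 2 ^ w`, and whatever a program does not write syntactically is known to be unchanged. -/

/-! ### Running programs with bounded memory -/

/-- All registers and all array cells hold values at most `V`. -/
def RamState.Bounded (V : ℕ) (s : RamState) : Prop :=
  (∀ x, s.reg x ≤ V) ∧ ∀ a m, s.arr a m ≤ V

@[simp] theorem RamState.setReg_reg (s : RamState) (x v y : ℕ) :
    (s.setReg x v).reg y = if y = x then v else s.reg y := by
  simp [RamState.setReg, Function.update_apply]

@[simp] theorem RamState.setReg_arr (s : RamState) (x v : ℕ) : (s.setReg x v).arr = s.arr := rfl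

@[simp] theorem RamState.setArr_reg (s : RamState) (a m v : ℕ) : (s.setArr a m v).reg = s.reg := rfl

@[simp] theorem RamState.setArr_arr (s : RamState) (a m v b : ℕ) :
    (s.setArr a m v).arr b = if b = a then Function.update (s.arr a) m v else s.arr b := by
  simp only [RamState.setArr, Function.update_apply]

theorem RamState.Bounded.setReg {V : ℕ} {s : RamState} (h : s.Bounded V) {x v : ℕ} (hv : v ≤ V) :
    (s.setReg x v).Bounded V := by
  refine ⟨fun y => ?_, h.2⟩
  rw [RamState.setReg_reg]
  split
  · exact hv
  · exact h.1 y

theorem RamState.Bounded.setArr {V : ℕ} {s : RamState} (h : s.Bounded V) {a m v : ℕ} (hv : v ≤ V) :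
    (s.setArr a m v).Bounded V := by
  refine ⟨h.1, fun b k => ?_⟩
  rw [RamState.setArr_arr]
  split
  · rw [Function.update_apply]
    split
    · exact hv
    · exact h.2 _ _
  · exact h.2 _ _

/-! ### Size of the values of short expressions -/

namespace RamExpr

/-- All literals are at most `2`. -/
def smallLits : RamExpr → Bool
  | lit v => decide (v ≤ 2)
  | reg _ => true
  | get _ e => e.smallLits
  | add e f => e.smallLits && f.smallLits
  | sub e f => e.smallLits && f.smallLits
  | mul e f => e.smallLits && f.smallLits
  | div e f => e.smallLits && f.smallLits
  | mod e f => e.smallLits && f.smallLits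
  | lt e f => e.smallLits && f.smallLits
  | eq e f => e.smallLits && f.smallLits

/-- The expression is short and has small literals. -/
def ok (e : RamExpr) : Bool := e.smallLits && decide (e.cost ≤ 64)

/-- The value of the expression is at most the largest value in the memory. -/
def tame : RamExpr → Bool
  | lit v => decide (v ≤ 2)
  | reg _ => true
  | get _ _ => true
  | add _ _ => false
  | mul _ _ => false
  | sub e _ => e.tame
  | div e _ => e.tame
  | mod e _ => e.tame
  | lt _ _ => true
  | eq _ _ => true

theorem eq_eval_ne_zero {s : RamState} {e f : RamExpr} :
    (eq e f).eval s ≠ 0 ↔ e.eval s = f.eval s := by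
  by_cases h : e.eval s = f.eval s <;> simp [eval, h]

theorem eq_eval_eq_zero {s : RamState} {e f : RamExpr} :
    (eq e f).eval s = 0 ↔ e.eval s ≠ f.eval s := by
  by_cases h : e.eval s = f.eval s <;> simp [eval, h]

theorem lt_eval_ne_zero {s : RamState} {e f : RamExpr} :
    (lt e f).eval s ≠ 0 ↔ e.eval s < f.eval s := by
  by_cases h : e.eval s < f.eval s <;> simp [eval, h]

theorem lt_eval_eq_zero {s : RamState} {e f : RamExpr} :
    (lt e f).eval s = 0 ↔ f.eval s ≤ e.eval s := by
  rw [← not_lt, ← lt_eval_ne_zero, not_not]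

theorem one_le_cost (e : RamExpr) : 1 ≤ e.cost := by
  cases e <;> simp [cost]

theorem eval_le_of_tame {V : ℕ} (hV : 2 ≤ V) {s : RamState} (hs : s.Bounded V) (e : RamExpr)
    (he : e.tame = true) : e.eval s ≤ V := by
  induction e with
  | lit v => simp only [tame, decide_eq_true_eq] at he; exact he.trans hV
  | reg x => exact hs.1 x
  | get a e _ => exact hs.2 _ _
  | add e f _ _ => simp [tame] at he
  | mul e f _ _ => simp [tame] at he
  | sub e f ihe _ => exact (Nat.sub_le _ _).trans (ihe he)
  | div e f ihe _ => exact (Nat.div_le_self _ _).trans (ihe he)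
  | mod e f ihe _ => exact (Nat.mod_le _ _).trans (ihe he)
  | lt e f _ _ => simp only [eval]; split <;> omega
  | eq e f _ _ => simp only [eval]; split <;> omega

/-- Products add exponents, and a sum of two bounds that are at least `2` is at most their product;
the remaining operations do not exceed their first operand, or `1`. -/
theorem eval_le {V : ℕ} (hV : 2 ≤ V) {s : RamState} (hs : s.Bounded V) (e : RamExpr)
    (he : e.smallLits = true) : e.eval s ≤ V ^ e.cost := by
  have mono : ∀ (e f : RamExpr), V ^ e.cost ≤ V ^ (e.cost + f.cost + 1) := fun e f =>
    Nat.pow_le_pow_right (by omega) (by omega)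
  have one : ∀ e : RamExpr, 2 ≤ V ^ e.cost := fun e =>
    hV.trans (Nat.le_self_pow (by have := e.one_le_cost; omega) V)
  induction e with
  | lit v => simp only [smallLits, decide_eq_true_eq] at he; simpa [cost, eval] using he.trans hV
  | reg x => simpa [cost, eval] using hs.1 x
  | get a e _ => exact (hs.2 _ _).trans (Nat.le_self_pow (by simp [cost]) V)
  | add e f ihe ihf =>
    simp only [smallLits, Bool.and_eq_true] at he
    have h1 := ihe he.1
    have h2 := ihf he.2
    have h3 := one e
    have h4 := one f
    simp only [eval, cost]
    have : V ^ e.cost + V ^ f.cost ≤ V ^ e.cost * V ^ f.cost := by nlinarith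
    have h5 : V ^ (e.cost + f.cost) ≤ V ^ (e.cost + f.cost + 1) :=
      Nat.pow_le_pow_right (by omega) (by omega)
    rw [pow_add] at h5
    omega
  | mul e f ihe ihf =>
    simp only [smallLits, Bool.and_eq_true] at he
    have h5 : V ^ (e.cost + f.cost) ≤ V ^ (e.cost + f.cost + 1) :=
      Nat.pow_le_pow_right (by omega) (by omega)
    rw [pow_add] at h5
    exact (Nat.mul_le_mul (ihe he.1) (ihf he.2)).trans h5
  | sub e f ihe _ =>
    simp only [smallLits, Bool.and_eq_true] at he
    exact (Nat.sub_le _ _).trans ((ihe he.1).trans (mono e f))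
  | div e f ihe _ =>
    simp only [smallLits, Bool.and_eq_true] at he
    exact (Nat.div_le_self _ _).trans ((ihe he.1).trans (mono e f))
  | mod e f ihe _ =>
    simp only [smallLits, Bool.and_eq_true] at he
    exact (Nat.mod_le _ _).trans ((ihe he.1).trans (mono e f))
  | lt e f _ _ =>
    have := (one e).trans (mono e f)
    simp only [eval, cost]
    split <;> omega
  | eq e f _ _ =>
    have := (one e).trans (mono e f)
    simp only [eval, cost]
    split <;> omega

/-- Subexpressions are cheaper than the whole, so `eval_le` bounds every intermediate value by the
same power of `V`. With this, word overflow reduces to a syntactic check. -/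
theorem fits_of_cost_le {V w n : ℕ} (hV : 2 ≤ V) (hw : V ^ n < 2 ^ w) {s : RamState}
    (hs : s.Bounded V) (e : RamExpr) (he : e.smallLits = true) (hn : e.cost ≤ n) :
    e.Fits w s := by
  have key : ∀ e : RamExpr, e.smallLits = true → e.cost ≤ n → e.eval s < 2 ^ w := fun e he hn =>
    ((eval_le hV hs e he).trans (Nat.pow_le_pow_right (by omega) hn)).trans_lt hw
  have one : ∀ e : RamExpr, e.cost ≤ n → 1 < 2 ^ w := fun e hn => by
    have h1 : V ^ 1 ≤ V ^ n := Nat.pow_le_pow_right (by omega) (e.one_le_cost.trans hn)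
    rw [pow_one] at h1
    omega
  induction e with
  | lit v => exact key _ he hn
  | reg x => exact key _ he hn
  | get a e ih => exact ⟨ih he (by simp only [cost] at hn; omega), key _ he hn⟩
  | add e f ihe ihf =>
    have he' := he
    simp only [smallLits, Bool.and_eq_true] at he'
    have hn' := hn
    simp only [cost] at hn'
    exact ⟨ihe he'.1 (by omega), ihf he'.2 (by omega), key _ he hn⟩
  | mul e f ihe ihf =>
    have he' := he
    simp only [smallLits, Bool.and_eq_true] at he'
    have hn' := hn
    simp only [cost] at hn'
    exact ⟨ihe he'.1 (by omega), ihf he'.2 (by omega), key _ he hn⟩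
  | sub e f ihe ihf =>
    simp only [smallLits, Bool.and_eq_true] at he
    simp only [cost] at hn
    exact ⟨ihe he.1 (by omega), ihf he.2 (by omega)⟩
  | div e f ihe ihf =>
    simp only [smallLits, Bool.and_eq_true] at he
    simp only [cost] at hn
    exact ⟨ihe he.1 (by omega), ihf he.2 (by omega)⟩
  | mod e f ihe ihf =>
    simp only [smallLits, Bool.and_eq_true] at he
    simp only [cost] at hn
    exact ⟨ihe he.1 (by omega), ihf he.2 (by omega)⟩
  | lt e f ihe ihf =>
    simp only [smallLits, Bool.and_eq_true] at he
    have h1 := one _ hn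
    simp only [cost] at hn
    exact ⟨ihe he.1 (by omega), ihf he.2 (by omega), h1⟩
  | eq e f ihe ihf =>
    simp only [smallLits, Bool.and_eq_true] at he
    have h1 := one _ hn
    simp only [cost] at hn
    exact ⟨ihe he.1 (by omega), ihf he.2 (by omega), h1⟩

end RamExpr

/-! ### Frame conditions -/

namespace RamProg

/-- Whether the program contains an assignment to register `x`. -/
def writesReg (x : ℕ) : RamProg → Bool
  | skip => false
  | assign y _ => Nat.beq x y
  | store _ _ _ => false
  | seq c c' => c.writesReg x || c'.writesReg x
  | cond _ c c' => c.writesReg x || c'.writesReg x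
  | loop _ c => c.writesReg x

/-- Whether the program contains a store to array `a`. -/
def writesArr (a : ℕ) : RamProg → Bool
  | skip => false
  | assign _ _ => false
  | store b _ _ => Nat.beq a b
  | seq c c' => c.writesArr a || c'.writesArr a
  | cond _ c c' => c.writesArr a || c'.writesArr a
  | loop _ c => c.writesArr a

/-- The two states agree on everything that the program does not write syntactically. -/
def Frame (c : RamProg) (s s' : RamState) : Prop :=
  (∀ x, c.writesReg x = false → s'.reg x = s.reg x) ∧
    ∀ a, c.writesArr a = false → s'.arr a = s.arr a

theorem Frame.refl (c : RamProg) (s : RamState) : c.Frame s s :=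
  ⟨fun _ _ => rfl, fun _ _ => rfl⟩

theorem Frame.trans {c : RamProg} {s s' s'' : RamState} (h : c.Frame s s') (h' : c.Frame s' s'') :
    c.Frame s s'' :=
  ⟨fun x hx => (h'.1 x hx).trans (h.1 x hx), fun a ha => (h'.2 a ha).trans (h.2 a ha)⟩

theorem Frame.mono {c c' : RamProg} {s s' : RamState} (h : c.Frame s s')
    (hr : ∀ x, c'.writesReg x = false → c.writesReg x = false)
    (ha : ∀ a, c'.writesArr a = false → c.writesArr a = false) : c'.Frame s s' :=
  ⟨fun x hx => h.1 x (hr x hx), fun a h' => h.2 a (ha a h')⟩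

end RamProg

/-- The write sets are computed by evaluation, so that later frame conditions hold by `rfl` and loop
invariants need to mention only what changes. -/
theorem RamExec.frame {w : ℕ} {c : RamProg} {s s' : RamState} {t : ℕ} (h : RamExec w c s t s') :
    c.Frame s s' := by
  induction h with
  | skip s => exact .refl _ _
  | assign s x e he =>
    refine ⟨fun y hy => ?_, fun _ _ => rfl⟩
    rw [RamState.setReg_reg, if_neg]
    rintro rfl
    simp [RamProg.writesReg] at hy
  | store s a e f he hf =>
    refine ⟨fun _ _ => rfl, fun b hb => ?_⟩
    rw [RamState.setArr_arr, if_neg]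
    rintro rfl
    simp [RamProg.writesArr] at hb
  | seq h h' ih ih' =>
    exact (ih.mono (by simp +contextual [RamProg.writesReg])
      (by simp +contextual [RamProg.writesArr])).trans
      (ih'.mono (by simp +contextual [RamProg.writesReg])
        (by simp +contextual [RamProg.writesArr]))
  | cond_true he h0 h ih =>
    exact ih.mono (by simp +contextual [RamProg.writesReg])
      (by simp +contextual [RamProg.writesArr])
  | cond_false he h0 h ih =>
    exact ih.mono (by simp +contextual [RamProg.writesReg])
      (by simp +contextual [RamProg.writesArr])
  | loop_true he h0 h h' ih ih' =>
    exact (ih.mono (by simp [RamProg.writesReg]) (by simp [RamProg.writesArr])).trans ih'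
  | loop_false he h0 => exact .refl _ _

/-! ### Program triples with time bounds -/

/-- The memory bound `V` is compatible with words of `w` bits. -/
structure RamBound (V w : ℕ) : Prop where
  two_le : 2 ≤ V
  lt : V ^ 64 < 2 ^ w

/-- Started in `s`, the program halts within `T` steps in a state that satisfies `Q`,
and the memory stays bounded by `V`. -/
def Run (V w : ℕ) (c : RamProg) (s : RamState) (T : ℕ) (Q : RamState → Prop) : Prop :=
  s.Bounded V → ∃ t s', RamExec w c s t s' ∧ t ≤ T ∧ s'.Bounded V ∧ Q s'

namespace Run

variable {V w : ℕ}

theorem fits (hw : RamBound V w) {s : RamState} (hs : s.Bounded V) {e : RamExpr}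
    (he : e.ok = true) : e.Fits w s := by
  simp only [RamExpr.ok, Bool.and_eq_true, decide_eq_true_eq] at he
  exact RamExpr.fits_of_cost_le hw.two_le hw.lt hs e he.1 he.2

theorem cost_le {e : RamExpr} (he : e.ok = true) : e.cost ≤ 64 := by
  simp only [RamExpr.ok, Bool.and_eq_true, decide_eq_true_eq] at he
  exact he.2

/-- The frame condition and the memory bound hold after every run, so the new postcondition may be
derived from them as well. -/
theorem conseq {c : RamProg} {s : RamState} {T T' : ℕ} {Q Q' : RamState → Prop}
    (h : Run V w c s T Q) (hT : T ≤ T')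
    (hQ : ∀ s', Q s' → c.Frame s s' → s'.Bounded V → Q' s') : Run V w c s T' Q' := by
  intro hs
  obtain ⟨t, s', he, ht, hb, hq⟩ := h hs
  exact ⟨t, s', he, ht.trans hT, hb, hQ s' hq he.frame hb⟩

theorem le {c : RamProg} {s : RamState} {T T' : ℕ} {Q : RamState → Prop}
    (h : Run V w c s T Q) (hT : T ≤ T') : Run V w c s T' Q :=
  h.conseq hT fun _ hq _ _ => hq

theorem skip {s : RamState} {Q : RamState → Prop} (h : Q s) : Run V w .skip s 1 Q :=
  fun hs => ⟨1, s, .skip s, le_rfl, hs, h⟩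

theorem assign (hw : RamBound V w) {s : RamState} {x : ℕ} {e : RamExpr} {Q : RamState → Prop}
    (he : e.ok = true) (hv : s.Bounded V → e.eval s ≤ V) (h : Q (s.setReg x (e.eval s))) :
    Run V w (.assign x e) s 65 Q :=
  fun hs => ⟨_, _, .assign s x e (fits hw hs he), by have := cost_le he; omega,
    hs.setReg (hv hs), h⟩

theorem store (hw : RamBound V w) {s : RamState} {a : ℕ} {e f : RamExpr} {Q : RamState → Prop}
    (he : e.ok = true) (hf : f.ok = true) (hv : s.Bounded V → f.eval s ≤ V)
    (h : Q (s.setArr a (e.eval s) (f.eval s))) :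
    Run V w (.store a e f) s 129 Q :=
  fun hs => ⟨_, _, .store s a e f (fits hw hs he) (fits hw hs hf), by
    have := cost_le he; have := cost_le hf; omega, hs.setArr (hv hs), h⟩

/-- Values of tame expressions are automatically bounded. -/
theorem tame (hw : RamBound V w) {s : RamState} {e : RamExpr} (he : e.tame = true) :
    s.Bounded V → e.eval s ≤ V := fun hs => RamExpr.eval_le_of_tame hw.two_le hs e he

theorem seq {c c' : RamProg} {s : RamState} {T T' : ℕ} {Q Q' : RamState → Prop}
    (h : Run V w c s T Q)
    (h' : ∀ s', Q s' → c.Frame s s' → s'.Bounded V → Run V w c' s' T' Q') :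
    Run V w (.seq c c') s (T + T') Q' := by
  intro hs
  obtain ⟨t, s', he, ht, hb, hq⟩ := h hs
  obtain ⟨t', s'', he', ht', hb', hq'⟩ := h' s' hq he.frame hb hb
  exact ⟨_, _, .seq he he', by omega, hb', hq'⟩

/-- The time bound adds both branches instead of taking their maximum; this costs only a constant
factor and keeps the bounds linear. -/
theorem cond (hw : RamBound V w) {e : RamExpr} {c c' : RamProg} {s : RamState} {T : ℕ}
    {T' : ℕ} {Q : RamState → Prop} (he : e.ok = true)
    (h : e.eval s ≠ 0 → Run V w c s T Q) (h' : e.eval s = 0 → Run V w c' s T' Q) :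
    Run V w (.cond e c c') s (65 + (T + T')) Q := by
  intro hs
  have hc := cost_le he
  by_cases h0 : e.eval s = 0
  · obtain ⟨t, s', hx, ht, hb, hq⟩ := h' h0 hs
    exact ⟨_, _, .cond_false (fits hw hs he) h0 hx, by omega, hb, hq⟩
  · obtain ⟨t, s', hx, ht, hb, hq⟩ := h h0 hs
    exact ⟨_, _, .cond_true (fits hw hs he) h0 hx, by omega, hb, hq⟩

end Run

/-- `for i < e do c`; the bound `e` must not change and `c` must not write the register `i`. -/
def RamProg.count (i : ℕ) (e : RamExpr) (c : RamProg) : RamProg :=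
  .seq (.assign i (.lit 0))
    (.loop (.lt (.reg i) e) (.seq c (.assign i (.add (.reg i) (.lit 1)))))

/-- The invariant is stated at the loop head, hence the body must establish it for the state in
which the counter has already been raised. The frame relative to `s₀` makes the loop bound evaluate
to `n` throughout, and tameness of `e` gives `n ≤ V`, so that the counter stays within the memory
bound. The `200` covers test and increment. -/
theorem Run.count {V w : ℕ} (hw : RamBound V w) {i : ℕ} {e : RamExpr} {c : RamProg}
    {s₀ : RamState} {T : ℕ} {Q : RamState → Prop} (n : ℕ) (Inv : ℕ → RamState → Prop)
    (hi : c.writesReg i = false) (he : (RamExpr.lt (.reg i) e).ok = true)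
    (het : e.tame = true)
    (hen : ∀ s, (RamProg.count i e c).Frame s₀ s → e.eval s = n)
    (h0 : Inv 0 (s₀.setReg i 0))
    (hstep : ∀ j < n, ∀ s, Inv j s → s.reg i = j → (RamProg.count i e c).Frame s₀ s →
      s.Bounded V → Run V w c s T fun s' => Inv (j + 1) (s'.setReg i (j + 1)))
    (hQ : ∀ s, Inv n s → s.reg i = n → (RamProg.count i e c).Frame s₀ s → Q s) :
    Run V w (RamProg.count i e c) s₀ (n * (T + 200) + 200) Q := by
  intro hs
  have hn : n ≤ V := hen s₀ (.refl _ _) ▸ Run.tame hw het hs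
  -- Induction on the number `m` of remaining rounds.
  have key : ∀ m j, j + m = n → ∀ s, Inv j s → s.reg i = j →
      (RamProg.count i e c).Frame s₀ s → s.Bounded V → ∃ t s',
      RamExec w (.loop (.lt (.reg i) e) (.seq c (.assign i (.add (.reg i) (.lit 1))))) s t s' ∧
      t ≤ m * (T + 200) + 65 ∧ s'.Bounded V ∧ Q s' := by
    intro m
    induction m with
    | zero =>
      intro j hj s hI hr hF hb
      obtain rfl : j = n := by omega
      refine ⟨_, s, .loop_false (Run.fits hw hb he) ?_, ?_, hb, hQ s hI hr hF⟩
      · simp [RamExpr.eval, hen s hF, hr]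
      · have := Run.cost_le he; omega
    | succ m ih =>
      intro j hj s hI hr hF hb
      obtain ⟨t, s₁, hx, ht, hb₁, hI₁⟩ := hstep j (by omega) s hI hr hF hb hb
      have hF₁ := hx.frame
      have hr₁ : s₁.reg i = j := (hF₁.1 i hi).trans hr
      have hx₂ : RamExec w (.assign i (.add (.reg i) (.lit 1))) s₁ 4 (s₁.setReg i (j + 1)) := by
        have h := RamExec.assign s₁ i (.add (.reg i) (.lit 1)) (Run.fits hw hb₁ rfl)
        simpa [RamExpr.eval, RamExpr.cost, hr₁] using h
      have hb₂ : (s₁.setReg i (j + 1)).Bounded V := hb₁.setReg (by omega)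
      have hx₃ := RamExec.seq hx hx₂
      have hF₂ : (RamProg.count i e c).Frame s₀ (s₁.setReg i (j + 1)) := by
        refine hF.trans (hx₃.frame.mono ?_ ?_)
        · intro x h; simp [RamProg.count, RamProg.writesReg] at h ⊢; tauto
        · intro x h; simp [RamProg.count, RamProg.writesArr] at h ⊢; tauto
      obtain ⟨t', s', hx', ht', hb', hq'⟩ := ih (j + 1) (by omega) _ hI₁ (by simp) hF₂ hb₂
      refine ⟨_, s', .loop_true (Run.fits hw hb he) ?_ hx₃ hx', ?_, hb', hq'⟩
      · have : j < n := by omega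
        simp [RamExpr.eval, hen s hF, hr, this]
      · have := Run.cost_le he
        rw [Nat.add_mul]
        omega
  have hx₁ : RamExec w (.assign i (.lit 0)) s₀ 2 (s₀.setReg i 0) :=
    RamExec.assign s₀ i (.lit 0) (Run.fits hw hs rfl)
  have hF₁ : (RamProg.count i e c).Frame s₀ (s₀.setReg i 0) := by
    refine hx₁.frame.mono ?_ ?_
    · intro x h; simp [RamProg.count, RamProg.writesReg] at h ⊢; tauto
    · intro x h; simp [RamProg.writesArr] at h ⊢
  obtain ⟨t, s', hx, ht, hb, hq⟩ := key n 0 (by omega) _ h0 (by simp) hF₁ (hs.setReg (by omega))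
  exact ⟨_, s', .seq hx₁ hx, by omega, hb, hq⟩

/-! ### Labels and rectangles of a decomposition -/

namespace Decomposition

variable {π : PointPerm} (D : Decomposition π)

/-- A label in use is a point or was created by an earlier step. So labels are never reused, and a
rectangle can be attached to a label independently of time. -/
theorem lt_step_k_of_mem {p : ℕ} (hp : p < D.s) :
    ∀ {q : ℕ}, q ≤ p → ∀ {y : ℕ}, y ∈ (D.fam q).S → y < (D.step p).k := by
  intro q
  induction q with
  | zero =>
    intro _ y hy
    rw [D.start] at hy
    exact D.fresh p hp y hy
  | succ q ih =>
    intro hq y hy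
    rw [D.next q (by omega)] at hy
    simp only [RectFamily.merge, Finset.mem_insert, Finset.mem_erase] at hy
    rcases hy with rfl | ⟨_, _, hy⟩
    · exact D.increasing q p (by omega) hp
    · exact ih (by omega) hy

theorem card_fam {p : ℕ} (hp : p ≤ D.s) : (D.fam p).S.card + p = π.length := by
  induction p with
  | zero => rw [D.start]; rfl
  | succ p ih =>
    have hp' : p < D.s := hp
    have hk : (D.step p).k ∉ (D.fam p).S := fun h => (D.lt_step_k_of_mem hp' le_rfl h).ne rfl
    have hj : (D.step p).j ∈ (D.fam p).S.erase (D.step p).i :=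
      Finset.mem_erase.2 ⟨(D.ne p hp').symm, D.mem_j p hp'⟩
    rw [← ih hp'.le, D.next p hp']
    simp only [RectFamily.merge]
    rw [Finset.card_insert_of_notMem (fun h => hk (Finset.mem_of_mem_erase
      (Finset.mem_of_mem_erase h))), Finset.card_erase_of_mem hj,
      Finset.card_erase_of_mem (D.mem_i p hp')]
    have := Finset.card_pos.2 ⟨_, hj⟩
    rw [Finset.card_erase_of_mem (D.mem_i p hp')] at this
    omega

theorem s_add_one : D.s + 1 = π.length := by
  rw [← D.card_fam le_rfl, D.final, add_comm]

theorem mem_fam {p : ℕ} (hp : p ≤ D.s) {y : ℕ} (hy : y ∈ (D.fam p).S) :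
    y ∈ π.S ∨ ∃ q < p, y = (D.step q).k := by
  induction p with
  | zero => rw [D.start] at hy; exact .inl hy
  | succ p ih =>
    rw [D.next p hp] at hy
    simp only [RectFamily.merge, Finset.mem_insert, Finset.mem_erase] at hy
    rcases hy with rfl | ⟨_, _, hy⟩
    · exact .inr ⟨p, by omega, rfl⟩
    · rcases ih (by omega) hy with h | ⟨q, hq, rfl⟩
      · exact .inl h
      · exact .inr ⟨q, by omega, rfl⟩

/-- A rectangle that is still present and was not created since has been present before. -/
theorem mem_fam_of_mem {a b : ℕ} (hab : a ≤ b) (hb : b ≤ D.s) {y : ℕ} (hy : y ∈ (D.fam b).S)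
    (hne : ∀ r, a ≤ r → r < b → y ≠ (D.step r).k) : y ∈ (D.fam a).S := by
  induction b, hab using Nat.le_induction with
  | base => exact hy
  | succ b hab ih =>
    rw [D.next b hb] at hy
    simp only [RectFamily.merge, Finset.mem_insert, Finset.mem_erase] at hy
    rcases hy with h | ⟨_, _, hy⟩
    · exact absurd h (hne b hab (by omega))
    · exact ih (by omega) hy fun r h h' => hne r h (by omega)

theorem step_k_mem {p : ℕ} (hp : p < D.s) : (D.step p).k ∈ (D.fam (p + 1)).S := by
  rw [D.next p hp]
  exact Finset.mem_insert_self _ _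

theorem mem_fam_of_mem_succ {p : ℕ} (hp : p < D.s) {y : ℕ} (hy : y ∈ (D.fam (p + 1)).S)
    (hne : y ≠ (D.step p).k) : y ∈ (D.fam p).S :=
  D.mem_fam_of_mem (Nat.le_succ p) hp hy fun r h h' => by
    obtain rfl : r = p := by omega
    exact hne

theorem step_k_injective {p q : ℕ} (hp : p < D.s) (hq : q < D.s)
    (h : (D.step p).k = (D.step q).k) : p = q := by
  rcases lt_trichotomy p q with h' | h' | h'
  · exact absurd h (D.increasing p q h' hq).ne
  · exact h'
  · exact absurd h (D.increasing q p h' hp).ne'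

theorem step_k_le {p q : ℕ} (hpq : p ≤ q) (hq : q < D.s) : (D.step p).k ≤ (D.step q).k := by
  rcases hpq.lt_or_eq with h | rfl
  · exact (D.increasing p q h hq).le
  · exact le_rfl

/-- A merge overwrites only the value at its new label; values at discarded labels survive, which is
why `rect` can read them off the last family. -/
theorem R_stable {a b : ℕ} (hab : a ≤ b) (hb : b ≤ D.s) {y : ℕ}
    (hne : ∀ r, a ≤ r → r < b → y ≠ (D.step r).k) : (D.fam b).R y = (D.fam a).R y := by
  induction b, hab using Nat.le_induction with
  | base => rfl
  | succ b hab ih =>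
    rw [D.next b hb]
    simp only [RectFamily.merge]
    rw [Function.update_of_ne (hne b hab (by omega))]
    exact ih (by omega) fun r h h' => hne r h (by omega)

/-- The rectangle that belongs to a label at any time at which the label is in use. -/
def rect (y : ℕ) : Rect := (D.fam D.s).R y

theorem rect_eq {p : ℕ} (hp : p ≤ D.s) {y : ℕ} (hy : y ∈ (D.fam p).S) :
    D.rect y = (D.fam p).R y :=
  D.R_stable hp le_rfl fun _ h h' => (D.lt_step_k_of_mem h' h hy).ne

theorem rect_point {y : ℕ} (hy : y ∈ π.S) (α : Fin 2) :
    D.rect y α = NonemptyInterval.pure (π.P y α) := by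
  rw [D.rect_eq (Nat.zero_le _) (by rw [D.start]; exact hy), D.start]
  rfl

theorem rect_step {p : ℕ} (hp : p < D.s) :
    D.rect (D.step p).k = D.rect (D.step p).i ⊔ D.rect (D.step p).j := by
  rw [D.rect_eq hp (D.step_k_mem hp), D.rect_eq hp.le (D.mem_i p hp),
    D.rect_eq hp.le (D.mem_j p hp), D.next p hp]
  simp [RectFamily.merge]

/-- The lower end of a side of a rectangle. -/
def lo (α : Fin 2) (y : ℕ) : ℕ := (D.rect y α).fst

/-- The upper end of a side of a rectangle. -/
def hi (α : Fin 2) (y : ℕ) : ℕ := (D.rect y α).snd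

theorem lo_point {y : ℕ} (hy : y ∈ π.S) (α : Fin 2) : D.lo α y = π.P y α := by
  simp [lo, D.rect_point hy]

theorem hi_point {y : ℕ} (hy : y ∈ π.S) (α : Fin 2) : D.hi α y = π.P y α := by
  simp [hi, D.rect_point hy]

theorem lo_step {p : ℕ} (hp : p < D.s) (α : Fin 2) :
    D.lo α (D.step p).k = min (D.lo α (D.step p).i) (D.lo α (D.step p).j) := by
  simp [lo, D.rect_step hp]

theorem hi_step {p : ℕ} (hp : p < D.s) (α : Fin 2) :
    D.hi α (D.step p).k = max (D.hi α (D.step p).i) (D.hi α (D.step p).j) := by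
  simp [hi, D.rect_step hp]

/-- The rectangles of two labels view each other in direction `α`. -/
def Sees (α : Fin 2) (y z : ℕ) : Prop := D.lo α y ≤ D.hi α z ∧ D.lo α z ≤ D.hi α y

theorem views_iff_sees (α : Fin 2) (y z : ℕ) :
    Rect.Views α (D.rect y) (D.rect z) ↔ D.Sees α y z := by
  have h1 := (D.rect y α).fst_le_snd
  have h2 := (D.rect z α).fst_le_snd
  constructor
  · rintro ⟨x, hx, hx'⟩
    rw [NonemptyInterval.mem_def] at hx hx'
    exact ⟨hx.1.trans hx'.2, hx'.1.trans hx.2⟩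
  · rintro ⟨h, h'⟩
    refine ⟨max (D.lo α y) (D.lo α z), ?_, ?_⟩ <;> rw [NonemptyInterval.mem_def]
    · exact ⟨le_max_left _ _, max_le h1 h'⟩
    · exact ⟨le_max_right _ _, max_le h h2⟩

/-- Symmetry is what makes linkage of positions an undirected relation. -/
theorem Sees.symm {D : Decomposition π} {α : Fin 2} {y z : ℕ} (h : D.Sees α y z) : D.Sees α z y :=
  And.symm h

/-- `D.Contains y x`: the point `x` has been merged into the rectangle `y`. -/
inductive Contains : ℕ → ℕ → Prop
  | point {x : ℕ} : x ∈ π.S → Contains x x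
  | left {p x : ℕ} : p < D.s → Contains (D.step p).i x → Contains (D.step p).k x
  | right {p x : ℕ} : p < D.s → Contains (D.step p).j x → Contains (D.step p).k x

theorem Contains.mem {D : Decomposition π} {x y : ℕ} (h : D.Contains y x) : x ∈ π.S := by
  induction h <;> assumption

theorem Contains.bounds {D : Decomposition π} {x y : ℕ} (h : D.Contains y x) (α : Fin 2) :
    D.lo α y ≤ π.P x α ∧ π.P x α ≤ D.hi α y := by
  induction h with
  | point hx => rw [D.lo_point hx, D.hi_point hx]; exact ⟨le_rfl, le_rfl⟩
  | left hp _ ih => rw [D.lo_step hp, D.hi_step hp]; omega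
  | right hp _ ih => rw [D.lo_step hp, D.hi_step hp]; omega

/-- New labels differ from points and from each other, so the last constructor of the derivation
must belong to step `p`. -/
theorem contains_step {p x : ℕ} (hp : p < D.s) (h : D.Contains (D.step p).k x) :
    D.Contains (D.step p).i x ∨ D.Contains (D.step p).j x := by
  generalize hy : (D.step p).k = y at h
  cases h with
  | point hx => exact absurd hy (D.fresh p hp _ hx).ne'
  | left hq h =>
    obtain rfl := D.step_k_injective hp hq hy
    exact .inl h
  | right hq h =>
    obtain rfl := D.step_k_injective hp hq hy
    exact .inr h

theorem exists_contains {x : ℕ} (hx : x ∈ π.S) {p : ℕ} (hp : p ≤ D.s) :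
    ∃ y ∈ (D.fam p).S, D.Contains y x := by
  induction p with
  | zero => exact ⟨x, by rw [D.start]; exact hx, .point hx⟩
  | succ p ih =>
    obtain ⟨y, hy, hc⟩ := ih (by omega)
    by_cases hi : y = (D.step p).i
    · exact ⟨_, D.step_k_mem hp, .left hp (hi ▸ hc)⟩
    by_cases hj : y = (D.step p).j
    · exact ⟨_, D.step_k_mem hp, .right hp (hj ▸ hc)⟩
    refine ⟨y, ?_, hc⟩
    rw [D.next p hp]
    simp [RectFamily.merge, hi, hj, hy]

/-- The label of the last rectangle. -/
def top : ℕ := if D.s = 0 then π.length else (D.step (D.s - 1)).k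

theorem fam_last (hπ : π.Reduced) : (D.fam D.s).S = {D.top} := by
  obtain ⟨y, hy⟩ := Finset.card_eq_one.1 D.final
  rw [hy]
  by_cases h : D.s = 0
  · have h1 := D.s_add_one
    rw [h, D.start] at hy
    have h2 : (RectFamily.ofPerm π).S = π.S := rfl
    rw [h2, hπ.1, ← h1, h] at hy
    simp only [top, h, if_true, ← h1, zero_add]
    simpa using hy.symm
  · have h1 := D.step_k_mem (p := D.s - 1) (by omega)
    rw [Nat.sub_add_cancel (by omega), hy, Finset.mem_singleton] at h1
    simp [top, h, h1]

/-- This makes `top + 1` usable as a base for encoding pairs of a number and a label in a single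
address. -/
theorem le_top (hπ : π.Reduced) {p : ℕ} (hp : p ≤ D.s) {y : ℕ} (hy : y ∈ (D.fam p).S) :
    y ≤ D.top := by
  rcases D.mem_fam hp hy with h | ⟨q, hq, rfl⟩
  · by_cases hs : D.s = 0
    · rw [hπ.1, Finset.mem_Icc] at h
      simp [top, hs, h.2]
    · simp only [top, hs, if_false]
      exact (D.fresh _ (by omega) y h).le
  · have hs : D.s ≠ 0 := by omega
    simp only [top, hs, if_false]
    exact D.step_k_le (by omega) (by omega)

theorem top_le : D.top ≤ π.length + D.maxLabel := by
  unfold top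
  split
  · omega
  · have : (D.step (D.s - 1)).k ≤ D.maxLabel :=
      Finset.le_sup (f := fun p => (D.step p).k) (Finset.mem_range.2 (by omega))
    omega

theorem pos_of_mem {p : ℕ} (hp : p ≤ D.s) {y : ℕ} (hy : y ∈ (D.fam p).S) : 0 < y := by
  rcases D.mem_fam hp hy with h | ⟨q, hq, rfl⟩
  · exact π.pos y h
  · exact (Nat.zero_le _).trans_lt (D.lt_step_k_of_mem (by omega) le_rfl (D.mem_i q (by omega)))

theorem length_lt_k (hπ : π.Reduced) {p : ℕ} (hp : p < D.s) : π.length < (D.step p).k := by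
  have := D.s_add_one
  exact D.fresh p hp _ (by rw [hπ.1, Finset.mem_Icc]; omega)

theorem mem_of_le_length (hπ : π.Reduced) {p : ℕ} (hp : p ≤ D.s) {y : ℕ} (hy : y ∈ (D.fam p).S)
    (h : y ≤ π.length) : y ∈ π.S := by
  rcases D.mem_fam hp hy with h' | ⟨q, hq, rfl⟩
  · exact h'
  · exact absurd h (D.length_lt_k hπ (by omega)).not_ge

/-! ### Partial assignments of pattern elements to rectangles

An assignment maps each of the positions `0, …, ℓ - 1` of the pattern to the label of a rectangle,
or to `0` if the position is not assigned. -/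

variable (σ : PointPerm)

/-- The assignment can be refined to an order-preserving assignment of points. -/
def Realizable (m : ℕ → ℕ) : Prop :=
  ∃ φ : ℕ → ℕ, (∀ q < σ.length, m q ≠ 0 → D.Contains (m q) (φ q)) ∧
    ∀ x < σ.length, ∀ y < σ.length, m x ≠ 0 → m y ≠ 0 → ∀ α : Fin 2,
      σ.P (x + 1) α < σ.P (y + 1) α → π.P (φ x) α < π.P (φ y) α

/-- No pair of rectangles contradicts the order of the pattern. -/
def Consistent (m : ℕ → ℕ) : Prop :=
  ∀ x < σ.length, ∀ y < σ.length, m x ≠ 0 → m y ≠ 0 → ∀ α : Fin 2,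
    σ.P (x + 1) α < σ.P (y + 1) α → D.lo α (m x) < D.hi α (m y)

/-- Two assigned positions whose rectangles view each other. -/
def Link (m : ℕ → ℕ) (x y : ℕ) : Prop :=
  x < σ.length ∧ y < σ.length ∧ m x ≠ 0 ∧ m y ≠ 0 ∧ ∃ α, D.Sees α (m x) (m y)

def Joined (m : ℕ → ℕ) : ℕ → ℕ → Prop := Relation.ReflTransGen (D.Link σ m)

open Classical in
/-- The restriction of an assignment to the connected component of a position. -/
noncomputable def comp (m : ℕ → ℕ) (r q : ℕ) : ℕ := if D.Joined σ m r q then m q else 0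

variable {D σ}

theorem Link.symm {m : ℕ → ℕ} {x y : ℕ} (h : D.Link σ m x y) : D.Link σ m y x := by
  obtain ⟨h1, h2, h3, h4, α, h5⟩ := h
  exact ⟨h2, h1, h4, h3, α, h5.symm⟩

theorem Joined.symm {m : ℕ → ℕ} {x y : ℕ} (h : D.Joined σ m x y) : D.Joined σ m y x := by
  induction h with
  | refl => exact .refl
  | tail _ h ih => exact .head h.symm ih

theorem comp_of_joined {m : ℕ → ℕ} {r q : ℕ} (h : D.Joined σ m r q) : D.comp σ m r q = m q :=
  if_pos h

theorem joined_of_comp {m : ℕ → ℕ} {r q : ℕ} (h : D.comp σ m r q ≠ 0) : D.Joined σ m r q := by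
  by_contra h'
  exact h (if_neg h')

theorem comp_eq {m : ℕ → ℕ} {r q : ℕ} (h : D.comp σ m r q ≠ 0) : D.comp σ m r q = m q :=
  comp_of_joined (joined_of_comp h)

theorem comp_congr {m : ℕ → ℕ} {r r' : ℕ} (h : D.Joined σ m r r') :
    D.comp σ m r = D.comp σ m r' := by
  funext q
  have : D.Joined σ m r q ↔ D.Joined σ m r' q := ⟨fun h' => h.symm.trans h', fun h' => h.trans h'⟩
  by_cases h' : D.Joined σ m r q
  · rw [comp_of_joined h', comp_of_joined (this.1 h')]
  · rw [comp, comp, if_neg h', if_neg (this.not.1 h')]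

variable (D σ) in
/-- All assigned positions are joined. -/
def Connected (m : ℕ → ℕ) : Prop :=
  ∀ x < σ.length, ∀ y < σ.length, m x ≠ 0 → m y ≠ 0 → D.Joined σ m x y

/-- A path of links starting at `r` stays among the positions on which the restriction agrees with
`m`, so each of its links survives. -/
theorem connected_comp (m : ℕ → ℕ) (r : ℕ) : D.Connected σ (D.comp σ m r) := by
  have key : ∀ x, D.Joined σ m r x → D.Joined σ (D.comp σ m r) r x := by
    intro x hx
    induction hx with
    | refl => exact .refl
    | tail h h' ih =>
      refine ih.tail ?_
      obtain ⟨h1, h2, h3, h4, h5⟩ := h'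
      refine ⟨h1, h2, ?_, ?_, ?_⟩ <;>
        simpa only [comp_of_joined h, comp_of_joined (h.tail ⟨h1, h2, h3, h4, h5⟩)]
  intro x _ y _ hx hy
  exact (key x (joined_of_comp hx)).symm.trans (key y (joined_of_comp hy))

theorem Realizable.consistent {m : ℕ → ℕ} (h : D.Realizable σ m) : D.Consistent σ m := by
  obtain ⟨φ, h1, h2⟩ := h
  intro x hx y hy hmx hmy α hlt
  exact ((h1 x hx hmx).bounds α).1.trans_lt
    ((h2 x hx y hy hmx hmy α hlt).trans_le ((h1 y hy hmy).bounds α).2)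

theorem Realizable.comp {m : ℕ → ℕ} (h : D.Realizable σ m) (r : ℕ) :
    D.Realizable σ (D.comp σ m r) := by
  obtain ⟨φ, h1, h2⟩ := h
  refine ⟨φ, fun q hq hc => ?_, fun x hx y hy hcx hcy => ?_⟩
  · have := comp_eq hc
    rw [this] at hc ⊢
    exact h1 q hq hc
  · rw [comp_eq hcx] at hcx
    rw [comp_eq hcy] at hcy
    exact h2 x hx y hy hcx hcy

/-- Points are chosen separately for each component. Positions in different components have disjoint
projections, and there consistency forces the whole first interval below the second one. -/
theorem realizable_of_comp {m : ℕ → ℕ} (hc : D.Consistent σ m)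
    (h : ∀ r < σ.length, D.Realizable σ (D.comp σ m r)) : D.Realizable σ m := by
  classical
  -- The choice depends on the restricted assignment and not on the root `r`: joined positions have
  -- equal restrictions by `comp_congr`, hence use the same realization.
  let choice : (ℕ → ℕ) → ℕ → ℕ := fun c => if h : D.Realizable σ c then h.choose else id
  have hch : ∀ c, D.Realizable σ c → (∀ q < σ.length, c q ≠ 0 → D.Contains (c q) (choice c q)) ∧
      ∀ x < σ.length, ∀ y < σ.length, c x ≠ 0 → c y ≠ 0 → ∀ α : Fin 2,
      σ.P (x + 1) α < σ.P (y + 1) α → π.P (choice c x) α < π.P (choice c y) α := by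
    intro c hc
    have : choice c = hc.choose := dif_pos hc
    rw [this]
    exact hc.choose_spec
  have hself : ∀ q, D.comp σ m q q = m q := fun q => comp_of_joined .refl
  have hin : ∀ q < σ.length, m q ≠ 0 → D.Contains (m q) (choice (D.comp σ m q) q) := by
    intro q hq hm
    have := (hch _ (h q hq)).1 q hq
    rw [hself] at this
    exact this hm
  refine ⟨fun q => choice (D.comp σ m q) q, hin, fun x hx y hy hmx hmy α hlt => ?_⟩
  by_cases hj : D.Joined σ m x y
  · have h1 := (hch _ (h x hx)).2 x hx y hy
    rw [hself, comp_of_joined hj] at h1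
    have h2 := h1 hmx hmy α hlt
    simp only
    rw [← comp_congr hj]
    exact h2
  · have hs : ¬ D.Sees α (m x) (m y) := fun hs => hj (.single ⟨hx, hy, hmx, hmy, α, hs⟩)
    have h1 := hc x hx y hy hmx hmy α hlt
    have h2 := (hin x hx hmx).bounds α
    have h3 := (hin y hy hmy).bounds α
    simp only [Sees, not_and_or] at hs
    simp only
    omega

/-- For degenerate rectangles both ends are the coordinate itself, and consistency says literally
that the order is preserved. This is the base of the recursion. -/
theorem realizable_of_points {m : ℕ → ℕ} (hm : ∀ q < σ.length, m q ≠ 0 → m q ∈ π.S)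
    (hc : D.Consistent σ m) : D.Realizable σ m := by
  refine ⟨m, fun q hq h => .point (hm q hq h), fun x hx y hy hx' hy' α hlt => ?_⟩
  have := hc x hx y hy hx' hy' α hlt
  rwa [D.lo_point (hm x hx hx'), D.hi_point (hm y hy hy')] at this

theorem Consistent.comp {m : ℕ → ℕ} (h : D.Consistent σ m) (r : ℕ) :
    D.Consistent σ (D.comp σ m r) := by
  intro x hx y hy hcx hcy
  have h1 := comp_eq hcx
  have h2 := comp_eq hcy
  rw [h1] at hcx ⊢
  rw [h2] at hcy ⊢
  exact h x hx y hy hcx hcy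

/-- Assignments are read from arrays whose contents are controlled only below `ℓ`; hence this and
the following congruence lemmas. -/
theorem Realizable.congr {m m' : ℕ → ℕ} (h : D.Realizable σ m) (hm : ∀ q < σ.length, m q = m' q) :
    D.Realizable σ m' := by
  obtain ⟨φ, h1, h2⟩ := h
  refine ⟨φ, fun q hq => ?_, fun x hx y hy => ?_⟩
  · rw [← hm q hq]; exact h1 q hq
  · rw [← hm x hx, ← hm y hy]; exact h2 x hx y hy

theorem Link.congr {m m' : ℕ → ℕ} {x y : ℕ} (h : D.Link σ m x y)
    (hm : ∀ q < σ.length, m q = m' q) : D.Link σ m' x y := by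
  obtain ⟨h1, h2, h3⟩ := h
  rw [hm x h1, hm y h2] at h3
  exact ⟨h1, h2, h3⟩

theorem joined_congr {m m' : ℕ → ℕ} (hm : ∀ q < σ.length, m q = m' q) (x y : ℕ) :
    D.Joined σ m x y ↔ D.Joined σ m' x y :=
  ⟨Relation.ReflTransGen.mono (fun _ _ (h : D.Link σ m _ _) => h.congr hm) x y,
    Relation.ReflTransGen.mono
      (fun _ _ (h : D.Link σ m' _ _) => h.congr fun q hq => (hm q hq).symm) x y⟩

theorem Connected.congr {m m' : ℕ → ℕ} (h : D.Connected σ m) (hm : ∀ q < σ.length, m q = m' q) :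
    D.Connected σ m' := by
  intro x hx y hy
  rw [← hm x hx, ← hm y hy, ← joined_congr hm]
  exact h x hx y hy

/-! ### Splitting the most recent rectangle -/

variable (D) in
/-- Undo the merge `p`: the positions in the new rectangle are distributed over its two parts,
according to the binary digits of `b`. -/
def split (p b : ℕ) (m : ℕ → ℕ) (q : ℕ) : ℕ :=
  if m q = (D.step p).k then (if b.testBit q then (D.step p).i else (D.step p).j) else m q

theorem Realizable.of_split {m : ℕ → ℕ} {p b : ℕ} (hp : p < D.s)
    (h : D.Realizable σ (D.split p b m)) : D.Realizable σ m := by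
  have hi := (D.pos_of_mem hp.le (D.mem_i p hp)).ne'
  have hj := (D.pos_of_mem hp.le (D.mem_j p hp)).ne'
  have hne : ∀ q, m q ≠ 0 → D.split p b m q ≠ 0 := by
    intro q hq
    unfold split
    split_ifs <;> assumption
  obtain ⟨φ, h1, h2⟩ := h
  refine ⟨φ, fun q hq hm => ?_, fun x hx y hy hmx hmy =>
    h2 x hx y hy (hne x hmx) (hne y hmy)⟩
  have h3 := h1 q hq (hne q hm)
  unfold split at h3
  split_ifs at h3 with h4 h5
  · rw [h4]; exact .left hp h3
  · rw [h4]; exact .right hp h3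
  · exact h3

theorem Realizable.exists_split {m : ℕ → ℕ} {p : ℕ} (hp : p < D.s) (h : D.Realizable σ m) :
    ∃ b < 2 ^ σ.length, D.Realizable σ (D.split p b m) := by
  classical
  obtain ⟨φ, h1, h2⟩ := h
  -- The realizing points themselves dictate the split: digit `q` records whether the point of `q`
  -- lies in the first part.
  refine ⟨Nat.ofBits fun q : Fin σ.length => decide (D.Contains (D.step p).i (φ q)),
    Nat.ofBits_lt_two_pow _, φ, fun q hq hm => ?_, fun x hx y hy hmx hmy => ?_⟩
  · unfold split at hm ⊢
    rw [Nat.testBit_ofBits_lt _ _ hq] at hm ⊢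
    by_cases hk : m q = (D.step p).k
    · have h3 := h1 q hq (by rw [hk]; exact (D.pos_of_mem hp (D.step_k_mem hp)).ne')
      rw [hk] at h3
      by_cases h4 : D.Contains (D.step p).i (φ q)
      · simp [hk, h4]
      · simpa [hk, h4] using (D.contains_step hp h3).resolve_left h4
    · simp only [hk, if_false] at hm ⊢
      exact h1 q hq hm
  · have key : ∀ (b q : ℕ), D.split p b m q ≠ 0 → m q ≠ 0 := by
      intro b q hq h0
      unfold split at hq
      rw [h0, if_neg (D.pos_of_mem hp (D.step_k_mem hp)).ne] at hq
      exact hq rfl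
    exact h2 x hx y hy (key _ x hmx) (key _ y hmy)

/-! ### Connected assignments -/

variable (D σ) in
/-- A connected assignment to rectangles present after step `p` that uses the new one. -/
structure Good (p : ℕ) (m : ℕ → ℕ) : Prop where
  mem : ∀ q < σ.length, m q ≠ 0 → m q ∈ (D.fam (p + 1)).S
  uses : ∃ q < σ.length, m q = (D.step p).k
  connected : D.Connected σ m

theorem Good.congr {p : ℕ} {m m' : ℕ → ℕ} (h : D.Good σ p m) (hm : ∀ q < σ.length, m q = m' q) :
    D.Good σ p m' := by
  refine ⟨fun q hq => ?_, ?_, h.connected.congr hm⟩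
  · rw [← hm q hq]; exact h.mem q hq
  · obtain ⟨q, hq, h'⟩ := h.uses
    exact ⟨q, hq, (hm q hq).symm.trans h'⟩

theorem Good.le {p : ℕ} (hp : p < D.s) {m : ℕ → ℕ} (h : D.Good σ p m) {q : ℕ} (hq : q < σ.length) :
    m q ≤ (D.step p).k := by
  by_cases h0 : m q = 0
  · omega
  · by_contra hlt
    have h1 := D.mem_fam_of_mem_succ hp (h.mem q hq h0) (by omega)
    exact hlt (D.lt_step_k_of_mem hp le_rfl h1).le

/-- The step is determined by the largest label of the assignment, so every assignment belongs to a
single bucket. -/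
theorem Good.unique {p p' : ℕ} (hp : p < D.s) (hp' : p' < D.s) {m : ℕ → ℕ} (h : D.Good σ p m)
    (h' : D.Good σ p' m) : p = p' := by
  obtain ⟨q, hq, hk⟩ := h.uses
  obtain ⟨q', hq', hk'⟩ := h'.uses
  have h1 := h.le hp hq'
  have h2 := h'.le hp' hq
  exact D.step_k_injective hp hp' (by omega)

theorem Good.lt_of_lt {p p' : ℕ} (hp' : p' < D.s) {m : ℕ → ℕ} (h : D.Good σ p' m)
    (hlt : ∀ q < σ.length, m q < (D.step p).k) : p' < p := by
  obtain ⟨q, hq, hk⟩ := h.uses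
  by_contra hge
  have := D.step_k_le (p := p) (q := p') (by omega) hp'
  have := hlt q hq
  omega

theorem Good.split_mem {p : ℕ} (hp : p < D.s) {m : ℕ → ℕ} (h : D.Good σ p m) (b : ℕ) :
    ∀ q < σ.length, D.split p b m q ≠ 0 → D.split p b m q ∈ (D.fam p).S := by
  intro q hq
  unfold split
  split_ifs with h1 h2
  · exact fun _ => D.mem_i p hp
  · exact fun _ => D.mem_j p hp
  · exact fun h0 => D.mem_fam_of_mem_succ hp (h.mem q hq h0) h1

/-- This strict decrease makes the recursion well founded. -/
theorem Good.split_lt {p : ℕ} (hp : p < D.s) {m : ℕ → ℕ} (h : D.Good σ p m) (b : ℕ) {q : ℕ}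
    (hq : q < σ.length) : D.split p b m q < (D.step p).k := by
  by_cases h0 : D.split p b m q = 0
  · have := D.pos_of_mem hp (D.step_k_mem hp)
    omega
  · exact D.lt_step_k_of_mem hp le_rfl (h.split_mem hp b q hq h0)

/-- A component that does not consist of points only is a connected assignment that uses its
most recent rectangle. -/
theorem exists_good_comp (hπ : π.Reduced) {p : ℕ} (hp : p ≤ D.s) {m : ℕ → ℕ}
    (hm : ∀ q < σ.length, m q ≠ 0 → m q ∈ (D.fam p).S) {r k : ℕ}
    (hle : ∀ q < σ.length, D.comp σ m r q ≤ k) (hk : ∃ q < σ.length, D.comp σ m r q = k)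
    (hn : π.length < k) : ∃ p' < p, k = (D.step p').k ∧ D.Good σ p' (D.comp σ m r) := by
  obtain ⟨q, hq, hqk⟩ := hk
  have hne : D.comp σ m r q ≠ 0 := by omega
  have hmem := hm q hq (by rw [← comp_eq hne]; exact hne)
  rw [← comp_eq hne, hqk] at hmem
  rcases D.mem_fam hp hmem with h | ⟨p', hp', rfl⟩
  · rw [hπ.1, Finset.mem_Icc] at h
    omega
  refine ⟨p', hp', rfl, fun x hx h0 => ?_, ⟨q, hq, hqk⟩, connected_comp m r⟩
  have h1 := comp_eq h0
  have h2 := hle x hx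
  rw [h1] at h0 h2 ⊢
  -- Rectangles created after step `p'` have labels above the maximum of the component, so all its
  -- rectangles were present right after step `p'`.
  refine D.mem_fam_of_mem hp' hp (hm x hx h0) fun r h3 h4 => ?_
  have := D.increasing p' r (by omega) (by omega)
  omega

/-! ### The number of connected assignments -/

theorem exists_injOn_fin {A : Finset ℕ} {n : ℕ} (hn : 0 < n) (h : A.card ≤ n) :
    ∃ f : ℕ → Fin n, Set.InjOn f A := by
  classical
  refine ⟨fun x => if hx : x ∈ A then Fin.castLE h (A.equivFin ⟨x, hx⟩) else ⟨0, hn⟩, ?_⟩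
  intro x hx y hy hxy
  have hx' : x ∈ A := hx
  have hy' : y ∈ A := hy
  simp only [hx', hy', dif_pos, Fin.castLE_inj, EmbeddingLike.apply_eq_iff_eq,
    Subtype.mk.injEq] at hxy
  exact hxy

/-- Every connected assignment is determined by a choice, for each assigned position, of a parent
position and of a rectangle among those viewed by the rectangle of the parent. -/
theorem exists_code {d p : ℕ} (hd : D.IsWide d) (hp : p < D.s) :
    ∃ code : (ℕ → ℕ) → Fin σ.length → Option (Fin σ.length × Fin (2 * d)),
      ∀ m m', D.Good σ p m → D.Good σ p m' → code m = code m' → ∀ q < σ.length, m q = m' q := by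
  classical
  have hd0 : 0 < d := (Nat.zero_le _).trans_lt (hd (p + 1) hp _ (D.step_k_mem hp))
  let F := D.fam (p + 1)
  -- The rectangle itself is included, because positions in a common rectangle are linked while
  -- `viewSet` leaves it out. The size is at most `1 + 2 * (d - 1)`, which is below `2 * d`.
  let nb : ℕ → Finset ℕ := fun y => insert y (F.viewSet 0 y ∪ F.viewSet 1 y)
  have hcard : ∀ y, ∃ f : ℕ → Fin (2 * d), y ∈ F.S → Set.InjOn f (nb y) := by
    intro y
    by_cases hy : y ∈ F.S
    · have h1 := hd (p + 1) hp y hy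
      rw [RectFamily.view, max_lt_iff] at h1
      have h2 : (nb y).card ≤ 2 * d := by
        refine (Finset.card_insert_le _ _).trans ?_
        have := Finset.card_union_le (F.viewSet 0 y) (F.viewSet 1 y)
        simp only [F] at this ⊢
        omega
      obtain ⟨f, hf⟩ := exists_injOn_fin (by omega) h2
      exact ⟨f, fun _ => hf⟩
    · exact ⟨fun _ => ⟨0, by omega⟩, fun h => absurd h hy⟩
  choose ix hix using hcard
  have hnb : ∀ y ∈ F.S, ∀ z ∈ F.S, (∃ α, D.Sees α y z) → z ∈ nb y := by
    rintro y hy z hz ⟨α, hs⟩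
    by_cases hyz : z = y
    · subst hyz; exact Finset.mem_insert_self _ _
    refine Finset.mem_insert_of_mem ?_
    rw [← D.views_iff_sees, D.rect_eq hp hy, D.rect_eq hp hz] at hs
    have : z ∈ F.viewSet α y := by
      simp only [RectFamily.viewSet, Finset.mem_filter, Finset.mem_erase]
      exact ⟨⟨hyz, hz⟩, hs⟩
    rw [Finset.mem_union]
    fin_cases α
    · exact .inl this
    · exact .inr this
  -- A breadth-first tree rooted at a position in the new rectangle; the root is recognized by being
  -- its own parent.
  have tree : ∀ m, ∃ (par : Fin σ.length → Fin σ.length)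
      (rank : Fin σ.length → ℕ), D.Good σ p m → ∀ q : Fin σ.length, m q ≠ 0 →
        (par q = q ∧ m q = (D.step p).k) ∨
        (par q ≠ q ∧ rank (par q) < rank q ∧ D.Link σ m (par q) q) := by
    intro m
    by_cases hm : D.Good σ p m
    swap
    · exact ⟨id, fun _ => 0, fun h => absurd h hm⟩
    obtain ⟨q₀, hq₀, hk⟩ := hm.uses
    have h0 : m q₀ ≠ 0 := by rw [hk]; exact (D.pos_of_mem hp (D.step_k_mem hp)).ne'
    let reach : ℕ → ℕ → Prop := fun n => Nat.rec (fun q => q = q₀)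
      (fun _ R q => ∃ x, R x ∧ D.Link σ m x q) n
    have hreach : ∀ q, D.Joined σ m q₀ q → ∃ n, reach n q := by
      intro q hq
      induction hq with
      | refl => exact ⟨0, rfl⟩
      | tail _ h ih =>
        obtain ⟨n, hn⟩ := ih
        exact ⟨n + 1, _, hn, h⟩
    -- The distance from the root. The value `0` for an empty set does no harm, since the assigned
    -- positions are all reachable.
    let rank : ℕ → ℕ := fun q => sInf {n | reach n q}
    have hpar : ∀ q : Fin σ.length, ∃ x : Fin σ.length, m q ≠ 0 →
        (x = q ∧ m q = (D.step p).k) ∨ (x ≠ q ∧ rank x < rank q ∧ D.Link σ m x q) := by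
      intro q
      by_cases hq : m q = 0
      · exact ⟨q, fun h => absurd hq h⟩
      have hex := hreach q (hm.connected q₀ hq₀ q q.2 h0 hq)
      have hspec : reach (rank q) q := Nat.sInf_mem (s := {n | reach n q}) hex
      cases hfind : rank q with
      | zero =>
        rw [hfind] at hspec
        have hq' : (q : ℕ) = q₀ := hspec
        exact ⟨q, fun _ => .inl ⟨rfl, by rw [hq', hk]⟩⟩
      | succ n =>
        rw [hfind] at hspec
        obtain ⟨x, hx, hl⟩ := hspec
        have hlt : rank x < n + 1 := Nat.lt_succ_of_le (Nat.sInf_le (s := {n | reach n x}) hx)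
        refine ⟨⟨x, hl.1⟩, fun _ => .inr ⟨fun h => ?_, hlt, hl⟩⟩
        rw [← h] at hfind
        simp only at hfind
        omega
    choose par hpar using hpar
    exact ⟨par, fun q => rank q, fun _ => hpar⟩
  choose par rank htree using tree
  refine ⟨fun m q => if m q = 0 then none else some (par m q, ix (m (par m q)) (m q)), ?_⟩
  intro m m' hm hm' hcode
  have hzero : ∀ q : Fin σ.length, m q = 0 ↔ m' q = 0 := by
    intro q
    have := congrFun hcode q
    by_cases h1 : m q = 0 <;> by_cases h2 : m' q = 0 <;> simp_all
  -- Decoding along the tree of `m`: roots carry the label of step `p` in both assignments.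
  -- Elsewhere the rectangle of the common parent agrees by induction, and the index determines one
  -- of its neighbours.
  have key : ∀ n, ∀ q : Fin σ.length, rank m q = n → m q = m' q := by
    intro n
    induction n using Nat.strong_induction_on with
    | _ n ih =>
      intro q hn
      by_cases h0 : m q = 0
      · rw [h0, (hzero q).1 h0]
      have h0' : m' q ≠ 0 := fun h => h0 ((hzero q).2 h)
      have hc := congrFun hcode q
      simp only [h0, h0', if_false, Option.some.injEq, Prod.mk.injEq] at hc
      obtain ⟨hpq, hidx⟩ := hc
      rcases htree m hm q h0 with ⟨h1, h2⟩ | ⟨h1, h2, h3⟩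
      · rcases htree m' hm' q h0' with ⟨_, h4⟩ | ⟨h4, _⟩
        · rw [h2, h4]
        · exact absurd (hpq ▸ h1) h4
      · rcases htree m' hm' q h0' with ⟨h4, _⟩ | ⟨_, _, h6⟩
        · exact absurd (hpq.trans h4) h1
        · have h5 := ih _ (hn ▸ h2) (par m q) rfl
          rw [← hpq] at hidx h6
          rw [← h5] at hidx
          obtain ⟨_, _, h7, h8, h9⟩ := h3
          obtain ⟨_, _, h10, h11, h12⟩ := h6
          rw [← h5] at h12
          have hy := hm.mem _ (par m q).2 h7
          exact hix _ hy (hnb _ hy _ (hm.mem _ q.2 h8) h9)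
            (hnb _ hy _ (hm'.mem _ q.2 h11) h12) hidx
  exact fun q hq => key _ ⟨q, hq⟩ rfl

/-- The number of pairwise different connected assignments that use the rectangle of step `p`. -/
theorem card_good_le {d p : ℕ} (hd : D.IsWide d) (hp : p < D.s) {N : ℕ} (m : ℕ → ℕ → ℕ)
    (hm : ∀ i < N, D.Good σ p (m i))
    (hinj : ∀ i < N, ∀ j < N, (∀ q < σ.length, m i q = m j q) → i = j) :
    N ≤ (2 * d * σ.length + 1) ^ σ.length := by
  obtain ⟨code, hcode⟩ := exists_code (σ := σ) hd hp
  have h := Fintype.card_le_of_injective (fun i : Fin N => code (m i)) fun i j hij =>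
    Fin.ext (hinj i i.2 j j.2 (hcode _ _ (hm i i.2) (hm j j.2) hij))
  simp only [Fintype.card_fin, Fintype.card_fun, Fintype.card_option, Fintype.card_prod] at h
  rwa [mul_comm σ.length (2 * d)] at h

/-! ### The pattern and the last rectangle -/

/-- Every point has been merged into the last rectangle, so assigning all positions to it restricts
nothing. Position `q` stands for the pattern label `q + 1`. -/
theorem isSubpattern_iff (hσ : σ.Reduced) (hπ : π.Reduced) :
    σ.IsSubpattern π ↔ D.Realizable σ fun _ => D.top := by
  have hmem : ∀ q < σ.length, q + 1 ∈ σ.S := by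
    intro q hq
    rw [hσ.1, Finset.mem_Icc]
    omega
  have htop : D.top ≠ 0 := (D.pos_of_mem le_rfl
    (by rw [D.fam_last hπ]; exact Finset.mem_singleton_self _)).ne'
  constructor
  · rintro ⟨φ, h1, h2⟩
    refine ⟨fun q => φ (q + 1), fun q hq _ => ?_, fun x hx y hy _ _ α hlt =>
      (h2 _ (hmem x hx) _ (hmem y hy) α).1 hlt⟩
    obtain ⟨y, hy, hc⟩ := D.exists_contains (h1 _ (hmem q hq)) le_rfl
    rw [D.fam_last hπ, Finset.mem_singleton] at hy
    exact hy ▸ hc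
  · rintro ⟨φ, h1, h2⟩
    have hS : ∀ p ∈ σ.S, p - 1 < σ.length ∧ p - 1 + 1 = p := by
      intro p hp
      rw [hσ.1, Finset.mem_Icc] at hp
      omega
    have key : ∀ p ∈ σ.S, ∀ q ∈ σ.S, ∀ α : Fin 2, σ.P p α < σ.P q α →
        π.P (φ (p - 1)) α < π.P (φ (q - 1)) α := by
      intro p hp q hq α hlt
      refine h2 _ (hS p hp).1 _ (hS q hq).1 htop htop α ?_
      rwa [(hS p hp).2, (hS q hq).2]
    refine ⟨fun p => φ (p - 1), fun p hp => (h1 _ (hS p hp).1 htop).mem,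
      fun p hp q hq α => ⟨key p hp q hq α, fun hlt => ?_⟩⟩
    -- A realization preserves the order in one direction only; the converse follows because equal
    -- coordinates in `σ` occur only for equal labels.
    rcases lt_trichotomy (σ.P p α) (σ.P q α) with h | h | h
    · exact h
    · obtain rfl := σ.general α hp hq h
      exact absurd hlt (lt_irrefl _)
    · exact absurd hlt (key q hq p hp α h).not_gt

end Decomposition

/-! ### The program

Registers: `0` length `ℓ` of the pattern, `1` length `n` of the permutation, `2` a strict bound `K`
of the labels, `3` number of trie nodes, `4` the power `2 ^ ℓ`, `5` and `6` merge steps, `7` label of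
the current bucket, `8` its size, `9` position in it, `10` node of the current assignment, `11` and
`12` binary digits that describe a split, `13` result of a test, `14`, `15` and `16` loop counters,
`17` root of a component, `18` largest label in the component, `19` trie node, `20` and `21`
temporary values.

Arrays: `0` to `6` input, `7`, `8` and `9`, `10` lower and upper ends of the rectangles, `11` edges of
the trie (the edge with label `y` at the node `v` is stored at `v * K + y`), `12` marks of the
registered nodes, `13` assignments of the registered nodes, `14` sizes and `15` entries of the buckets
(the entry `i` of the bucket `y` is stored at `i * K + y`), `16` marks of the nodes known to be
realizable, `17` current assignment, `18` component numbers, `19` current component. -/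

namespace PatternProg

open RamProg

/-- Positive if the positions in registers `14` and `15` contradict the order of the pattern. -/
def conflictExpr (α : ℕ) : RamExpr :=
  .mul (.mul (.lt (.lit 0) (.get 17 (.reg 14))) (.lt (.lit 0) (.get 17 (.reg 15))))
    (.mul (.lt (.get α (.add (.reg 14) (.lit 1))) (.get α (.add (.reg 15) (.lit 1))))
      (.sub (.lit 1)
        (.lt (.get (7 + α) (.get 17 (.reg 14))) (.get (9 + α) (.get 17 (.reg 15))))))

/-- Test whether the current assignment is consistent. -/
def consistentProg : RamProg :=
  seq (assign 13 (.lit 1))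
    (count 14 (.reg 0) (count 15 (.reg 0)
      (cond (.add (conflictExpr 0) (conflictExpr 1)) (assign 13 (.lit 0)) skip)))

def seesExpr (α : ℕ) : RamExpr :=
  .mul (.sub (.lit 1)
      (.lt (.get (9 + α) (.get 17 (.reg 15))) (.get (7 + α) (.get 17 (.reg 14)))))
    (.sub (.lit 1)
      (.lt (.get (9 + α) (.get 17 (.reg 14))) (.get (7 + α) (.get 17 (.reg 15)))))

/-- Positive if the positions in registers `14` and `15` are linked. -/
def linkExpr : RamExpr :=
  .mul (.mul (.lt (.lit 0) (.get 17 (.reg 14))) (.lt (.lit 0) (.get 17 (.reg 15))))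
    (.add (seesExpr 0) (seesExpr 1))

/-- Renumber the components such that two of them get the same number. -/
def uniteProg : RamProg :=
  seq (assign 20 (.get 18 (.reg 14))) (seq (assign 21 (.get 18 (.reg 15)))
    (count 16 (.reg 0)
      (cond (.eq (.get 18 (.reg 16)) (.reg 21)) (store 18 (.reg 16) (.reg 20)) skip)))

/-- Number the components of the current assignment. -/
def numberProg : RamProg :=
  seq (count 14 (.reg 0) (store 18 (.reg 14) (.reg 14)))
    (count 14 (.reg 0) (count 15 (.reg 0) (cond linkExpr uniteProg skip)))

/-- Compute the component of the position in register `17` and its largest label. -/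
def compProg : RamProg :=
  seq (assign 18 (.lit 0)) (count 14 (.reg 0)
    (seq (store 19 (.reg 14)
        (.mul (.eq (.get 18 (.reg 14)) (.get 18 (.reg 17))) (.get 17 (.reg 14))))
      (assign 18 (.add (.reg 18) (.sub (.get 19 (.reg 14)) (.reg 18))))))

/-- Walk down the trie along the current component, adding missing nodes. -/
def walkProg : RamProg :=
  seq (assign 19 (.lit 0)) (count 14 (.reg 0)
    (seq (assign 20 (.add (.mul (.reg 19) (.reg 2)) (.get 19 (.reg 14))))
      (seq (cond (.eq (.get 11 (.reg 20)) (.lit 0))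
          (seq (assign 3 (.add (.reg 3) (.lit 1))) (store 11 (.reg 20) (.reg 3))) skip)
        (assign 19 (.get 11 (.reg 20))))))

/-- Register the current component at the node in register `19` if this is not yet done. -/
def registerProg : RamProg :=
  cond (.eq (.get 12 (.reg 19)) (.lit 0))
    (seq (store 12 (.reg 19) (.lit 1))
      (seq (count 14 (.reg 0)
          (store 13 (.add (.mul (.reg 19) (.reg 0)) (.reg 14)) (.get 19 (.reg 14))))
        (seq (store 15 (.add (.mul (.get 14 (.reg 18)) (.reg 2)) (.reg 18)) (.reg 19))
          (store 14 (.reg 18) (.add (.get 14 (.reg 18)) (.lit 1))))))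
    skip

/-- Handle the component of the position in register `17`. -/
def rootProg : RamProg :=
  seq compProg (cond (.lt (.reg 1) (.reg 18))
    (seq walkProg (seq registerProg (cond (.get 16 (.reg 19)) skip (assign 13 (.lit 0))))) skip)

/-- Test whether the current assignment is consistent and its components are known to be
realizable; register the components. -/
def checkProg : RamProg :=
  seq consistentProg (cond (.reg 13) (seq numberProg (count 17 (.reg 0) rootProg)) skip)

/-- Compute the split of the assignment at the node in register `10` described by register `11`. -/
def splitProg : RamProg :=
  seq (assign 12 (.reg 11)) (count 14 (.reg 0)
    (seq (store 17 (.reg 14) (.get 13 (.add (.mul (.reg 10) (.reg 0)) (.reg 14))))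
      (seq (cond (.eq (.get 17 (.reg 14)) (.reg 7))
          (cond (.mod (.reg 12) (.lit 2)) (store 17 (.reg 14) (.get 4 (.reg 6)))
            (store 17 (.reg 14) (.get 5 (.reg 6)))) skip)
        (assign 12 (.div (.reg 12) (.lit 2))))))

/-- Check all splits of the assignment at the node in register `10`. -/
def nodeProg : RamProg :=
  count 11 (.reg 4)
    (seq splitProg (seq checkProg (cond (.reg 13) (store 16 (.reg 10) (.lit 1)) skip)))

/-- Handle all registered assignments that use the rectangle of the step in register `6`. -/
def bucketProg : RamProg :=
  seq (assign 7 (.get 6 (.reg 6))) (seq (assign 8 (.get 14 (.reg 7)))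
    (count 9 (.reg 8)
      (seq (assign 10 (.get 15 (.add (.mul (.reg 9) (.reg 2)) (.reg 7)))) nodeProg)))

/-- Assign all positions to the last rectangle. -/
def topProg : RamProg :=
  count 14 (.reg 0) (store 17 (.reg 14) (.sub (.reg 2) (.lit 1)))

def minExpr (a : ℕ) : RamExpr :=
  .sub (.get a (.get 4 (.reg 14)))
    (.sub (.get a (.get 4 (.reg 14))) (.get a (.get 5 (.reg 14))))

def maxExpr (a : ℕ) : RamExpr :=
  .add (.get a (.get 4 (.reg 14)))
    (.sub (.get a (.get 5 (.reg 14))) (.get a (.get 4 (.reg 14))))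

/-- Compute the rectangles of the points. -/
def pointsProg : RamProg :=
  count 14 (.reg 1)
    (seq (store 7 (.add (.reg 14) (.lit 1)) (.get 2 (.add (.reg 14) (.lit 1))))
    (seq (store 8 (.add (.reg 14) (.lit 1)) (.get 3 (.add (.reg 14) (.lit 1))))
    (seq (store 9 (.add (.reg 14) (.lit 1)) (.get 2 (.add (.reg 14) (.lit 1))))
      (store 10 (.add (.reg 14) (.lit 1)) (.get 3 (.add (.reg 14) (.lit 1)))))))

/-- Compute the rectangles of the merge steps. -/
def boxesProg : RamProg :=
  count 14 (.sub (.reg 1) (.lit 1))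
    (seq (store 7 (.get 6 (.reg 14)) (minExpr 7))
    (seq (store 8 (.get 6 (.reg 14)) (minExpr 8))
    (seq (store 9 (.get 6 (.reg 14)) (maxExpr 9))
      (store 10 (.get 6 (.reg 14)) (maxExpr 10)))))

def initProg : RamProg :=
  seq pointsProg (seq boxesProg
    (seq (assign 2 (.add (.add (.reg 1) (.sub (.get 6 (.sub (.reg 1) (.lit 2))) (.reg 1)))
        (.lit 1)))
      (seq (assign 4 (.lit 1)) (count 14 (.reg 0) (assign 4 (.mul (.reg 4) (.lit 2)))))))

def downProg : RamProg :=
  count 5 (.sub (.reg 1) (.lit 1))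
    (seq (assign 6 (.sub (.sub (.reg 1) (.lit 2)) (.reg 5))) bucketProg)

def upProg : RamProg :=
  count 5 (.sub (.reg 1) (.lit 1)) (seq (assign 6 (.reg 5)) bucketProg)

/-- The decision algorithm. -/
def mainProg : RamProg :=
  seq initProg (seq topProg (seq checkProg (seq downProg (seq upProg
    (seq topProg (seq checkProg (assign 0 (.lt (.lit 0) (.reg 13)))))))))

end PatternProg

/-! ### Memory layout and the consistency test -/

/-- The program leaves the input and the tables computed from it alone. -/
def RamProg.keepsInput (c : RamProg) : Bool :=
  [0, 1, 2, 4].all (fun x => !c.writesReg x) && (List.range 11).all fun a => !c.writesArr a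

/-- The memory holds the input and the tables computed from it. -/
structure InputTables {π : PointPerm} (D : Decomposition π) (σ : PointPerm) (s : RamState) :
    Prop where
  len : s.reg 0 = σ.length
  size : s.reg 1 = π.length
  bound : s.reg 2 = D.top + 1
  power : s.reg 4 = 2 ^ σ.length
  pattern : ∀ (α : Fin 2), ∀ q < σ.length, s.arr α (q + 1) = σ.P (q + 1) α
  lo : ∀ (α : Fin 2), ∀ p ≤ D.s, ∀ y ∈ (D.fam p).S, s.arr (7 + α) y = D.lo α y
  hi : ∀ (α : Fin 2), ∀ p ≤ D.s, ∀ y ∈ (D.fam p).S, s.arr (9 + α) y = D.hi α y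
  stepI : ∀ p < D.s, s.arr 4 p = (D.step p).i
  stepJ : ∀ p < D.s, s.arr 5 p = (D.step p).j
  stepK : ∀ p < D.s, s.arr 6 p = (D.step p).k

namespace InputTables

variable {π : PointPerm} {D : Decomposition π} {σ : PointPerm} {s s' : RamState}

theorem of_eq (h : InputTables D σ s) (hr : ∀ x, x = 0 ∨ x = 1 ∨ x = 2 ∨ x = 4 →
    s'.reg x = s.reg x) (ha : ∀ a < 11, s'.arr a = s.arr a) : InputTables D σ s' where
  len := (hr 0 (by simp)).trans h.len
  size := (hr 1 (by simp)).trans h.size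
  bound := (hr 2 (by simp)).trans h.bound
  power := (hr 4 (by simp)).trans h.power
  pattern α q hq := by rw [ha _ (by omega)]; exact h.pattern α q hq
  lo α p hp y hy := by rw [ha _ (by omega)]; exact h.lo α p hp y hy
  hi α p hp y hy := by rw [ha _ (by omega)]; exact h.hi α p hp y hy
  stepI p hp := by rw [ha _ (by omega)]; exact h.stepI p hp
  stepJ p hp := by rw [ha _ (by omega)]; exact h.stepJ p hp
  stepK p hp := by rw [ha _ (by omega)]; exact h.stepK p hp

theorem of_frame (h : InputTables D σ s) {c : RamProg} (hF : c.Frame s s')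
    (hc : c.keepsInput = true) : InputTables D σ s' := by
  simp only [RamProg.keepsInput, Bool.and_eq_true, List.all_eq_true, Bool.not_eq_true',
    List.mem_range] at hc
  refine h.of_eq (fun x hx => hF.1 x (hc.1 x ?_)) fun a ha => hF.2 a (hc.2 a ha)
  rcases hx with rfl | rfl | rfl | rfl <;> simp

end InputTables

namespace PatternProg

open RamProg Decomposition

variable {V w : ℕ} {π : PointPerm} {D : Decomposition π} {σ : PointPerm} {s : RamState}

/-- Products of `0`/`1` factors act as conjunctions and `1 - _` as negation. The guards against
label `0` are essential, since the tables are known only at labels of actual rectangles. -/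
theorem conflictExpr_eval (hB : InputTables D σ s) {p : ℕ} (hp : p ≤ D.s)
    (hm : ∀ q < σ.length, s.arr 17 q ≠ 0 → s.arr 17 q ∈ (D.fam p).S)
    (hx : s.reg 14 < σ.length) (hy : s.reg 15 < σ.length) (α : Fin 2) :
    (conflictExpr α).eval s = 0 ↔ (s.arr 17 (s.reg 14) ≠ 0 → s.arr 17 (s.reg 15) ≠ 0 →
      σ.P (s.reg 14 + 1) α < σ.P (s.reg 15 + 1) α →
      D.lo α (s.arr 17 (s.reg 14)) < D.hi α (s.arr 17 (s.reg 15))) := by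
  simp only [conflictExpr, RamExpr.eval, hB.pattern α _ hx, hB.pattern α _ hy]
  by_cases h1 : s.arr 17 (s.reg 14) = 0
  · simp [h1]
  by_cases h2 : s.arr 17 (s.reg 15) = 0
  · simp [h2]
  simp only [hB.lo α p hp _ (hm _ hx h1), hB.hi α p hp _ (hm _ hy h2)]
  simp [h1, h2, Nat.pos_of_ne_zero, Nat.sub_eq_zero_iff_le]
  by_cases h3 : D.lo α (s.arr 17 (s.reg 14)) < D.hi α (s.arr 17 (s.reg 15)) <;> simp [h3]

theorem linkExpr_eval (hB : InputTables D σ s) {p : ℕ} (hp : p ≤ D.s)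
    (hm : ∀ q < σ.length, s.arr 17 q ≠ 0 → s.arr 17 q ∈ (D.fam p).S)
    (hx : s.reg 14 < σ.length) (hy : s.reg 15 < σ.length) :
    linkExpr.eval s ≠ 0 ↔ D.Link σ (s.arr 17) (s.reg 14) (s.reg 15) := by
  have hs : ∀ α : Fin 2, s.arr 17 (s.reg 14) ≠ 0 → s.arr 17 (s.reg 15) ≠ 0 →
      ((seesExpr α).eval s ≠ 0 ↔ D.Sees α (s.arr 17 (s.reg 14)) (s.arr 17 (s.reg 15))) := by
    intro α h1 h2
    simp only [seesExpr, RamExpr.eval, hB.lo α p hp _ (hm _ hx h1), hB.hi α p hp _ (hm _ hy h2),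
      hB.lo α p hp _ (hm _ hy h2), hB.hi α p hp _ (hm _ hx h1), Sees]
    split_ifs <;> simp <;> omega
  have h : linkExpr.eval s ≠ 0 ↔ s.arr 17 (s.reg 14) ≠ 0 ∧ s.arr 17 (s.reg 15) ≠ 0 ∧
      ((seesExpr 0).eval s ≠ 0 ∨ (seesExpr 1).eval s ≠ 0) := by
    simp only [linkExpr, RamExpr.eval]
    by_cases h1 : s.arr 17 (s.reg 14) = 0
    · simp [h1]
    by_cases h2 : s.arr 17 (s.reg 15) = 0
    · simp [h2]
    simp [h1, h2, Nat.pos_of_ne_zero]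
    tauto
  rw [h]
  constructor
  · rintro ⟨h1, h2, h3 | h3⟩
    · exact ⟨hx, hy, h1, h2, 0, (hs 0 h1 h2).1 h3⟩
    · exact ⟨hx, hy, h1, h2, 1, (hs 1 h1 h2).1 h3⟩
  · rintro ⟨_, _, h1, h2, α, h3⟩
    refine ⟨h1, h2, ?_⟩
    fin_cases α
    · exact .inl ((hs 0 h1 h2).2 h3)
    · exact .inr ((hs 1 h1 h2).2 h3)

theorem run_consistentProg (hw : RamBound V w) (hB : InputTables D σ s) {p : ℕ} (hp : p ≤ D.s)
    (hm : ∀ q < σ.length, s.arr 17 q ≠ 0 → s.arr 17 q ∈ (D.fam p).S) :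
    Run V w consistentProg s (65 + (σ.length * (σ.length * (131 + 200) + 200 + 200) + 200))
      fun s' => s'.reg 13 ≠ 0 ↔ D.Consistent σ (s.arr 17) := by
  let ok : ℕ → ℕ → Prop := fun x y => s.arr 17 x ≠ 0 → s.arr 17 y ≠ 0 → ∀ α : Fin 2,
    σ.P (x + 1) α < σ.P (y + 1) α → D.lo α (s.arr 17 x) < D.hi α (s.arr 17 y)
  refine Run.seq (Q := fun s' => s'.reg 13 = 1) (Run.assign hw rfl (Run.tame hw rfl) (by
    simp [RamExpr.eval])) fun s₁ h₁ hF₁ _ => ?_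
  have hB₁ := hB.of_frame hF₁ rfl
  have ha₁ : s₁.arr 17 = s.arr 17 := hF₁.2 17 rfl
  refine Run.count hw σ.length
    (fun j s' => s'.reg 13 ≠ 0 ↔ ∀ x < j, ∀ y < σ.length, ok x y) rfl rfl rfl
    (fun s' hF => (hB₁.of_frame hF rfl).len) (by simp [h₁]) ?_ ?_
  · intro x hx s₂ h₂ hr₂ hF₂ _
    have hB₂ := hB₁.of_frame hF₂ rfl
    have ha₂ : s₂.arr 17 = s.arr 17 := (hF₂.2 17 rfl).trans ha₁
    refine Run.count hw σ.length
      (fun j s' => s'.reg 13 ≠ 0 ↔ (∀ x' < x, ∀ y < σ.length, ok x' y) ∧ ∀ y < j, ok x y)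
      rfl rfl rfl (fun s' hF => (hB₂.of_frame hF rfl).len) (by simpa using h₂) ?_ ?_
    · intro y hy s₃ h₃ hr₃ hF₃ _
      have hB₃ := hB₂.of_frame hF₃ rfl
      have ha₃ : s₃.arr 17 = s.arr 17 := (hF₃.2 17 rfl).trans ha₂
      have hx₃ : s₃.reg 14 = x := (hF₃.1 14 rfl).trans hr₂
      have hval : ((RamExpr.add (conflictExpr 0) (conflictExpr 1)).eval s₃ = 0) ↔ ok x y := by
        have h0 := conflictExpr_eval hB₃ hp (by rw [ha₃]; exact hm) (by omega) (by omega) 0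
        have h1 := conflictExpr_eval hB₃ hp (by rw [ha₃]; exact hm) (by omega) (by omega) 1
        rw [hx₃, hr₃, ha₃] at h0 h1
        simp only [RamExpr.eval, Nat.add_eq_zero_iff]
        simp only [ok, Fin.forall_fin_two]
        constructor
        · rintro ⟨h2, h3⟩ hx' hy'
          exact ⟨h0.1 h2 hx' hy', h1.1 h3 hx' hy'⟩
        · intro h
          exact ⟨h0.2 fun a b => (h a b).1, h1.2 fun a b => (h a b).2⟩
      refine Run.cond hw rfl (fun hne => Run.assign hw rfl (Run.tame hw rfl) ?_)
        fun h0 => Run.skip ?_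
      · have : ¬ ok x y := fun h => hne (hval.2 h)
        simp only [RamExpr.eval, RamState.setReg_reg]
        simp only [Nat.reduceEqDiff, if_false, if_true, ne_eq, not_true, false_iff]
        exact fun h => this (h.2 y (by omega))
      · have : ok x y := hval.1 h0
        simp only [RamState.setReg_reg, Nat.reduceEqDiff, if_false]
        rw [h₃]
        refine and_congr_right fun _ => ⟨fun h y' hy' => ?_, fun h y' hy' => h y' (by omega)⟩
        rcases (Nat.lt_succ_iff_lt_or_eq.1 hy') with h' | rfl
        · exact h y' h'
        · exact this
    · intro s₃ h₃ _ _
      simp only [RamState.setReg_reg, Nat.reduceEqDiff, if_false]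
      rw [h₃]
      constructor
      · rintro ⟨h4, h5⟩ x' hx'
        rcases (Nat.lt_succ_iff_lt_or_eq.1 hx') with h' | rfl
        · exact h4 x' h'
        · exact h5
      · exact fun h => ⟨fun x' hx' => h x' (by omega), h x (by omega)⟩
  · intro s₂ h₂ _ _
    exact h₂

end PatternProg

namespace PatternProg

open RamProg Decomposition

variable {V w : ℕ} {π : PointPerm} {D : Decomposition π} {σ : PointPerm} {s : RamState}

/-! ### Components -/

/-- Both component numbers are copied to registers first, as the loop overwrites the cells from
which they were read. -/
theorem run_uniteProg (hw : RamBound V w) (hB : InputTables D σ s) :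
    Run V w uniteProg s (65 + (65 + (σ.length * (195 + 200) + 200))) fun s' =>
      ∀ z < σ.length, s'.arr 18 z =
        if s.arr 18 z = s.arr 18 (s.reg 15) then s.arr 18 (s.reg 14) else s.arr 18 z := by
  refine Run.seq (Q := fun s' => s'.reg 20 = s.arr 18 (s.reg 14)) (Run.assign hw rfl
    (Run.tame hw rfl) (by simp [RamExpr.eval])) fun s₁ h₁ hF₁ _ => ?_
  have hB₁ := hB.of_frame hF₁ rfl
  refine Run.seq (Q := fun s' => s'.reg 21 = s.arr 18 (s.reg 15)) (Run.assign hw rfl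
    (Run.tame hw rfl) (by simp [RamExpr.eval, hF₁.1 15 rfl, hF₁.2 18 rfl]))
    fun s₂ h₂ hF₂ _ => ?_
  have hB₂ := hB₁.of_frame hF₂ rfl
  have h20 : s₂.reg 20 = s.arr 18 (s.reg 14) := (hF₂.1 20 rfl).trans h₁
  have h18 : s₂.arr 18 = s.arr 18 := (hF₂.2 18 rfl).trans (hF₁.2 18 rfl)
  refine Run.count hw σ.length
    (fun j s' => ∀ z < σ.length, s'.arr 18 z =
      if z < j ∧ s.arr 18 z = s.arr 18 (s.reg 15) then s.arr 18 (s.reg 14) else s.arr 18 z)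
    rfl rfl rfl (fun s' hF => (hB₂.of_frame hF rfl).len) (by simp [h18]) ?_ ?_
  · intro j hj s₃ h₃ hr₃ hF₃ _
    have h20₃ : s₃.reg 20 = s.arr 18 (s.reg 14) := (hF₃.1 20 rfl).trans h20
    have h21₃ : s₃.reg 21 = s.arr 18 (s.reg 15) := (hF₃.1 21 rfl).trans h₂
    have hj₃ : s₃.arr 18 j = s.arr 18 j := by rw [h₃ j hj, if_neg (by omega)]
    refine Run.cond hw rfl (fun hne => Run.store hw rfl rfl (Run.tame hw rfl) ?_)
      fun h0 => Run.skip ?_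
    · simp only [RamExpr.eval, hr₃, h21₃, hj₃, ne_eq, ite_eq_right_iff, one_ne_zero, imp_false,
        not_not] at hne
      intro z hz
      simp only [RamExpr.eval, RamState.setReg_arr, RamState.setArr_arr, if_true, hr₃, h20₃,
        Function.update_apply]
      by_cases hzj : z = j
      · subst hzj
        simp [hne]
      · rw [if_neg hzj, h₃ z hz]
        have : z < j + 1 ↔ z < j := by omega
        simp only [this]
    · simp only [RamExpr.eval, hr₃, h21₃, hj₃, ite_eq_right_iff, one_ne_zero, imp_false] at h0
      intro z hz
      simp only [RamState.setReg_arr, h₃ z hz]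
      by_cases hzj : z = j
      · subst hzj
        simp [h0]
      · have : z < j + 1 ↔ z < j := by omega
        simp only [this]
  · intro s₃ h₃ _ _ z hz
    rw [h₃ z hz]
    simp [hz]

/-- Array `18` numbers the components of the current assignment. -/
def Numbered (D : Decomposition π) (σ : PointPerm) (s : RamState) : Prop :=
  ∀ x < σ.length, ∀ y < σ.length, s.arr 18 x = s.arr 18 y ↔ D.Joined σ (s.arr 17) x y

/-- Invariant: equal numbers occur only for joined positions, and linked pairs already visited have
equal numbers. At the end equality of numbers is an equivalence relation containing all links, so it
contains joinedness. -/
theorem run_numberProg (hw : RamBound V w) (hB : InputTables D σ s) {p : ℕ} (hp : p ≤ D.s)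
    (hm : ∀ q < σ.length, s.arr 17 q ≠ 0 → s.arr 17 q ∈ (D.fam p).S) :
    Run V w numberProg s (σ.length * 329 + 200 + (σ.length * (σ.length * (65 +
      (65 + (65 + (σ.length * (195 + 200) + 200)) + 1) + 200) + 200 + 200) + 200))
      (Numbered D σ) := by
  let m := s.arr 17
  refine Run.seq (Q := fun s' => ∀ z < σ.length, s'.arr 18 z = z) (Run.count hw σ.length
    (fun j s' => ∀ z < j, s'.arr 18 z = z) rfl rfl rfl
    (fun s' hF => (hB.of_frame hF rfl).len) (by simp) (fun j hj s₁ h₁ hr₁ _ _ =>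
      Run.store hw rfl rfl (Run.tame hw rfl) ?_) (fun s₁ h₁ _ _ => h₁)) fun s₁ h₁ hF₁ _ => ?_
  · intro z hz
    simp only [RamExpr.eval, RamState.setReg_arr, RamState.setArr_arr, if_true, hr₁,
      Function.update_apply]
    split
    · omega
    · exact h₁ z (by omega)
  have hB₁ := hB.of_frame hF₁ rfl
  have ha₁ : s₁.arr 17 = m := hF₁.2 17 rfl
  let good : (ℕ → ℕ → Prop) → RamState → Prop := fun done s' =>
    (∀ x < σ.length, ∀ y < σ.length, s'.arr 18 x = s'.arr 18 y → D.Joined σ m x y) ∧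
      ∀ x < σ.length, ∀ y < σ.length, done x y → D.Link σ m x y → s'.arr 18 x = s'.arr 18 y
  refine Run.count hw σ.length (fun j => good fun x _ => x < j) rfl rfl rfl
    (fun s' hF => (hB₁.of_frame hF rfl).len) ?_ ?_ ?_
  · refine ⟨fun x hx y hy h => ?_, fun x _ y _ h => absurd h (Nat.not_lt_zero _)⟩
    simp only [RamState.setReg_arr, h₁ x hx, h₁ y hy] at h
    rw [h]
    exact .refl
  · intro x hx s₂ h₂ hr₂ hF₂ _
    have hB₂ := hB₁.of_frame hF₂ rfl
    have ha₂ : s₂.arr 17 = m := (hF₂.2 17 rfl).trans ha₁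
    refine Run.count hw σ.length (fun j => good fun x' y => x' < x ∨ x' = x ∧ y < j) rfl rfl rfl
      (fun s' hF => (hB₂.of_frame hF rfl).len) ?_ ?_ ?_
    · refine ⟨h₂.1, fun x' hx' y hy h => h₂.2 x' hx' y hy (by omega)⟩
    · intro y hy s₃ h₃ hr₃ hF₃ _
      have hB₃ := hB₂.of_frame hF₃ rfl
      have ha₃ : s₃.arr 17 = m := (hF₃.2 17 rfl).trans ha₂
      have hx₃ : s₃.reg 14 = x := (hF₃.1 14 rfl).trans hr₂
      have hval := linkExpr_eval hB₃ hp (by rw [ha₃]; exact hm) (by omega) (by omega)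
      rw [ha₃, hx₃, hr₃] at hval
      refine Run.cond hw rfl (fun hne => (run_uniteProg hw hB₃).conseq le_rfl
        fun s₄ h₄ _ _ => ?_) fun h0 => Run.skip ?_
      · have hl := hval.1 hne
        rw [hx₃, hr₃] at h₄
        refine ⟨fun a ha b hb h => ?_, fun a ha b hb h hab => ?_⟩
        · simp only [RamState.setReg_arr, h₄ a ha, h₄ b hb] at h
          split_ifs at h with h5 h6 h6
          · exact (h₃.1 a ha y hy h5).trans (h₃.1 b hb y hy h6).symm
          · exact ((h₃.1 a ha y hy h5).trans (.single hl.symm)).trans (h₃.1 x hx b hb h)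
          · exact ((h₃.1 a ha x hx h).trans (.single hl)).trans (h₃.1 b hb y hy h6).symm
          · exact h₃.1 a ha b hb h
        · simp only [RamState.setReg_arr, h₄ a ha, h₄ b hb]
          by_cases hold : a < x ∨ a = x ∧ b < y
          · rw [h₃.2 a ha b hb hold hab]
          · obtain ⟨rfl, rfl⟩ : a = x ∧ b = y := by omega
            simp
      · have hl : ¬ D.Link σ m x y := fun h => hval.2 h h0
        refine ⟨h₃.1, fun a ha b hb h hab => ?_⟩
        by_cases hold : a < x ∨ a = x ∧ b < y
        · exact h₃.2 a ha b hb hold hab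
        · obtain ⟨rfl, rfl⟩ : a = x ∧ b = y := by omega
          exact absurd hab hl
    · intro s₃ h₃ _ _
      exact ⟨h₃.1, fun a ha b hb h => h₃.2 a ha b hb (by omega)⟩
  · intro s₂ h₂ _ hF₂
    have ha₂ : s₂.arr 17 = m := (hF₂.2 17 rfl).trans ha₁
    intro x hx y hy
    rw [ha₂]
    refine ⟨h₂.1 x hx y hy, fun h => ?_⟩
    -- The bound on the end of the path is dropped so that the induction can vary this end; each
    -- link carries its own bounds.
    clear hy
    induction h with
    | refl => rfl
    | tail _ h ih => exact ih.trans (h₂.2 _ h.1 _ h.2.1 h.1 h)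

/-- The maximum is formed as `x + (y - x)` with truncated subtraction. Its start value `0` need not
be attained if the loop is empty, hence the alternative in the last clause. -/
theorem run_compProg (hw : RamBound V w) (hB : InputTables D σ s) (hN : Numbered D σ s)
    (hr : s.reg 17 < σ.length) :
    Run V w compProg s (65 + (σ.length * (129 + 65 + 200) + 200)) fun s' =>
      (∀ q < σ.length, s'.arr 19 q = D.comp σ (s.arr 17) (s.reg 17) q) ∧
      (∀ q < σ.length, s'.arr 19 q ≤ s'.reg 18) ∧
      (s'.reg 18 = 0 ∨ ∃ q < σ.length, s'.arr 19 q = s'.reg 18) := by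
  refine Run.seq (Q := fun s' => s'.reg 18 = 0) (Run.assign hw rfl (Run.tame hw rfl)
    (by simp [RamExpr.eval])) fun s₁ h₁ hF₁ _ => ?_
  have hB₁ := hB.of_frame hF₁ rfl
  refine Run.count hw σ.length (fun j s' =>
    (∀ q < j, s'.arr 19 q = D.comp σ (s.arr 17) (s.reg 17) q) ∧
      (∀ q < j, s'.arr 19 q ≤ s'.reg 18) ∧
      (s'.reg 18 = 0 ∨ ∃ q < j, s'.arr 19 q = s'.reg 18)) rfl rfl rfl
    (fun s' hF => (hB₁.of_frame hF rfl).len) (by simp [h₁]) ?_ (fun s₂ h₂ _ _ => h₂)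
  intro j hj s₂ h₂ hr₂ hF₂ hb₂
  have h17 : s₂.arr 17 = s.arr 17 := (hF₂.2 17 rfl).trans (hF₁.2 17 rfl)
  have h18 : s₂.arr 18 = s.arr 18 := (hF₂.2 18 rfl).trans (hF₁.2 18 rfl)
  have hr17 : s₂.reg 17 = s.reg 17 := (hF₂.1 17 rfl).trans (hF₁.1 17 rfl)
  have hval : ((RamExpr.eq (.get 18 (.reg 14)) (.get 18 (.reg 17))).mul
      (.get 17 (.reg 14))).eval s₂ = D.comp σ (s.arr 17) (s.reg 17) j := by
    simp only [RamExpr.eval, hr₂, h18, hr17, h17]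
    by_cases hJ : D.Joined σ (s.arr 17) (s.reg 17) j
    · rw [comp_of_joined hJ, if_pos ((hN _ hj _ hr).2 hJ.symm), one_mul]
    · rw [if_neg fun h => hJ ((hN _ hj _ hr).1 h).symm, zero_mul]
      by_contra h
      exact hJ (joined_of_comp (Ne.symm h))
  have hle : D.comp σ (s.arr 17) (s.reg 17) j ≤ V := by
    rw [← hval]
    refine (Nat.mul_le_mul_right _ (?_ : _ ≤ 1)).trans ((one_mul _).trans_le (hb₂.2 _ _))
    by_cases h : s₂.arr 18 (s₂.reg 14) = s₂.arr 18 (s₂.reg 17) <;> simp [RamExpr.eval, h]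
  refine Run.seq (Q := fun s' => s'.arr 19 = Function.update (s₂.arr 19) j
    (D.comp σ (s.arr 17) (s.reg 17) j)) (Run.store hw rfl rfl (fun _ => hval ▸ hle) ?_)
    fun s₃ h₃ hF₃ hb₃ => Run.assign hw rfl (fun hb => ?_) ?_
  · rw [hval]
    simp [RamExpr.eval, hr₂]
  · simp only [RamExpr.eval]
    have := hb.1 18
    have := hb.2 19 (s₃.reg 14)
    omega
  · have e14 : s₃.reg 14 = j := (hF₃.1 14 rfl).trans hr₂
    have e18 : s₃.reg 18 = s₂.reg 18 := hF₃.1 18 rfl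
    simp only [RamExpr.eval, e14, h₃, Function.update_self, e18, RamState.setReg_arr,
      RamState.setReg_reg, Nat.reduceEqDiff, if_false, if_true]
    set c := D.comp σ (s.arr 17) (s.reg 17) j
    refine ⟨fun q hq => ?_, fun q hq => ?_, ?_⟩
    · rw [Function.update_apply]
      split
      · next h => rw [h]
      · exact h₂.1 q (by omega)
    · rw [Function.update_apply]
      split
      · omega
      · have := h₂.2.1 q (by omega)
        omega
    · by_cases hc : s₂.reg 18 ≤ c
      · exact .inr ⟨j, by omega, by rw [Function.update_self]; omega⟩
      · rcases h₂.2.2 with h | ⟨q, hq, h⟩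
        · omega
        · refine .inr ⟨q, by omega, ?_⟩
          rw [Function.update_of_ne (by omega), h]
          omega

/-! ### The trie -/

/-- The node reached after `j` steps along the labels `m`. -/
def trieNode (T : ℕ → ℕ) (K : ℕ) (m : ℕ → ℕ) : ℕ → ℕ
  | 0 => 0
  | j + 1 => T (trieNode T K m j * K + m j)

/-- All edges on the path along the first `l` labels `m` exist. -/
def TriePath (T : ℕ → ℕ) (K : ℕ) (m : ℕ → ℕ) (l : ℕ) : Prop :=
  ∀ j < l, trieNode T K m (j + 1) ≠ 0

/-- Nodes are at most `n`, and every node has one incoming edge. -/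
structure IsTrie (T : ℕ → ℕ) (n : ℕ) : Prop where
  le : ∀ a, T a ≤ n
  inj : ∀ a b, T a = T b → T a ≠ 0 → a = b

variable {T T' : ℕ → ℕ} {K l n : ℕ} {m m' : ℕ → ℕ}

theorem IsTrie.trieNode_le (h : IsTrie T n) (j : ℕ) : trieNode T K m j ≤ n := by
  cases j with
  | zero => exact Nat.zero_le _
  | succ j => exact h.le _

/-- A trie that only gains edges leaves existing paths in place, so node numbers are permanent names
of assignments. -/
theorem trieNode_mono (hT : ∀ a, T a ≠ 0 → T' a = T a) (h : TriePath T K m l) {j : ℕ}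
    (hj : j ≤ l) : trieNode T' K m j = trieNode T K m j := by
  induction j with
  | zero => rfl
  | succ j ih =>
    have h1 := h j (by omega)
    simp only [trieNode] at h1 ⊢
    rw [ih (by omega), hT _ h1]

theorem TriePath.mono (hT : ∀ a, T a ≠ 0 → T' a = T a) (h : TriePath T K m l) :
    TriePath T' K m l := fun j hj => by
  rw [trieNode_mono hT h (by omega)]
  exact h j hj

theorem trieNode_congr (hm : ∀ q < l, m q = m' q) {j : ℕ} (hj : j ≤ l) :
    trieNode T K m j = trieNode T K m' j := by
  induction j with
  | zero => rfl
  | succ j ih =>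
    simp only [trieNode]
    rw [ih (by omega), hm j (by omega)]

theorem TriePath.congr (h : TriePath T K m l) (hm : ∀ q < l, m q = m' q) :
    TriePath T K m' l := fun j hj => by
  rw [← trieNode_congr hm (by omega)]
  exact h j hj

/-- The path is read backwards: the address `v * K + y` of the only edge into a node gives the label
`y` modulo `K`, and then the parent `v`. -/
theorem IsTrie.eq_of_trieNode_eq (hT : IsTrie T n) (hm : ∀ q < l, m q < K)
    (hm' : ∀ q < l, m' q < K) (h : TriePath T K m l) (h' : TriePath T K m' l)
    (heq : trieNode T K m l = trieNode T K m' l) : ∀ q < l, m q = m' q := by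
  induction l with
  | zero => intro q hq; omega
  | succ l ih =>
    have h1 := hT.inj _ _ heq (h l (by omega))
    have hK : 0 < K := (Nat.zero_le _).trans_lt (hm l (by omega))
    have h2 : m l = m' l := by
      have := congrArg (· % K) h1
      simpa [Nat.add_mod, Nat.mod_eq_of_lt (hm l (by omega)),
        Nat.mod_eq_of_lt (hm' l (by omega))] using this
    have h3 : trieNode T K m l = trieNode T K m' l := by
      rw [h2] at h1
      exact Nat.eq_of_mul_eq_mul_right hK (Nat.add_right_cancel h1)
    intro q hq
    rcases Nat.lt_succ_iff_lt_or_eq.1 hq with h4 | rfl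
    · exact ih (fun q hq => hm q (by omega)) (fun q hq => hm' q (by omega))
        (fun j hj => h j (by omega)) (fun j hj => h' j (by omega)) h3 q h4
    · exact h2

/-- The number `n + 1` is not yet the target of any edge. -/
theorem IsTrie.update (hT : IsTrie T n) (a : ℕ) :
    IsTrie (Function.update T a (n + 1)) (n + 1) := by
  refine ⟨fun b => ?_, fun b c h h0 => ?_⟩
  · rw [Function.update_apply]
    split
    · exact le_rfl
    · exact (hT.le b).trans (Nat.le_succ n)
  · have h1 := hT.le b
    have h2 := hT.le c
    simp only [Function.update_apply] at h h0
    split_ifs at h h0 with h3 h4 h4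
    · rw [h3, h4]
    · omega
    · omega
    · exact hT.inj b c h h0

/-- At most one node is added per position. The last clause, that an existing path adds none, is
what lets a repeated check leave the tables untouched. -/
theorem run_walkProg (hw : RamBound V w) (hB : InputTables D σ s)
    (hT : IsTrie (s.arr 11) (s.reg 3)) (hc : ∀ q < σ.length, s.arr 19 q < D.top + 1)
    (hV : (s.reg 3 + σ.length + 1) * (D.top + 1) ≤ V) :
    Run V w walkProg s (65 + (σ.length * (65 + (65 + (65 + 129 + 1) + 65) + 200) + 200)) fun s' =>
      IsTrie (s'.arr 11) (s'.reg 3) ∧ (∀ a, s.arr 11 a ≠ 0 → s'.arr 11 a = s.arr 11 a) ∧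
      s'.reg 3 ≤ s.reg 3 + σ.length ∧ TriePath (s'.arr 11) (D.top + 1) (s.arr 19) σ.length ∧
      s'.reg 19 = trieNode (s'.arr 11) (D.top + 1) (s.arr 19) σ.length ∧
      (TriePath (s.arr 11) (D.top + 1) (s.arr 19) σ.length →
        s'.arr 11 = s.arr 11 ∧ s'.reg 3 = s.reg 3) := by
  set K := D.top + 1
  set c := s.arr 19
  refine Run.seq (Q := fun s' => s'.reg 19 = 0) (Run.assign hw rfl (Run.tame hw rfl)
    (by simp [RamExpr.eval])) fun s₁ h₁ hF₁ _ => ?_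
  have hB₁ := hB.of_frame hF₁ rfl
  refine Run.count hw σ.length (fun j s' =>
      IsTrie (s'.arr 11) (s'.reg 3) ∧ (∀ a, s.arr 11 a ≠ 0 → s'.arr 11 a = s.arr 11 a) ∧
      s'.reg 3 ≤ s.reg 3 + j ∧ TriePath (s'.arr 11) K c j ∧
      s'.reg 19 = trieNode (s'.arr 11) K c j ∧
      (TriePath (s.arr 11) K c σ.length → s'.arr 11 = s.arr 11 ∧ s'.reg 3 = s.reg 3)) rfl rfl rfl
    (fun s' hF => (hB₁.of_frame hF rfl).len) ?_ ?_ (fun s₂ h₂ _ _ => h₂)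
  · have e3 : s₁.reg 3 = s.reg 3 := hF₁.1 3 rfl
    have e11 : s₁.arr 11 = s.arr 11 := hF₁.2 11 rfl
    simp only [RamState.setReg_arr, RamState.setReg_reg, Nat.reduceEqDiff, if_false, e3, e11, h₁]
    exact ⟨hT, by simp, le_rfl, fun j hj => absurd hj (Nat.not_lt_zero _), rfl,
      fun _ => by simp⟩
  intro j hj s₂ ⟨t₁, t₂, t₃, t₄, t₅, t₆⟩ hr₂ hF₂ hb₂
  have hB₂ := hB₁.of_frame hF₂ rfl
  have e19 : s₂.arr 19 = c := (hF₂.2 19 rfl).trans (hF₁.2 19 rfl)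
  have hcj := hc j hj
  set a := trieNode (s₂.arr 11) K c j * K + c j with ha
  -- The edge address is kept in a register, so it must obey the memory bound: it is below `(v + 1)
  -- * K` for a node `v ≤ s.reg 3 + ℓ`.
  have haV : a ≤ V := by
    have h1 : trieNode (s₂.arr 11) K c j ≤ s.reg 3 + σ.length := (t₁.trieNode_le j).trans (by omega)
    have h2 : (trieNode (s₂.arr 11) K c j + 1) * K ≤ (s.reg 3 + σ.length + 1) * K :=
      Nat.mul_le_mul_right _ (by omega)
    rw [Nat.add_mul] at h2
    omega
  have hval : (RamExpr.add (.mul (.reg 19) (.reg 2)) (.get 19 (.reg 14))).eval s₂ = a := by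
    simp only [RamExpr.eval, t₅, hB₂.bound, hr₂, e19, ha, K]
  refine Run.seq (Q := fun s' => s'.reg 20 = a) (Run.assign hw rfl (fun _ => hval ▸ haV)
    (by rw [hval]; simp)) fun s₃ h₃ hF₃ _ => ?_
  have e3 : s₃.reg 3 = s₂.reg 3 := hF₃.1 3 rfl
  have e11 : s₃.arr 11 = s₂.arr 11 := hF₃.2 11 rfl
  refine Run.le (Run.seq (T' := 65) (Q := fun s' => s'.reg 20 = a ∧
      IsTrie (s'.arr 11) (s'.reg 3) ∧ (∀ a, s₂.arr 11 a ≠ 0 → s'.arr 11 a = s₂.arr 11 a) ∧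
      s'.reg 3 ≤ s₂.reg 3 + 1 ∧ s'.arr 11 a ≠ 0 ∧
      (s₂.arr 11 a ≠ 0 → s'.arr 11 = s₂.arr 11 ∧ s'.reg 3 = s₂.reg 3))
    (T := 65 + (65 + 129 + 1)) ?_ fun s₄ h₄ hF₄ _ => ?_) le_rfl
  · refine Run.cond hw rfl (fun hne => ?_) fun h0 => Run.skip ?_
    · simp only [RamExpr.eval, h₃, e11, ne_eq, ite_eq_right_iff, one_ne_zero, imp_false,
        not_not] at hne
      have hsmall : s₂.reg 3 + 1 ≤ V := by
        have : (s.reg 3 + σ.length + 1) * 1 ≤ (s.reg 3 + σ.length + 1) * K :=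
          Nat.mul_le_mul_left _ (by omega)
        omega
      refine Run.seq (Q := fun s' => s'.reg 3 = s₂.reg 3 + 1) (Run.assign hw rfl
        (fun _ => by simpa [RamExpr.eval, e3] using hsmall) (by simp [RamExpr.eval, e3]))
        fun s₄ h₄ hF₄ _ => Run.store hw rfl rfl (Run.tame hw rfl) ?_
      have e20 : s₄.reg 20 = a := (hF₄.1 20 rfl).trans h₃
      have e11' : s₄.arr 11 = s₂.arr 11 := (hF₄.2 11 rfl).trans e11
      simp only [RamExpr.eval, RamState.setArr_reg, RamState.setArr_arr, if_true, e20, h₄, e11']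
      refine ⟨trivial, t₁.update a, fun b hb => ?_, le_rfl, by simp, fun h => absurd hne h⟩
      rw [Function.update_of_ne]
      rintro rfl
      exact hb hne
    · simp only [RamExpr.eval, h₃, e11, ite_eq_right_iff, one_ne_zero, imp_false] at h0
      rw [e11, e3]
      exact ⟨h₃, t₁, fun _ _ => rfl, by omega, h0, fun _ => ⟨rfl, rfl⟩⟩
  · obtain ⟨u₁, u₂, u₃, u₄, u₅, u₆⟩ := h₄
    refine Run.assign hw rfl (Run.tame hw rfl) ?_
    simp only [RamExpr.eval, RamState.setReg_arr, RamState.setReg_reg, Nat.reduceEqDiff, if_false,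
      if_true, u₁]
    have hnode : trieNode (s₄.arr 11) K c j = trieNode (s₂.arr 11) K c j :=
      trieNode_mono u₃ t₄ le_rfl
    refine ⟨u₂, fun b hb => ?_, by omega, fun i hi => ?_, ?_, fun h => ?_⟩
    · rw [← t₂ b hb]
      exact u₃ b (by rw [t₂ b hb]; exact hb)
    · rcases Nat.lt_succ_iff_lt_or_eq.1 hi with h | rfl
      · exact t₄.mono u₃ i h
      · simp only [trieNode, hnode]
        exact u₅
    · simp only [trieNode, hnode]
      rfl
    · obtain ⟨h1, h2⟩ := t₆ h
      have h3 : s₂.arr 11 a ≠ 0 := by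
        rw [ha, h1]
        exact h j hj
      obtain ⟨h4, h5⟩ := u₆ h3
      exact ⟨h4.trans h1, h5.trans h2⟩

end PatternProg

namespace PatternProg

open RamProg Decomposition

variable {V w : ℕ} {π : PointPerm} {D : Decomposition π} {σ : PointPerm} {s s' s'' : RamState}

/-! ### The table of registered assignments -/

/-- The assignment stored for the node `v`. -/
def row (σ : PointPerm) (s : RamState) (v q : ℕ) : ℕ := s.arr 13 (v * σ.length + q)

/-- The assignment `c` has been registered. -/
def Registered (σ : PointPerm) (s : RamState) (c : ℕ → ℕ) : Prop :=
  ∃ v, s.arr 12 v ≠ 0 ∧ ∀ q < σ.length, row σ s v q = c q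

variable (D σ) in
/-- The data structures for the registered assignments are in order. -/
structure Tables (s : RamState) : Prop where
  trie : IsTrie (s.arr 11) (s.reg 3)
  path : ∀ v, s.arr 12 v ≠ 0 → TriePath (s.arr 11) (D.top + 1) (row σ s v) σ.length ∧
    trieNode (s.arr 11) (D.top + 1) (row σ s v) σ.length = v
  entry : ∀ v, s.arr 12 v ≠ 0 → ∃ p < D.s, D.Good σ p (row σ s v) ∧
    ∃ i < s.arr 14 (D.step p).k, s.arr 15 (i * (D.top + 1) + (D.step p).k) = v
  bucket : ∀ p < D.s, ∀ i < s.arr 14 (D.step p).k,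
    s.arr 12 (s.arr 15 (i * (D.top + 1) + (D.step p).k)) ≠ 0 ∧
    D.Good σ p (row σ s (s.arr 15 (i * (D.top + 1) + (D.step p).k)))
  inj : ∀ p < D.s, ∀ i < s.arr 14 (D.step p).k, ∀ j < s.arr 14 (D.step p).k,
    s.arr 15 (i * (D.top + 1) + (D.step p).k) = s.arr 15 (j * (D.top + 1) + (D.step p).k) → i = j
  value : ∀ v, s.arr 16 v ≠ 0 → s.arr 12 v ≠ 0 ∧ D.Realizable σ (row σ s v)

/-- The registered assignments are the same. -/
structure SameTables (s s' : RamState) : Prop where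
  reg : s'.reg 3 = s.reg 3
  arr : ∀ a, 11 ≤ a → a ≤ 15 → s'.arr a = s.arr a

theorem SameTables.refl (s : RamState) : SameTables s s := ⟨rfl, fun _ _ _ => rfl⟩

theorem SameTables.trans (h : SameTables s s') (h' : SameTables s' s'') : SameTables s s'' :=
  ⟨h'.reg.trans h.reg, fun a h1 h2 => (h'.arr a h1 h2).trans (h.arr a h1 h2)⟩

theorem SameTables.row (h : SameTables s s') : row σ s' = row σ s := by
  funext v q
  simp only [PatternProg.row, h.arr 13 (by omega) (by omega)]

theorem SameTables.registered (h : SameTables s s') (c : ℕ → ℕ) :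
    Registered σ s' c ↔ Registered σ s c := by
  simp only [Registered, h.row, h.arr 12 (by omega) (by omega)]

theorem Tables.of_same (hT : Tables D σ s) (h : SameTables s s') (hv : s'.arr 16 = s.arr 16) :
    Tables D σ s' := by
  have h11 := h.arr 11 (by omega) (by omega)
  have h12 := h.arr 12 (by omega) (by omega)
  have h14 := h.arr 14 (by omega) (by omega)
  have h15 := h.arr 15 (by omega) (by omega)
  constructor
  · rw [h11, h.reg]; exact hT.trie
  · rw [h11, h12, h.row]; exact hT.path
  · rw [h12, h14, h15, h.row]; exact hT.entry
  · rw [h12, h14, h15, h.row]; exact hT.bucket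
  · rw [h14, h15]; exact hT.inj
  · rw [h12, hv, h.row]; exact hT.value

variable (D σ) in
/-- Registered assignments are kept, and new ones only use labels below `k`. -/
structure Grows (k : ℕ) (s s' : RamState) : Prop where
  seen : ∀ v, s.arr 12 v ≠ 0 → s'.arr 12 v ≠ 0 ∧ ∀ q < σ.length, row σ s' v q = row σ s v q
  new : ∀ v, s'.arr 12 v ≠ 0 → s.arr 12 v ≠ 0 ∨ ∀ q < σ.length, row σ s' v q < k
  entries : ∀ p < D.s, ∀ i < s.arr 14 (D.step p).k, i < s'.arr 14 (D.step p).k ∧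
    s'.arr 15 (i * (D.top + 1) + (D.step p).k) = s.arr 15 (i * (D.top + 1) + (D.step p).k)

theorem SameTables.grows (h : SameTables s s') (k : ℕ) : Grows D σ k s s' := by
  constructor
  · rw [h.row, h.arr 12 (by omega) (by omega)]
    exact fun v hv => ⟨hv, fun _ _ => rfl⟩
  · rw [h.arr 12 (by omega) (by omega)]
    exact fun v hv => .inl hv
  · rw [h.arr 14 (by omega) (by omega), h.arr 15 (by omega) (by omega)]
    exact fun _ _ i hi => ⟨hi, rfl⟩

theorem Grows.trans {k : ℕ} (h : Grows D σ k s s') (h' : Grows D σ k s' s'') : Grows D σ k s s'' := by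
  constructor
  · intro v hv
    obtain ⟨h1, h2⟩ := h.seen v hv
    obtain ⟨h3, h4⟩ := h'.seen v h1
    exact ⟨h3, fun q hq => (h4 q hq).trans (h2 q hq)⟩
  · intro v hv
    rcases h'.new v hv with h1 | h1
    · rcases h.new v h1 with h2 | h2
      · exact .inl h2
      · exact .inr fun q hq => by rw [(h'.seen v h1).2 q hq]; exact h2 q hq
    · exact .inr h1
  · intro p hp i hi
    obtain ⟨h1, h2⟩ := h.entries p hp i hi
    obtain ⟨h3, h4⟩ := h'.entries p hp i h1
    exact ⟨h3, h4.trans h2⟩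

theorem Grows.registered {k : ℕ} (h : Grows D σ k s s') {c : ℕ → ℕ} (hc : Registered σ s c) :
    Registered σ s' c := by
  obtain ⟨v, hv, hr⟩ := hc
  obtain ⟨h1, h2⟩ := h.seen v hv
  exact ⟨v, h1, fun q hq => (h2 q hq).trans (hr q hq)⟩

theorem Tables.row_lt (hT : Tables D σ s) (hπ : π.Reduced) {v : ℕ} (hv : s.arr 12 v ≠ 0) {q : ℕ}
    (hq : q < σ.length) : row σ s v q < D.top + 1 := by
  obtain ⟨p, hp, hg, _⟩ := hT.entry v hv
  by_cases h0 : row σ s v q = 0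
  · omega
  · exact Nat.lt_succ_of_le (D.le_top hπ hp (hg.mem q hq h0))

/-- A node on the path of `c` that is registered stores `c`. -/
theorem Tables.row_eq (hT : Tables D σ s) (hπ : π.Reduced) {v : ℕ} (hv : s.arr 12 v ≠ 0)
    {c : ℕ → ℕ} (hc : ∀ q < σ.length, c q < D.top + 1)
    (hp : TriePath (s.arr 11) (D.top + 1) c σ.length)
    (hn : trieNode (s.arr 11) (D.top + 1) c σ.length = v) : ∀ q < σ.length, row σ s v q = c q :=
  hT.trie.eq_of_trieNode_eq (fun _ => hT.row_lt hπ hv) hc (hT.path v hv).1 hp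
    ((hT.path v hv).2.trans hn.symm)

/-- The entries are distinct nodes, and a node is the end of the trie path of its stored assignment;
so the assignments are pairwise different and `card_good_le` applies. Only here does the width enter
the analysis of the data structures. -/
theorem Tables.bucket_le (hT : Tables D σ s) {d p : ℕ} (hd : D.IsWide d) (hp : p < D.s) :
    s.arr 14 (D.step p).k ≤ (2 * d * σ.length + 1) ^ σ.length := by
  refine card_good_le hd hp
    (fun i => row σ s (s.arr 15 (i * (D.top + 1) + (D.step p).k)))
    (fun i hi => (hT.bucket p hp i hi).2) fun i hi j hj h => hT.inj p hp i hi j hj ?_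
  rw [← (hT.path _ (hT.bucket p hp i hi).1).2, trieNode_congr h le_rfl]
  exact (hT.path _ (hT.bucket p hp j hj).1).2

theorem run_registerProg (hw : RamBound V w) (hB : InputTables D σ s) (hT : Tables D σ s)
    (hπ : π.Reduced) {p : ℕ} (hp : p < D.s) (hk : s.reg 18 = (D.step p).k)
    (hg : D.Good σ p (s.arr 19))
    (hpath : TriePath (s.arr 11) (D.top + 1) (s.arr 19) σ.length)
    (hnode : trieNode (s.arr 11) (D.top + 1) (s.arr 19) σ.length = s.reg 19)
    (hV : s.arr 14 (D.step p).k + 1 ≤ V) :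
    Run V w registerProg s (65 + (129 + (σ.length * (129 + 200) + 200 + (129 + 129)) + 1)) fun s' =>
      Tables D σ s' ∧ Grows D σ ((D.step p).k + 1) s s' ∧ s'.arr 12 (s.reg 19) ≠ 0 ∧
      (∀ q < σ.length, row σ s' (s.reg 19) q = s.arr 19 q) ∧
      (s.arr 12 (s.reg 19) ≠ 0 → SameTables s s') ∧
      (∀ v, s'.arr 12 v ≠ 0 → s.arr 12 v ≠ 0 ∨ v = s.reg 19) := by
  set v := s.reg 19 with hv
  set c := s.arr 19 with hc
  set K := D.top + 1 with hK
  set k := (D.step p).k with hkdef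
  have hkK : k < K := Nat.lt_succ_of_le (D.le_top hπ hp (D.step_k_mem hp))
  have hcK : ∀ q < σ.length, c q < K := fun q hq => (hg.le hp hq).trans_lt hkK
  refine Run.cond hw rfl (fun hne => ?_) fun h0 => Run.skip ?_
  swap
  · replace h0 : s.arr 12 v ≠ 0 := RamExpr.eq_eval_eq_zero.1 h0
    exact ⟨hT, (SameTables.refl s).grows _, h0, hT.row_eq hπ h0 hcK hpath hnode,
      fun _ => .refl s, fun _ h => .inl h⟩
  replace hne : s.arr 12 v = 0 := RamExpr.eq_eval_ne_zero.1 hne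
  refine Run.seq (Q := fun s' => s'.arr 12 = Function.update (s.arr 12) v 1) (Run.store hw rfl rfl
    (Run.tame hw rfl) (by simp [RamExpr.eval, hv])) fun s₁ h₁ hF₁ _ => ?_
  have hB₁ := hB.of_frame hF₁ rfl
  refine Run.seq (Q := fun s' => (∀ q < σ.length, row σ s' v q = c q) ∧
      ∀ u ≠ v, ∀ q < σ.length, row σ s' u q = row σ s u q)
    (Run.count hw σ.length (T := 129) (fun j s' => (∀ q < j, row σ s' v q = c q) ∧
      ∀ u ≠ v, ∀ q < σ.length, row σ s' u q = row σ s u q) rfl rfl rfl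
      (fun s' hF => (hB₁.of_frame hF rfl).len) ?_ ?_ (fun _ h _ _ => h)) ?_
  · refine ⟨fun q hq => absurd hq (Nat.not_lt_zero _), fun u _ q _ => ?_⟩
    simp only [row, RamState.setReg_arr, hF₁.2 13 rfl]
  · intro j hj s₂ h₂ hr₂ hF₂ _
    refine Run.store hw rfl rfl (Run.tame hw rfl) ?_
    have e19 : s₂.reg 19 = v := (hF₂.1 19 rfl).trans (hF₁.1 19 rfl)
    have e0 : s₂.reg 0 = σ.length := (hB₁.of_frame hF₂ rfl).len
    have ec : s₂.arr 19 = c := (hF₂.2 19 rfl).trans (hF₁.2 19 rfl)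
    simp only [RamExpr.eval, row, RamState.setReg_arr, RamState.setArr_arr, if_true, e19, e0, ec,
      hr₂, Function.update_apply]
    refine ⟨fun q hq => ?_, fun u hu q hq => ?_⟩
    · split
      · next h => rw [show q = j by omega]
      · exact h₂.1 q (by omega)
    · rw [if_neg]
      · exact h₂.2 u hu q hq
      -- Rows of different nodes occupy disjoint blocks of length `ℓ`, so division by `ℓ` recovers
      -- the node.
      · intro h
        apply hu
        have h1 : (u * σ.length + q) / σ.length = u := by
          rw [mul_comm, Nat.mul_add_div (by omega), Nat.div_eq_of_lt hq, add_zero]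
        have h2 : (v * σ.length + j) / σ.length = v := by
          rw [mul_comm, Nat.mul_add_div (by omega), Nat.div_eq_of_lt hj, add_zero]
        rw [← h1, h, h2]
  intro s₂ h₂ hF₂ _
  have hB₂ := hB₁.of_frame hF₂ rfl
  have e18 : s₂.reg 18 = k := ((hF₂.1 18 rfl).trans (hF₁.1 18 rfl)).trans hk
  have e19 : s₂.reg 19 = v := (hF₂.1 19 rfl).trans (hF₁.1 19 rfl)
  have e14 : s₂.arr 14 = s.arr 14 := (hF₂.2 14 rfl).trans (hF₁.2 14 rfl)
  have e15 : s₂.arr 15 = s.arr 15 := (hF₂.2 15 rfl).trans (hF₁.2 15 rfl)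
  refine Run.seq (Q := fun s' => s'.arr 15 =
      Function.update (s.arr 15) (s.arr 14 k * K + k) v)
    (Run.store hw rfl rfl (Run.tame hw rfl)
      (by simp [RamExpr.eval, e18, e19, e14, e15, hB₂.bound, hK]))
    fun s₃ h₃ hF₃ _ => Run.store hw rfl rfl (fun _ => ?_) ?_
  · simp only [RamExpr.eval, hF₃.1 18 rfl, e18, hF₃.2 14 rfl, e14]
    exact hV
  set s₄ := s₃.setArr 14 (RamExpr.eval s₃ (.reg 18))
    (RamExpr.eval s₃ (.add (.get 14 (.reg 18)) (.lit 1))) with hs₄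
  have f14 : s₄.arr 14 = Function.update (s.arr 14) k (s.arr 14 k + 1) := by
    simp [hs₄, RamExpr.eval, hF₃.1 18 rfl, e18, hF₃.2 14 rfl, e14]
  have f12 : s₄.arr 12 = Function.update (s.arr 12) v 1 := by
    simp [hs₄, hF₃.2 12 rfl, hF₂.2 12 rfl, h₁]
  have f11 : s₄.arr 11 = s.arr 11 := by
    simp [hs₄, hF₃.2 11 rfl, hF₂.2 11 rfl, hF₁.2 11 rfl]
  have f15 : s₄.arr 15 = Function.update (s.arr 15) (s.arr 14 k * K + k) v := by
    simp [hs₄, h₃]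
  have f16 : s₄.arr 16 = s.arr 16 := by
    simp [hs₄, hF₃.2 16 rfl, hF₂.2 16 rfl, hF₁.2 16 rfl]
  have f3 : s₄.reg 3 = s.reg 3 := by
    simp [hs₄, hF₃.1 3 rfl, hF₂.1 3 rfl, hF₁.1 3 rfl]
  have frow : ∀ u, row σ s₄ u = row σ s₂ u := by
    intro u
    funext q
    simp [row, hs₄, hF₃.2 13 rfl]
  have frv : ∀ q < σ.length, c q = row σ s₄ v q := fun q hq => by
    rw [frow]; exact (h₂.1 q hq).symm
  have fru : ∀ u ≠ v, ∀ q < σ.length, row σ s u q = row σ s₄ u q := fun u hu q hq => by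
    rw [frow]; exact (h₂.2 u hu q hq).symm
  have hold : ∀ u, s₄.arr 12 u ≠ 0 → u ≠ v → s.arr 12 u ≠ 0 := by
    intro u h hu
    rwa [f12, Function.update_of_ne hu] at h
  have hnew : s₄.arr 12 v ≠ 0 := by simp [f12]
  have hsne : ∀ u, s.arr 12 u ≠ 0 → u ≠ v := fun u h h' => h (h' ▸ hne)
  have hseen : ∀ u, s.arr 12 u ≠ 0 → s₄.arr 12 u ≠ 0 := by
    intro u h
    rw [f12, Function.update_of_ne (hsne u h)]
    exact h
  -- The residue modulo `K` of an address identifies the bucket, and the quotient the entry; the new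
  -- entry therefore overwrites no old one.
  have haddr : ∀ p' < D.s, ∀ i < s.arr 14 (D.step p').k,
      i * K + (D.step p').k ≠ s.arr 14 k * K + k := by
    intro p' hp' i hi h
    have hk' : (D.step p').k < K := Nat.lt_succ_of_le (D.le_top hπ hp' (D.step_k_mem hp'))
    have h1 : (D.step p').k = k := by
      have := congrArg (· % K) h
      simpa [Nat.add_mod, Nat.mod_eq_of_lt hk', Nat.mod_eq_of_lt hkK] using this
    rw [h1] at h hi
    have := Nat.eq_of_mul_eq_mul_right (by omega) (Nat.add_right_cancel h)
    omega
  have hcount : ∀ y, s.arr 14 y ≤ s₄.arr 14 y := by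
    intro y
    rw [f14, Function.update_apply]
    split
    · next h => rw [h]; omega
    · exact le_rfl
  have hentry : ∀ p' < D.s, ∀ i < s.arr 14 (D.step p').k,
      s₄.arr 15 (i * K + (D.step p').k) = s.arr 15 (i * K + (D.step p').k) := by
    intro p' hp' i hi
    rw [f15, Function.update_of_ne (haddr p' hp' i hi)]
  have hlast : s₄.arr 15 (s.arr 14 k * K + k) = v := by simp [f15]
  have hcases : ∀ p' < D.s, ∀ i < s₄.arr 14 (D.step p').k,
      i < s.arr 14 (D.step p').k ∨ (p' = p ∧ i = s.arr 14 k) := by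
    intro p' hp' i hi
    by_cases h : (D.step p').k = k
    · obtain rfl := D.step_k_injective hp' hp h
      simp only [f14, hkdef, Function.update_self] at hi
      simp only [hkdef, true_and]
      omega
    · rw [f14, Function.update_of_ne h] at hi
      exact .inl hi
  refine ⟨⟨?_, ?_, ?_, ?_, ?_, ?_⟩, ⟨?_, ?_, ?_⟩, hnew, fun q hq => (frv q hq).symm,
    fun h => absurd hne h, ?_⟩
  · rw [f11, f3]; exact hT.trie
  · intro u hu
    rw [f11]
    by_cases huv : u = v
    · subst huv
      exact ⟨hpath.congr frv, by rw [← trieNode_congr frv le_rfl]; exact hnode⟩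
    · obtain ⟨h1, h2⟩ := hT.path u (hold u hu huv)
      exact ⟨h1.congr (fru u huv), by rw [← trieNode_congr (fru u huv) le_rfl]; exact h2⟩
  · intro u hu
    by_cases huv : u = v
    · subst huv
      exact ⟨p, hp, hg.congr frv, s.arr 14 k, by simp [f14, hkdef], hlast⟩
    · obtain ⟨p', hp', h1, i, hi, h2⟩ := hT.entry u (hold u hu huv)
      exact ⟨p', hp', h1.congr (fru u huv), i, hi.trans_le (hcount _),
        (hentry p' hp' i hi).trans h2⟩
  · intro p' hp' i hi
    rcases hcases p' hp' i hi with h | ⟨rfl, rfl⟩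
    · rw [hentry p' hp' i h]
      obtain ⟨h1, h2⟩ := hT.bucket p' hp' i h
      exact ⟨hseen _ h1, h2.congr (fru _ (hsne _ h1))⟩
    · rw [hlast]
      exact ⟨hnew, hg.congr frv⟩
  · intro p' hp' i hi j hj h
    have hvne : ∀ i, i < s.arr 14 (D.step p').k → s₄.arr 15 (i * K + (D.step p').k) ≠ v := by
      intro i hi
      rw [hentry p' hp' i hi]
      exact hsne _ (hT.bucket p' hp' i hi).1
    rcases hcases p' hp' i hi with h1 | ⟨h1, h2⟩ <;> rcases hcases p' hp' j hj with h3 | ⟨h3, h4⟩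
    · rw [hentry p' hp' i h1, hentry p' hp' j h3] at h
      exact hT.inj p' hp' i h1 j h3 h
    · subst h3 h4
      exact absurd (h.trans hlast) (hvne i h1)
    · subst h1 h2
      exact absurd (h.symm.trans hlast) (hvne j h3)
    · omega
  · intro u hu
    rw [f16] at hu
    obtain ⟨h1, h2⟩ := hT.value u hu
    exact ⟨hseen u h1, h2.congr (fru u (hsne u h1))⟩
  · intro u hu
    exact ⟨hseen u hu, fun q hq => (fru u (hsne u hu) q hq).symm⟩
  · intro u hu
    by_cases huv : u = v
    · subst huv
      exact .inr fun q hq => by rw [← frv q hq]; exact Nat.lt_succ_of_le (hg.le hp hq)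
    · exact .inl (hold u hu huv)
  · exact fun p' hp' i hi => ⟨hi.trans_le (hcount _), hentry p' hp' i hi⟩
  · intro u hu
    by_cases huv : u = v
    · exact .inr huv
    · exact .inl (hold u hu huv)

end PatternProg

/-- The program leaves the table of registered assignments alone. -/
def RamProg.keepsTables (c : RamProg) : Bool :=
  !c.writesReg 3 && [11, 12, 13, 14, 15].all fun a => !c.writesArr a

namespace PatternProg

open RamProg Decomposition

variable {V w : ℕ} {π : PointPerm} {D : Decomposition π} {σ : PointPerm} {s s' s'' : RamState}

theorem SameTables.of_frame {c : RamProg} (hF : c.Frame s s') (hc : c.keepsTables = true) :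
    SameTables s s' := by
  simp only [RamProg.keepsTables, Bool.and_eq_true, List.all_eq_true, Bool.not_eq_true'] at hc
  refine ⟨hF.1 3 hc.1, fun a h1 h2 => hF.2 a (hc.2 a ?_)⟩
  interval_cases a <;> simp

/-- Adding edges to the trie does not affect the registered assignments. -/
theorem Tables.of_trie (hT : Tables D σ s) (h : IsTrie (s'.arr 11) (s'.reg 3))
    (hle : ∀ a, s.arr 11 a ≠ 0 → s'.arr 11 a = s.arr 11 a)
    (ha : ∀ a, 12 ≤ a → a ≤ 16 → s'.arr a = s.arr a) : Tables D σ s' := by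
  have h12 := ha 12 (by omega) (by omega)
  have h14 := ha 14 (by omega) (by omega)
  have h15 := ha 15 (by omega) (by omega)
  have h16 := ha 16 (by omega) (by omega)
  have hrow : row σ s' = row σ s := by
    funext v q
    simp only [row, ha 13 (by omega) (by omega)]
  constructor
  · exact h
  · rw [h12, hrow]
    intro v hv
    obtain ⟨h1, h2⟩ := hT.path v hv
    exact ⟨h1.mono hle, (trieNode_mono hle h1 le_rfl).trans h2⟩
  · rw [h12, h14, h15, hrow]; exact hT.entry
  · rw [h12, h14, h15, hrow]; exact hT.bucket
  · rw [h14, h15]; exact hT.inj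
  · rw [h12, h16, hrow]; exact hT.value

/-- The assignment does not consist of points only. -/
def Needed (π σ : PointPerm) (c : ℕ → ℕ) : Prop := ∃ q < σ.length, π.length < c q

/-! ### Checking an assignment -/

variable (D σ) in
/-- The effect of handling the component `c`, which only uses labels below `k`. -/
structure RootPost (k : ℕ) (c : ℕ → ℕ) (s s' : RamState) : Prop where
  tables : Tables D σ s'
  grows : Grows D σ k s s'
  count_le : s'.reg 3 ≤ s.reg 3 + σ.length
  registered : Needed π σ c → Registered σ s' c
  same : (Needed π σ c → Registered σ s c) → SameTables s s'
  sound : s'.reg 13 ≠ 0 → s.reg 13 ≠ 0 ∧ D.Realizable σ c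
  complete : s.reg 13 ≠ 0 → (∀ v, s'.arr 12 v ≠ 0 → (∀ q < σ.length, row σ s' v q = c q) →
    s.arr 16 v ≠ 0) → s'.reg 13 ≠ 0

/-- If the largest label is at most `n`, the component consists of points and consistency settles it
without a table entry. Otherwise `exists_good_comp` supplies the step whose bucket receives the
component, and its mark is consulted. -/
theorem run_rootProg (hw : RamBound V w) (hπ : π.Reduced) {d : ℕ} (hd : D.IsWide d)
    (hB : InputTables D σ s) (hT : Tables D σ s) {p : ℕ} (hp : p ≤ D.s)
    (hm : ∀ q < σ.length, s.arr 17 q ≠ 0 → s.arr 17 q ∈ (D.fam p).S) (hN : Numbered D σ s)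
    (hc : D.Consistent σ (s.arr 17)) {k : ℕ} (hk : ∀ q < σ.length, s.arr 17 q < k)
    (hr : s.reg 17 < σ.length) (hV : (s.reg 3 + σ.length + 1) * (D.top + 1) ≤ V)
    (hS : (2 * d * σ.length + 1) ^ σ.length + 1 ≤ V) :
    Run V w rootProg s (σ.length * 1500 + 2000)
      (RootPost D σ k (D.comp σ (s.arr 17) (s.reg 17)) s) := by
  set c := D.comp σ (s.arr 17) (s.reg 17) with hcdef
  have hck : ∀ q < σ.length, c q < k := by
    intro q hq
    by_cases h0 : c q = 0
    · have := hk q hq; omega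
    · rw [hcdef, comp_eq h0]; exact hk q hq
  have hcK : ∀ q < σ.length, c q < D.top + 1 := by
    intro q hq
    by_cases h0 : c q = 0
    · omega
    · have h1 := comp_eq h0
      rw [hcdef, h1]
      rw [hcdef, h1] at h0
      exact Nat.lt_succ_of_le (D.le_top hπ hp (hm q hq h0))
  refine Run.le (Run.seq (run_compProg hw hB hN hr)
    (T' := 65 + (65 + (σ.length * 590 + 200) +
      (65 + (129 + (σ.length * (129 + 200) + 200 + (129 + 129)) + 1) + (65 + (1 + 65))) + 1))
    fun s₁ h₁ hF₁ _ => ?_) (by omega)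
  obtain ⟨hc₁, hle₁, hmax₁⟩ := h₁
  replace hc₁ : ∀ q < σ.length, s₁.arr 19 q = c q := hc₁
  have hB₁ := hB.of_frame hF₁ rfl
  have hS₁ : SameTables s s₁ := .of_frame hF₁ rfl
  have hT₁ := hT.of_same hS₁ (hF₁.2 16 rfl)
  have h13₁ : s₁.reg 13 = s.reg 13 := hF₁.1 13 rfl
  refine Run.cond hw rfl (fun hne => ?_) fun h0 => Run.skip ?_
  swap
  · rw [RamExpr.lt_eval_eq_zero] at h0
    simp only [RamExpr.eval, hB₁.size] at h0
    have hnot : ¬ Needed π σ c := by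
      rintro ⟨q, hq, h⟩
      rw [← hc₁ q hq] at h
      have := hle₁ q hq
      omega
    refine ⟨hT₁, hS₁.grows k, by rw [hS₁.reg]; omega, fun h => absurd h hnot, fun _ => hS₁,
      fun h => ⟨h13₁ ▸ h, realizable_of_points (fun q hq h' => ?_) (hc.comp _)⟩,
      fun h _ => h13₁ ▸ h⟩
    have h1 : c q = s.arr 17 q := comp_eq h'
    have h2 : c q ≤ π.length := by
      rw [← hc₁ q hq]
      exact (hle₁ q hq).trans h0
    rw [h1] at h' h2 ⊢
    exact D.mem_of_le_length hπ hp (hm q hq h') h2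
  rw [RamExpr.lt_eval_ne_zero] at hne
  simp only [RamExpr.eval, hB₁.size] at hne
  obtain ⟨q₀, hq₀, hq₀k⟩ : ∃ q < σ.length, s₁.arr 19 q = s₁.reg 18 :=
    hmax₁.resolve_left (by omega)
  have hneed : Needed π σ c := ⟨q₀, hq₀, by rw [← hc₁ q₀ hq₀, hq₀k]; exact hne⟩
  obtain ⟨p', hp', hk', hgood⟩ := exists_good_comp hπ hp hm
    (r := s.reg 17) (k := s₁.reg 18) (fun q hq => by rw [← hcdef, ← hc₁ q hq]; exact hle₁ q hq)
    ⟨q₀, hq₀, by rw [← hcdef, ← hc₁ q₀ hq₀]; exact hq₀k⟩ hne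
  rw [← hcdef] at hgood
  have hp's : p' < D.s := by omega
  refine Run.seq (run_walkProg hw hB₁ hT₁.trie (fun q hq => by rw [hc₁ q hq]; exact hcK q hq)
    (by rw [hS₁.reg]; exact hV)) fun s₂ ⟨w₁, w₂, w₃, w₄, w₅, w₆⟩ hF₂ _ => ?_
  have hB₂ := hB₁.of_frame hF₂ rfl
  have ha₂ : ∀ a, 12 ≤ a → a ≤ 16 → s₂.arr a = s₁.arr a := by
    intro a h1 h2
    interval_cases a <;> exact hF₂.2 _ rfl
  have hT₂ := hT₁.of_trie w₁ w₂ ha₂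
  have e19 : s₂.arr 19 = s₁.arr 19 := hF₂.2 19 rfl
  have e18 : s₂.reg 18 = s₁.reg 18 := hF₂.1 18 rfl
  have hc₂ : ∀ q < σ.length, s₂.arr 19 q = c q := by rw [e19]; exact hc₁
  have hrow₂ : row σ s₂ = row σ s := by
    funext v q
    simp only [row, ha₂ 13 (by omega) (by omega), hS₁.arr 13 (by omega) (by omega)]
  have h12₂ : s₂.arr 12 = s.arr 12 :=
    (ha₂ 12 (by omega) (by omega)).trans (hS₁.arr 12 (by omega) (by omega))
  have hg₂ : Grows D σ k s s₂ := by
    constructor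
    · rw [hrow₂, h12₂]
      exact fun v hv => ⟨hv, fun _ _ => rfl⟩
    · rw [h12₂]
      exact fun v hv => .inl hv
    · rw [ha₂ 14 (by omega) (by omega), hS₁.arr 14 (by omega) (by omega),
        ha₂ 15 (by omega) (by omega), hS₁.arr 15 (by omega) (by omega)]
      exact fun _ _ i hi => ⟨hi, rfl⟩
  refine Run.seq (run_registerProg hw hB₂ hT₂ hπ hp's (e18.trans hk')
    (hgood.congr fun q hq => (hc₂ q hq).symm) (by rw [e19]; exact w₄) (by rw [e19]; exact w₅.symm)
    ((Nat.add_le_add_right (hT₂.bucket_le hd hp's) 1).trans hS))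
    fun s₃ ⟨r₁, r₂, r₃, r₄, r₅, r₆⟩ hF₃ _ => ?_
  have e19₃ : s₃.reg 19 = s₂.reg 19 := hF₃.1 19 rfl
  have e16₃ : s₃.arr 16 = s.arr 16 := (hF₃.2 16 rfl).trans ((hF₂.2 16 rfl).trans (hF₁.2 16 rfl))
  have e13₃ : s₃.reg 13 = s.reg 13 := (hF₃.1 13 rfl).trans ((hF₂.1 13 rfl).trans h13₁)
  have e3₃ : s₃.reg 3 ≤ s.reg 3 + σ.length := by
    rw [hF₃.1 3 rfl, ← hS₁.reg]; exact w₃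
  have hrow₃ : ∀ q < σ.length, row σ s₃ (s₂.reg 19) q = c q := fun q hq =>
    (r₄ q hq).trans (hc₂ q hq)
  -- Registration on its own yields the bound `(D.step p').k + 1`. Only the node of `c` can be new,
  -- however, and all labels of `c` are below `k`.
  have hg₃ : Grows D σ k s s₃ := by
    refine hg₂.trans ⟨r₂.seen, fun v hv => ?_, r₂.entries⟩
    rcases r₆ v hv with h | rfl
    · exact .inl h
    · exact .inr fun q hq => by rw [hrow₃ q hq]; exact hck q hq
  -- An already registered component has its full path in the trie; the walk ends at its old node,
  -- where registration does nothing.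
  have hsame : (Needed π σ c → Registered σ s c) → SameTables s s₃ := by
    intro h
    obtain ⟨v, hv, hvc⟩ := h hneed
    obtain ⟨h1, h2⟩ := hT.path v hv
    have hcc : ∀ q < σ.length, row σ s v q = s₁.arr 19 q := fun q hq =>
      (hvc q hq).trans (hc₁ q hq).symm
    have hpath : TriePath (s₁.arr 11) (D.top + 1) (s₁.arr 19) σ.length := by
      rw [hS₁.arr 11 (by omega) (by omega)]
      exact h1.congr hcc
    obtain ⟨h3, h4⟩ := w₆ hpath
    have hS₂ : SameTables s₁ s₂ := by
      refine ⟨h4, fun a h5 h6 => ?_⟩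
      rcases h5.eq_or_lt with rfl | h5
      · exact h3
      · exact ha₂ a h5 (by omega)
    have hnode : s₂.reg 19 = v := by
      rw [w₅, h3, hS₁.arr 11 (by omega) (by omega), ← trieNode_congr hcc le_rfl]
      exact h2
    refine (hS₁.trans hS₂).trans (r₅ ?_)
    rw [hnode, h12₂]
    exact hv
  have post : ∀ s₄, SameTables s₃ s₄ → s₄.arr 16 = s₃.arr 16 →
      (s₄.reg 13 ≠ 0 ↔ s.reg 13 ≠ 0 ∧ s.arr 16 (s₂.reg 19) ≠ 0) → RootPost D σ k c s s₄ := by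
    intro s₄ hS₄ hv₄ h₄
    refine ⟨r₁.of_same hS₄ hv₄, hg₃.trans (hS₄.grows k), by rw [hS₄.reg]; exact e3₃,
      fun _ => ?_, fun h => (hsame h).trans hS₄, fun h => ?_, fun h h' => h₄.2 ⟨h, ?_⟩⟩
    · rw [hS₄.registered]
      exact ⟨_, r₃, hrow₃⟩
    · obtain ⟨h1, h2⟩ := h₄.1 h
      rw [← e16₃] at h2
      exact ⟨h1, (r₁.value _ h2).2.congr hrow₃⟩
    · refine h' _ ?_ ?_
      · rw [hS₄.arr 12 (by omega) (by omega)]; exact r₃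
      · rw [hS₄.row]; exact hrow₃
  refine Run.cond hw rfl (fun hne => Run.skip ?_)
    fun h0 => Run.assign hw rfl (Run.tame hw rfl) ?_
  · simp only [RamExpr.eval, e19₃, e16₃] at hne
    exact post _ (.refl _) rfl (by rw [e13₃]; exact ⟨fun h => ⟨h, hne⟩, fun h => h.1⟩)
  · simp only [RamExpr.eval, e19₃, e16₃] at h0
    refine post (s₃.setReg 13 0) ⟨by simp, fun _ _ _ => rfl⟩ rfl ?_
    simp [h0]

variable (D σ) in
/-- The effect of checking the assignment `m`, which only uses labels below `k`. -/
structure CheckPost (k : ℕ) (m : ℕ → ℕ) (s s' : RamState) : Prop where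
  tables : Tables D σ s'
  grows : Grows D σ k s s'
  count_le : s'.reg 3 ≤ s.reg 3 + σ.length * σ.length
  registered : D.Consistent σ m → ∀ r < σ.length, Needed π σ (D.comp σ m r) →
    Registered σ s' (D.comp σ m r)
  same : (D.Consistent σ m → ∀ r < σ.length, Needed π σ (D.comp σ m r) →
    Registered σ s (D.comp σ m r)) → SameTables s s'
  sound : s'.reg 13 ≠ 0 → D.Realizable σ m
  complete : D.Realizable σ m → (∀ r < σ.length, ∀ v, s'.arr 12 v ≠ 0 →
    (∀ q < σ.length, row σ s' v q = D.comp σ m r q) → s.arr 16 v ≠ 0) → s'.reg 13 ≠ 0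

/-- The loop runs over all positions and so treats a component once for each of its positions;
repetitions change nothing. Every round adds at most `ℓ` trie nodes, and a negative answer does not
stop the registration of the remaining components. -/
theorem run_checkProg (hw : RamBound V w) (hπ : π.Reduced) {d : ℕ} (hd : D.IsWide d)
    (hB : InputTables D σ s) (hT : Tables D σ s) {p : ℕ} (hp : p ≤ D.s)
    (hm : ∀ q < σ.length, s.arr 17 q ≠ 0 → s.arr 17 q ∈ (D.fam p).S)
    {k : ℕ} (hk : ∀ q < σ.length, s.arr 17 q < k)
    (hV : (s.reg 3 + σ.length * σ.length + 1) * (D.top + 1) ≤ V)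
    (hS : (2 * d * σ.length + 1) ^ σ.length + 1 ≤ V) :
    Run V w checkProg s (10000 * (σ.length + 1) ^ 3) (CheckPost D σ k (s.arr 17) s) := by
  set m := s.arr 17 with hmdef
  refine Run.le (Run.seq (run_consistentProg hw hB hp hm)
    (T' := 65 + (σ.length * 329 + 200 + (σ.length * (σ.length * (65 +
      (65 + (65 + (σ.length * (195 + 200) + 200)) + 1) + 200) + 200 + 200) + 200) +
      (σ.length * (σ.length * 1500 + 2000 + 200) + 200) + 1))
    fun s₁ h₁ hF₁ _ => ?_) (by ring_nf; nlinarith [sq_nonneg σ.length, pow_nonneg (Nat.zero_le σ.length) 3])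
  have hB₁ := hB.of_frame hF₁ rfl
  have hS₁ : SameTables s s₁ := .of_frame hF₁ rfl
  have hT₁ := hT.of_same hS₁ (hF₁.2 16 rfl)
  have hm₁ : s₁.arr 17 = m := hF₁.2 17 rfl
  refine Run.cond hw rfl (fun hne => ?_) fun h0 => Run.skip ?_
  swap
  · have hnc : ¬ D.Consistent σ m := fun h => h₁.2 h h0
    exact ⟨hT₁, hS₁.grows k, by rw [hS₁.reg]; omega, fun h => absurd h hnc, fun _ => hS₁,
      fun h => absurd h0 h, fun h => absurd h.consistent hnc⟩
  have hcons : D.Consistent σ m := h₁.1 hne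
  refine Run.seq (run_numberProg hw hB₁ hp (by rw [hm₁]; exact hm)) fun s₂ h₂ hF₂ _ => ?_
  have hB₂ := hB₁.of_frame hF₂ rfl
  have hS₂ : SameTables s s₂ := hS₁.trans (.of_frame hF₂ rfl)
  have h16₂ : s₂.arr 16 = s.arr 16 := (hF₂.2 16 rfl).trans (hF₁.2 16 rfl)
  have hT₂ := hT.of_same hS₂ h16₂
  have hm₂ : s₂.arr 17 = m := (hF₂.2 17 rfl).trans hm₁
  have h13₂ : s₂.reg 13 ≠ 0 := by rw [hF₂.1 13 rfl]; exact hne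
  refine Run.count hw σ.length (fun j s' => Tables D σ s' ∧ Grows D σ k s s' ∧
      s'.reg 3 ≤ s.reg 3 + j * σ.length ∧
      (∀ r < j, Needed π σ (D.comp σ m r) → Registered σ s' (D.comp σ m r)) ∧
      ((∀ r < σ.length, Needed π σ (D.comp σ m r) → Registered σ s (D.comp σ m r)) →
        SameTables s s') ∧
      (s'.reg 13 ≠ 0 → ∀ r < j, D.Realizable σ (D.comp σ m r)) ∧
      ((∀ r < j, ∀ v, s'.arr 12 v ≠ 0 → (∀ q < σ.length, row σ s' v q = D.comp σ m r q) →
        s.arr 16 v ≠ 0) → s'.reg 13 ≠ 0)) rfl rfl rfl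
    (fun s' hF => (hB₂.of_frame hF rfl).len) ?_ ?_ ?_
  · have hS₃ : SameTables s₂ (s₂.setReg 17 0) := ⟨rfl, fun _ _ _ => rfl⟩
    refine ⟨hT₂.of_same hS₃ rfl, (hS₂.trans hS₃).grows k, by rw [(hS₂.trans hS₃).reg]; omega,
      fun r hr => absurd hr (Nat.not_lt_zero _), fun _ => hS₂.trans hS₃,
      fun _ r hr => absurd hr (Nat.not_lt_zero _), fun _ => ?_⟩
    simpa using h13₂
  · intro r hr s₃ ⟨i₁, i₂, i₃, i₄, i₅, i₆, i₇⟩ hr₃ hF₃ _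
    have hB₃ := hB₂.of_frame hF₃ rfl
    have hm₃ : s₃.arr 17 = m := (hF₃.2 17 rfl).trans hm₂
    have h16₃ : s₃.arr 16 = s.arr 16 := (hF₃.2 16 rfl).trans h16₂
    have hN₃ : Numbered D σ s₃ := by
      intro x hx y hy
      rw [hF₃.2 18 rfl, hF₃.2 17 rfl]
      exact h₂ x hx y hy
    have hmul : (r + 1) * σ.length ≤ σ.length * σ.length := Nat.mul_le_mul_right _ hr
    rw [Nat.add_mul, one_mul] at hmul
    have hroot := run_rootProg hw hπ hd hB₃ i₁ hp (by rw [hm₃]; exact hm) hN₃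
      (by rw [hm₃]; exact hcons) (k := k) (by rw [hm₃]; exact hk) (by omega)
      (le_trans (Nat.mul_le_mul_right _ (by omega)) hV) hS
    rw [hm₃, hr₃] at hroot
    refine hroot.conseq le_rfl fun s₄ h₄ hF₄ _ => ?_
    have hS₅ : SameTables s₄ (s₄.setReg 17 (r + 1)) := ⟨rfl, fun _ _ _ => rfl⟩
    have hg₅ : Grows D σ k s₃ (s₄.setReg 17 (r + 1)) := h₄.grows.trans (hS₅.grows k)
    refine ⟨h₄.tables.of_same hS₅ rfl, i₂.trans hg₅, ?_, fun r' hr' hneed => ?_, fun h => ?_,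
      fun h r' hr' => ?_, fun h => ?_⟩
    · rw [hS₅.reg, Nat.add_mul, one_mul]
      have := h₄.count_le
      omega
    · rcases Nat.lt_succ_iff_lt_or_eq.1 hr' with h | rfl
      · exact hg₅.registered (i₄ r' h hneed)
      · rw [hS₅.registered]
        exact h₄.registered hneed
    · have h5 := i₅ h
      refine (h5.trans (h₄.same fun hneed => ?_)).trans hS₅
      rw [h5.registered]
      exact h r hr hneed
    · obtain ⟨h5, h6⟩ := h₄.sound (by simpa using h)
      rcases Nat.lt_succ_iff_lt_or_eq.1 hr' with h | rfl
      · exact i₆ h5 r' h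
      · exact h6
    · have h5 : s₃.reg 13 ≠ 0 := i₇ fun r' hr' v hv hvr => by
        obtain ⟨h6, h7⟩ := hg₅.seen v hv
        exact h r' (by omega) v h6 fun q hq => (h7 q hq).trans (hvr q hq)
      have h6 : s₄.reg 13 ≠ 0 := h₄.complete h5 fun v hv hvr => by
        rw [h16₃]
        exact h r (by omega) v hv hvr
      simpa using h6
  · intro s₃ ⟨i₁, i₂, i₃, i₄, i₅, i₆, i₇⟩ _ _
    exact ⟨i₁, i₂, i₃, fun _ => i₄, fun h => i₅ (h hcons),
      fun h => realizable_of_comp hcons (i₆ h), fun _ => i₇⟩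

end PatternProg

/-! ### Congruence below the pattern length -/

namespace Decomposition

variable {π : PointPerm} {D : Decomposition π} {σ : PointPerm}

theorem Consistent.congr {m m' : ℕ → ℕ} (h : D.Consistent σ m) (hm : ∀ q < σ.length, m q = m' q) :
    D.Consistent σ m' := by
  intro x hx y hy
  rw [← hm x hx, ← hm y hy]
  exact h x hx y hy

theorem comp_eq_of_eq {m m' : ℕ → ℕ} (hm : ∀ q < σ.length, m q = m' q) (r : ℕ) :
    ∀ q < σ.length, D.comp σ m r q = D.comp σ m' r q := by
  intro q hq
  by_cases h : D.Joined σ m r q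
  · rw [comp_of_joined h, comp_of_joined ((joined_congr hm r q).1 h), hm q hq]
  · rw [comp, comp, if_neg h, if_neg ((joined_congr hm r q).not.1 h)]

theorem split_eq_of_eq {m m' : ℕ → ℕ} {q : ℕ} (hm : m q = m' q) (p b : ℕ) :
    D.split p b m q = D.split p b m' q := by
  rw [split, split, hm]

end Decomposition

namespace PatternProg

open RamProg Decomposition

variable {V w : ℕ} {π : PointPerm} {D : Decomposition π} {σ : PointPerm} {s s' s'' : RamState}

variable (D σ) in
/-- If `m` is consistent, its components have been registered. -/
def CompsRegistered (s : RamState) (m : ℕ → ℕ) : Prop :=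
  D.Consistent σ m → ∀ r < σ.length, Needed π σ (D.comp σ m r) → Registered σ s (D.comp σ m r)

theorem CompsRegistered.congr {m m' : ℕ → ℕ} (h : CompsRegistered D σ s m)
    (hm : ∀ q < σ.length, m q = m' q) : CompsRegistered D σ s m' := by
  intro hc r hr ⟨q, hq, hn⟩
  have he := comp_eq_of_eq (D := D) hm r
  obtain ⟨v, hv, hvr⟩ := h (hc.congr fun q hq => (hm q hq).symm) r hr
    ⟨q, hq, by rw [he q hq]; exact hn⟩
  exact ⟨v, hv, fun q hq => (hvr q hq).trans (he q hq)⟩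

theorem CompsRegistered.grows {m : ℕ → ℕ} {k : ℕ} (h : CompsRegistered D σ s m)
    (hg : Grows D σ k s s') : CompsRegistered D σ s' m :=
  fun hc r hr hn => hg.registered (h hc r hr hn)

theorem CheckPost.congr {k : ℕ} {m m' : ℕ → ℕ} (h : CheckPost D σ k m s s')
    (hm : ∀ q < σ.length, m q = m' q) : CheckPost D σ k m' s s' where
  tables := h.tables
  grows := h.grows
  count_le := h.count_le
  registered := CompsRegistered.congr h.registered hm
  same := fun h' => h.same (CompsRegistered.congr h' fun q hq => (hm q hq).symm)
  sound := fun h' => (h.sound h').congr hm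
  complete := fun hr h' => h.complete (hr.congr fun q hq => (hm q hq).symm)
    fun r hrl v hv hvr => h' r hrl v hv fun q hq =>
      (hvr q hq).trans (comp_eq_of_eq hm r q hq)

/-! ### Splitting -/

theorem run_splitProg (hw : RamBound V w) (hB : InputTables D σ s) {p : ℕ} (hp : p < D.s)
    (h6 : s.reg 6 = p) (h7 : s.reg 7 = (D.step p).k) :
    Run V w splitProg s (σ.length * 1000 + 1000) fun s' =>
      ∀ q < σ.length, s'.arr 17 q = D.split p (s.reg 11) (row σ s (s.reg 10)) q := by
  set b := s.reg 11
  set v := s.reg 10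
  refine Run.le (Run.seq (Q := fun s' => s'.reg 12 = b) (Run.assign hw rfl (Run.tame hw rfl)
    (by simp [RamExpr.eval, b])) (T' := σ.length * (650 + 200) + 200) fun s₁ h₁ hF₁ _ => ?_)
    (by omega)
  have hB₁ := hB.of_frame hF₁ rfl
  refine Run.count hw σ.length (fun j s' => s'.reg 12 = b / 2 ^ j ∧
    ∀ q < j, s'.arr 17 q = D.split p b (row σ s v) q) rfl rfl rfl
    (fun s' hF => (hB₁.of_frame hF rfl).len) (by simp [h₁]) ?_ (fun _ h _ _ => h.2)
  intro j hj s₂ ⟨i₁, i₂⟩ hr₂ hF₂ _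
  have hB₂ := hB₁.of_frame hF₂ rfl
  have e10 : s₂.reg 10 = v := (hF₂.1 10 rfl).trans (hF₁.1 10 rfl)
  have e6 : s₂.reg 6 = p := ((hF₂.1 6 rfl).trans (hF₁.1 6 rfl)).trans h6
  have e7 : s₂.reg 7 = (D.step p).k := ((hF₂.1 7 rfl).trans (hF₁.1 7 rfl)).trans h7
  have e13 : s₂.arr 13 = s.arr 13 := (hF₂.2 13 rfl).trans (hF₁.2 13 rfl)
  refine Run.le (Run.seq (T' := 65 + (65 + (129 + 129) + 1) + 65)
    (Q := fun s' => s'.arr 17 = Function.update (s₂.arr 17) j (row σ s v j))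
    (Run.store hw rfl rfl (Run.tame hw rfl)
      (by simp [RamExpr.eval, hr₂, e10, hB₂.len, e13, row])) fun s₃ h₃ hF₃ _ => ?_) (by omega)
  have hB₃ := hB₂.of_frame hF₃ rfl
  have e14₃ : s₃.reg 14 = j := (hF₃.1 14 rfl).trans hr₂
  have e7₃ : s₃.reg 7 = (D.step p).k := (hF₃.1 7 rfl).trans e7
  have e6₃ : s₃.reg 6 = p := (hF₃.1 6 rfl).trans e6
  have e12₃ : s₃.reg 12 = b / 2 ^ j := (hF₃.1 12 rfl).trans i₁
  refine Run.seq (T := 65 + (65 + (129 + 129) + 1)) (T' := 65) (Q := fun s' => s'.arr 17 =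
    Function.update (s₂.arr 17) j (D.split p b (row σ s v) j)) ?_ fun s₄ h₄ hF₄ _ => ?_
  · refine Run.cond hw rfl (fun hne => Run.cond hw rfl (fun hne' => ?_) fun h0' => ?_)
      fun h0 => Run.skip ?_
    · have h1 : row σ s v j = (D.step p).k := by
        have := RamExpr.eq_eval_ne_zero.1 hne
        simpa [RamExpr.eval, e14₃, h₃, e7₃] using this
      have h2 : b.testBit j = true := by
        simp only [RamExpr.eval, e12₃] at hne'
        rw [Nat.testBit_eq_decide_div_mod_eq, decide_eq_true_eq]
        omega
      refine Run.store hw rfl rfl (Run.tame hw rfl) ?_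
      simp [RamExpr.eval, e14₃, h₃, e6₃, hB₃.stepI p hp, split, h1, h2]
    · have h1 : row σ s v j = (D.step p).k := by
        have := RamExpr.eq_eval_ne_zero.1 hne
        simpa [RamExpr.eval, e14₃, h₃, e7₃] using this
      have h2 : b.testBit j = false := by
        simp only [RamExpr.eval, e12₃] at h0'
        rw [Nat.testBit_eq_decide_div_mod_eq, decide_eq_false_iff_not]
        omega
      refine Run.store hw rfl rfl (Run.tame hw rfl) ?_
      simp [RamExpr.eval, e14₃, h₃, e6₃, hB₃.stepJ p hp, split, h1, h2]
    · have h1 : row σ s v j ≠ (D.step p).k := by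
        have := RamExpr.eq_eval_eq_zero.1 h0
        simpa [RamExpr.eval, e14₃, h₃, e7₃] using this
      rw [h₃, split, if_neg h1]
  · refine Run.assign hw rfl (Run.tame hw rfl) ?_
    simp only [RamExpr.eval, RamState.setReg_arr, RamState.setReg_reg, Nat.reduceEqDiff, if_false,
      if_true, hF₄.1 12 rfl, e12₃, h₄]
    refine ⟨by rw [Nat.div_div_eq_div_mul, pow_succ], fun q hq => ?_⟩
    rw [Function.update_apply]
    split
    · next h => rw [h]
    · exact i₂ q (by omega)

/-! ### Handling a registered assignment -/

variable (D σ) in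
/-- The components of all splits of the assignment at node `v` have been registered. -/
def NodeClosed (p : ℕ) (s : RamState) (v : ℕ) : Prop :=
  ∀ b < 2 ^ σ.length, CompsRegistered D σ s (D.split p b (row σ s v))

variable (D σ) in
/-- The realizable assignments that use the rectangle of step `p` are known. -/
def Complete (p : ℕ) (s : RamState) : Prop :=
  ∀ v, s.arr 12 v ≠ 0 → D.Good σ p (row σ s v) → D.Realizable σ (row σ s v) → s.arr 16 v ≠ 0

theorem NodeClosed.grows {p k v : ℕ} (h : NodeClosed D σ p s v) (hg : Grows D σ k s s')
    (hv : s.arr 12 v ≠ 0) : NodeClosed D σ p s' v := fun b hb =>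
  ((h b hb).grows hg).congr fun q hq => split_eq_of_eq ((hg.seen v hv).2 q hq).symm p b

variable (D σ) in
/-- The effect of handling the assignment at node `v`. -/
structure NodePost (p v : ℕ) (s s' : RamState) : Prop where
  tables : Tables D σ s'
  grows : Grows D σ (D.step p).k s s'
  count_le : s'.reg 3 ≤ s.reg 3 + 2 ^ σ.length * (σ.length * σ.length)
  mono : ∀ u, s.arr 16 u ≠ 0 → s'.arr 16 u ≠ 0
  closed : NodeClosed D σ p s' v
  same : NodeClosed D σ p s v → SameTables s s'
  complete : NodeClosed D σ p s v → (∀ p' < p, Complete D σ p' s) →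
    D.Realizable σ (row σ s v) → s'.arr 16 v ≠ 0

theorem Tables.mark (hT : Tables D σ s) {v : ℕ} (hv : s.arr 12 v ≠ 0)
    (hr : D.Realizable σ (row σ s v)) : Tables D σ (s.setArr 16 v 1) := by
  refine ⟨hT.trie, hT.path, hT.entry, hT.bucket, hT.inj, fun u hu => ?_⟩
  by_cases h : u = v
  · subst h
    exact ⟨hv, hr⟩
  · refine hT.value u ?_
    simpa [Function.update_apply, h] using hu

/-- Serves both passes: on the way down the point is `closed`, on the way up `same` and `complete`.
Marks set in either pass are sound, because a realizable split makes the assignment realizable. -/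
theorem run_nodeProg (hw : RamBound V w) (hπ : π.Reduced) {d : ℕ} (hd : D.IsWide d)
    (hB : InputTables D σ s) (hT : Tables D σ s) {p : ℕ} (hp : p < D.s)
    (h6 : s.reg 6 = p) (h7 : s.reg 7 = (D.step p).k) (hv : s.arr 12 (s.reg 10) ≠ 0)
    (hg : D.Good σ p (row σ s (s.reg 10)))
    (hV : (s.reg 3 + 2 ^ σ.length * (σ.length * σ.length) + 1) * (D.top + 1) ≤ V)
    (hS : (2 * d * σ.length + 1) ^ σ.length + 1 ≤ V) :
    Run V w nodeProg s (2 ^ σ.length * (13000 * (σ.length + 1) ^ 3) + 200)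
      (NodePost D σ p (s.reg 10) s) := by
  set v := s.reg 10
  set R := row σ s v
  set k := (D.step p).k
  have hone : 1 ≤ (σ.length + 1) ^ 3 := Nat.one_le_pow _ _ (by omega)
  have hlen : σ.length ≤ (σ.length + 1) ^ 3 :=
    (Nat.le_succ _).trans (Nat.le_self_pow (by norm_num) _)
  refine Run.le (Run.count hw (2 ^ σ.length) (T := σ.length * 1000 + 1000 +
    (10000 * (σ.length + 1) ^ 3 + (65 + (129 + 1)))) (fun j s' => Tables D σ s' ∧
      Grows D σ k s s' ∧ s'.reg 3 ≤ s.reg 3 + j * (σ.length * σ.length) ∧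
      (∀ u, s.arr 16 u ≠ 0 → s'.arr 16 u ≠ 0) ∧
      (∀ b < j, CompsRegistered D σ s' (D.split p b R)) ∧
      (NodeClosed D σ p s v → SameTables s s') ∧
      (NodeClosed D σ p s v → (∀ p' < p, Complete D σ p' s) →
        ∀ b < j, D.Realizable σ (D.split p b R) → s'.arr 16 v ≠ 0)) rfl rfl rfl
    (fun s' hF => (hB.of_frame hF rfl).power) ?_ ?_ ?_)
    (by rw [Nat.add_le_add_iff_right]; exact Nat.mul_le_mul_left _ (by omega))
  · have hS₁ : SameTables s (s.setReg 11 0) := ⟨rfl, fun _ _ _ => rfl⟩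
    exact ⟨hT.of_same hS₁ rfl, hS₁.grows k, by rw [hS₁.reg]; omega, fun _ h => h,
      fun b hb => absurd hb (Nat.not_lt_zero _), fun _ => hS₁,
      fun _ _ b hb => absurd hb (Nat.not_lt_zero _)⟩
  · intro b hb s₁ ⟨i₁, i₂, i₃, i₄, i₅, i₆, i₇⟩ hr₁ hF₁ _
    have hB₁ := hB.of_frame hF₁ rfl
    have e10 : s₁.reg 10 = v := hF₁.1 10 rfl
    have hrow₁ : ∀ q < σ.length, row σ s₁ v q = R q := (i₂.seen v hv).2
    refine Run.seq (run_splitProg hw hB₁ hp ((hF₁.1 6 rfl).trans h6) ((hF₁.1 7 rfl).trans h7))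
      fun s₂ h₂ hF₂ _ => ?_
    have hB₂ := hB₁.of_frame hF₂ rfl
    have hS₂ : SameTables s₁ s₂ := .of_frame hF₂ rfl
    have h16₂ : s₂.arr 16 = s₁.arr 16 := hF₂.2 16 rfl
    have hT₂ := i₁.of_same hS₂ h16₂
    rw [hr₁, e10] at h₂
    have hm₂ : ∀ q < σ.length, s₂.arr 17 q = D.split p b R q := fun q hq =>
      (h₂ q hq).trans (split_eq_of_eq (hrow₁ q hq) p b)
    have hmul : (b + 1) * (σ.length * σ.length) ≤ 2 ^ σ.length * (σ.length * σ.length) :=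
      Nat.mul_le_mul_right _ hb
    rw [Nat.add_mul, one_mul] at hmul
    refine Run.seq (run_checkProg hw hπ hd hB₂ hT₂ hp.le
      (fun q hq => by rw [hm₂ q hq]; exact hg.split_mem hp b q hq) (k := k)
      (fun q hq => by rw [hm₂ q hq]; exact hg.split_lt hp b hq)
      (le_trans (Nat.mul_le_mul_right _ (by rw [hS₂.reg]; omega)) hV) hS) fun s₃ h₃' hF₃ _ => ?_
    have h₃ := h₃'.congr hm₂
    have h16₃ : s₃.arr 16 = s₁.arr 16 := (hF₃.2 16 rfl).trans h16₂
    have e10₃ : s₃.reg 10 = v := (hF₃.1 10 rfl).trans ((hF₂.1 10 rfl).trans e10)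
    have hg₃ : Grows D σ k s s₃ := (i₂.trans (hS₂.grows k)).trans h₃.grows
    have hsame₃ : NodeClosed D σ p s v → SameTables s s₃ := by
      intro h
      have h4 : SameTables s s₂ := (i₆ h).trans hS₂
      refine h4.trans (h₃.same ((h b hb).grows (h4.grows k)))
    -- At a closed node the check adds nothing, so a component found in the table was there before.
    -- Its labels are below `k`, hence it belongs to some `p' < p` and is marked by completeness of
    -- `p'`.
    have hcomp₃ : NodeClosed D σ p s v → (∀ p' < p, Complete D σ p' s) →
        D.Realizable σ (D.split p b R) → s₃.reg 13 ≠ 0 := by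
      intro hcl hco hre
      refine h₃.complete hre fun r hr u hu hur => ?_
      have h4 := hsame₃ hcl
      rw [h4.arr 12 (by omega) (by omega)] at hu
      rw [h4.row] at hur
      rw [h16₂]
      obtain ⟨p', hp', hgu, _⟩ := hT.entry u hu
      refine i₄ u (hco p' (hgu.lt_of_lt hp' fun q hq => ?_) u hu hgu
        ((hre.comp r).congr fun q hq => (hur q hq).symm))
      rw [hur q hq]
      have h5 := hg.split_lt hp b hq
      by_cases h0 : D.comp σ (D.split p b R) r q = 0
      · omega
      · rw [comp_eq h0]; exact h5
    have post : ∀ s₄, Tables D σ s₄ → SameTables s₃ s₄ → (∀ u, s₃.arr 16 u ≠ 0 → s₄.arr 16 u ≠ 0) →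
        (s₃.reg 13 ≠ 0 → s₄.arr 16 v ≠ 0) → Tables D σ s₄ ∧
      Grows D σ k s s₄ ∧ s₄.reg 3 ≤ s.reg 3 + (b + 1) * (σ.length * σ.length) ∧
      (∀ u, s.arr 16 u ≠ 0 → s₄.arr 16 u ≠ 0) ∧
      (∀ b' < b + 1, CompsRegistered D σ s₄ (D.split p b' R)) ∧
      (NodeClosed D σ p s v → SameTables s s₄) ∧
      (NodeClosed D σ p s v → (∀ p' < p, Complete D σ p' s) →
        ∀ b' < b + 1, D.Realizable σ (D.split p b' R) → s₄.arr 16 v ≠ 0) := by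
      intro s₄ hT₄ hS₄ hmono hmark
      refine ⟨hT₄, hg₃.trans (hS₄.grows k), ?_, fun u hu => hmono u ?_, fun b' hb' => ?_,
        fun h => (hsame₃ h).trans hS₄, fun hcl hco b' hb' hre => ?_⟩
      · have h4 := h₃.count_le
        rw [hS₂.reg] at h4
        rw [hS₄.reg, Nat.add_mul, one_mul]
        omega
      · rw [h16₃]; exact i₄ u hu
      · rcases Nat.lt_succ_iff_lt_or_eq.1 hb' with h | rfl
        · exact (((i₅ b' h).grows (hS₂.grows k)).grows h₃.grows).grows (hS₄.grows k)
        · exact CompsRegistered.grows h₃.registered (hS₄.grows k)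
      · rcases Nat.lt_succ_iff_lt_or_eq.1 hb' with h | rfl
        · refine hmono v ?_
          rw [h16₃]
          exact i₇ hcl hco b' h hre
        · exact hmark (hcomp₃ hcl hco hre)
    refine Run.cond hw rfl (fun hne => Run.store hw rfl rfl (Run.tame hw rfl) ?_)
      fun h0 => Run.skip ?_
    · obtain ⟨h4, h5⟩ := hg₃.seen v hv
      have h6 : D.Realizable σ (row σ s₃ v) :=
        ((h₃.sound hne).of_split hp).congr fun q hq => (h5 q hq).symm
      simp only [RamExpr.eval, e10₃]
      refine post ((s₃.setArr 16 v 1).setReg 11 (b + 1))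
        ((h₃.tables.mark h4 h6).of_same ⟨rfl, fun _ _ _ => rfl⟩ rfl)
        ⟨rfl, fun a _ h => ?_⟩ (fun u hu => ?_) (fun _ => ?_)
      · simp [show a ≠ 16 by omega]
      · by_cases huv : u = v
        · simp [huv]
        · simpa [huv] using hu
      · simp
    · have h0' : s₃.reg 13 = 0 := h0
      exact post (s₃.setReg 11 (b + 1)) (h₃.tables.of_same ⟨rfl, fun _ _ _ => rfl⟩ rfl)
        ⟨rfl, fun _ _ _ => rfl⟩ (fun _ h => h) (fun h => absurd h0' h)
  · intro s₁ ⟨i₁, i₂, i₃, i₄, i₅, i₆, i₇⟩ _ _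
    refine ⟨i₁, i₂, i₃, i₄, fun b hb => ?_, i₆, fun hcl hco hre => ?_⟩
    · exact (i₅ b hb).congr fun q hq => split_eq_of_eq ((i₂.seen v hv).2 q hq).symm p b
    · obtain ⟨b, hb, hre'⟩ := hre.exists_split hp
      exact i₇ hcl hco b hb hre'

/-! ### Handling a merge step -/

variable (D σ) in
/-- All registered assignments that use the rectangle of step `p` have been handled. -/
def Closed (p : ℕ) (s : RamState) : Prop :=
  ∀ v, s.arr 12 v ≠ 0 → D.Good σ p (row σ s v) → NodeClosed D σ p s v

variable (D σ) in
/-- The effect of handling step `p`, if there are at most `S` assignments to be handled. -/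
structure BucketPost (p S : ℕ) (s s' : RamState) : Prop where
  tables : Tables D σ s'
  grows : Grows D σ (D.step p).k s s'
  count_le : s'.reg 3 ≤ s.reg 3 + S * (2 ^ σ.length * (σ.length * σ.length))
  mono : ∀ u, s.arr 16 u ≠ 0 → s'.arr 16 u ≠ 0
  closed : Closed D σ p s'
  same : Closed D σ p s → SameTables s s'
  complete : Closed D σ p s → (∀ p' < p, Complete D σ p' s) → Complete D σ p s'

/-- New registrations use labels below `k` only, so the bucket does not change while it is processed
and its size may be read once at the start. -/
theorem run_bucketProg (hw : RamBound V w) (hπ : π.Reduced) {d : ℕ} (hd : D.IsWide d)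
    (hB : InputTables D σ s) (hT : Tables D σ s) {p : ℕ} (hp : p < D.s) (h6 : s.reg 6 = p) {S : ℕ}
    (hSdef : S = (2 * d * σ.length + 1) ^ σ.length)
    (hV : (s.reg 3 + S * (2 ^ σ.length * (σ.length * σ.length)) + 1) * (D.top + 1) ≤ V)
    (hS : S + 1 ≤ V) :
    Run V w bucketProg s (S * (2 ^ σ.length * (13000 * (σ.length + 1) ^ 3) + 465) + 330)
      (BucketPost D σ p S s) := by
  set k := (D.step p).k with hk
  set n := s.arr 14 k with hn
  have hnS : n ≤ S := hSdef ▸ hT.bucket_le hd hp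
  let E : ℕ → ℕ := fun i => s.arr 15 (i * (D.top + 1) + k)
  have hE : ∀ i < n, s.arr 12 (E i) ≠ 0 ∧ D.Good σ p (row σ s (E i)) := hT.bucket p hp
  refine Run.le (Run.seq (Q := fun s' => s'.reg 7 = k) (Run.assign hw rfl (Run.tame hw rfl)
    (by simp [RamExpr.eval, h6, hB.stepK p hp, hk])) fun s₁ h₁ hF₁ _ =>
    Run.seq (Q := fun s' => s'.reg 8 = n) (Run.assign hw rfl (Run.tame hw rfl)
    (by simp [RamExpr.eval, h₁, hF₁.2 14 rfl, hn])) (T' := n * (65 +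
      (2 ^ σ.length * (13000 * (σ.length + 1) ^ 3) + 200) + 200) + 200)
    fun s₂ h₂ hF₂ _ => ?_) ?_
  swap
  · have h3 : n * (65 + (2 ^ σ.length * (13000 * (σ.length + 1) ^ 3) + 200) + 200) ≤
        S * (2 ^ σ.length * (13000 * (σ.length + 1) ^ 3) + 465) :=
      Nat.mul_le_mul hnS (by omega)
    omega
  have hB₂ := (hB.of_frame hF₁ rfl).of_frame hF₂ rfl
  have hS₂ : SameTables s s₂ := SameTables.trans (.of_frame hF₁ rfl) (.of_frame hF₂ rfl)
  have h16₂ : s₂.arr 16 = s.arr 16 := (hF₂.2 16 rfl).trans (hF₁.2 16 rfl)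
  have hT₂ := hT.of_same hS₂ h16₂
  refine Run.count hw n (fun j s' => Tables D σ s' ∧ Grows D σ k s s' ∧
      s'.reg 3 ≤ s.reg 3 + j * (2 ^ σ.length * (σ.length * σ.length)) ∧
      (∀ u, s.arr 16 u ≠ 0 → s'.arr 16 u ≠ 0) ∧
      (∀ i < j, NodeClosed D σ p s' (E i)) ∧ (Closed D σ p s → SameTables s s') ∧
      (Closed D σ p s → (∀ p' < p, Complete D σ p' s) → ∀ i < j,
        D.Realizable σ (row σ s (E i)) → s'.arr 16 (E i) ≠ 0)) rfl rfl rfl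
    (fun s' hF => (hF.1 8 rfl).trans h₂) ?_ ?_ ?_
  · have hS₃ : SameTables s (s₂.setReg 9 0) := hS₂.trans ⟨rfl, fun _ _ _ => rfl⟩
    exact ⟨hT.of_same hS₃ h16₂, hS₃.grows k, by rw [hS₃.reg]; omega,
      fun u hu => by rw [RamState.setReg_arr, h16₂]; exact hu,
      fun i hi => absurd hi (Nat.not_lt_zero _), fun _ => hS₃,
      fun _ _ i hi => absurd hi (Nat.not_lt_zero _)⟩
  · intro i hi s₃ ⟨i₁, i₂, i₃, i₄, i₅, i₆, i₇⟩ hr₃ hF₃ _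
    have hB₃ := hB₂.of_frame hF₃ rfl
    have e7 : s₃.reg 7 = k := ((hF₃.1 7 rfl).trans (hF₂.1 7 rfl)).trans h₁
    have e6 : s₃.reg 6 = p := ((hF₃.1 6 rfl).trans ((hF₂.1 6 rfl).trans (hF₁.1 6 rfl))).trans h6
    obtain ⟨hi₃, hE₃⟩ := i₂.entries p hp i hi
    refine Run.seq (Q := fun s' => s'.reg 10 = E i) (Run.assign hw rfl (Run.tame hw rfl)
      (by simp [RamExpr.eval, hr₃, e7, hB₃.bound, hE₃, hk, E])) fun s₄ h₄ hF₄ _ => ?_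
    have hB₄ := hB₃.of_frame hF₄ rfl
    have hS₄ : SameTables s₃ s₄ := .of_frame hF₄ rfl
    have h16₄ : s₄.arr 16 = s₃.arr 16 := hF₄.2 16 rfl
    have hT₄ := i₁.of_same hS₄ h16₄
    have hg₄ : Grows D σ k s s₄ := i₂.trans (hS₄.grows k)
    obtain ⟨hv, hgood⟩ := hE i hi
    obtain ⟨hv₄, hrow₄⟩ := hg₄.seen _ hv
    have hmul : (i + 1) * (2 ^ σ.length * (σ.length * σ.length)) ≤
      S * (2 ^ σ.length * (σ.length * σ.length)) := Nat.mul_le_mul_right _ (by omega)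
    rw [Nat.add_mul, one_mul] at hmul
    have hrun := run_nodeProg hw hπ hd hB₄ hT₄ hp ((hF₄.1 6 rfl).trans e6)
      ((hF₄.1 7 rfl).trans e7) (by rw [h₄]; exact hv₄)
      (by rw [h₄]; exact hgood.congr fun q hq => (hrow₄ q hq).symm)
      (le_trans (Nat.mul_le_mul_right _ (by rw [hS₄.reg]; omega)) hV) (hSdef ▸ hS)
    rw [h₄] at hrun
    refine hrun.conseq le_rfl fun s₅ h₅ hF₅ _ => ?_
    have hS₆ : SameTables s₅ (s₅.setReg 9 (i + 1)) := ⟨rfl, fun _ _ _ => rfl⟩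
    have hg₆ : Grows D σ k s₃ (s₅.setReg 9 (i + 1)) :=
      ((hS₄.grows k).trans h₅.grows).trans (hS₆.grows k)
    have hmono : ∀ u, s₃.arr 16 u ≠ 0 → s₅.arr 16 u ≠ 0 := fun u hu =>
      h₅.mono u (by rw [h16₄]; exact hu)
    have hclosed : Closed D σ p s → NodeClosed D σ p s₄ (E i) := fun h =>
      (h _ hv hgood).grows hg₄ hv
    refine ⟨h₅.tables.of_same hS₆ rfl, i₂.trans hg₆, ?_, fun u hu => hmono u (i₄ u hu),
      fun j hj => ?_, fun h => ?_, fun hcl hco j hj hre => ?_⟩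
    · have h6 := h₅.count_le
      rw [hS₄.reg] at h6
      rw [hS₆.reg, Nat.add_mul, one_mul]
      omega
    · rcases Nat.lt_succ_iff_lt_or_eq.1 hj with h | rfl
      · exact (i₅ j h).grows hg₆ (i₂.seen _ (hE j (by omega)).1).1
      · exact h₅.closed.grows (hS₆.grows k) (h₅.grows.seen _ hv₄).1
    · exact (((i₆ h).trans hS₄).trans (h₅.same (hclosed h))).trans hS₆
    · rcases Nat.lt_succ_iff_lt_or_eq.1 hj with h | rfl
      · exact hmono _ (i₇ hcl hco j h hre)
      · refine h₅.complete (hclosed hcl) (fun p' hp' u hu hgu hru => ?_)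
          (hre.congr fun q hq => (hrow₄ q hq).symm)
        have hS := (i₆ hcl).trans hS₄
        rw [hS.arr 12 (by omega) (by omega)] at hu
        rw [hS.row] at hgu hru
        rw [h16₄]
        exact i₄ u (hco p' hp' u hu hgu hru)
  · intro s₃ ⟨i₁, i₂, i₃, i₄, i₅, i₆, i₇⟩ _ _
    have hfind : ∀ u, s.arr 12 u ≠ 0 → D.Good σ p (row σ s u) → ∃ i < n, E i = u := by
      intro u hu hgu
      obtain ⟨p', hp', hg', i, hi, hiu⟩ := hT.entry u hu
      obtain rfl := hgu.unique hp hp' hg'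
      exact ⟨i, hi, hiu⟩
    refine ⟨i₁, i₂, i₃.trans (Nat.add_le_add_left (Nat.mul_le_mul_right _ hnS) _), i₄,
      fun u hu hgu => ?_, i₆, fun hcl hco u hu hgu hre => ?_⟩
    -- An assignment using `k` was registered before the loop, since the new ones avoid `k`; thus it
    -- is one of the entries handled.
    · rcases i₂.new u hu with h | h
      · obtain ⟨i, hi, rfl⟩ := hfind u h (hgu.congr fun q hq => (i₂.seen u h).2 q hq)
        exact i₅ i hi
      · obtain ⟨q, hq, hqk⟩ := hgu.uses
        have := h q hq
        omega
    · have hS := i₆ hcl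
      rw [hS.arr 12 (by omega) (by omega)] at hu
      rw [hS.row] at hgu hre
      obtain ⟨i, hi, rfl⟩ := hfind u hu hgu
      exact i₇ hcl hco i hi hre

end PatternProg

namespace PatternProg

open RamProg Decomposition

variable {V w : ℕ} {π : PointPerm} {D : Decomposition π} {σ : PointPerm} {s s' s'' : RamState}

/-! ### Computing the rectangles -/

theorem run_pointsProg (hw : RamBound V w) (h1 : s.reg 1 = π.length)
    (hP : ∀ (α : Fin 2), ∀ y < π.length, s.arr (2 + α) (y + 1) = π.P (y + 1) α) :
    Run V w pointsProg s (π.length * (129 + (129 + (129 + 129)) + 200) + 200) fun s' =>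
      ∀ (α : Fin 2), ∀ y < π.length, s'.arr (7 + α) (y + 1) = π.P (y + 1) α ∧
        s'.arr (9 + α) (y + 1) = π.P (y + 1) α := by
  refine Run.count hw π.length (fun j s' => ∀ (α : Fin 2), ∀ y < j,
    s'.arr (7 + α) (y + 1) = π.P (y + 1) α ∧ s'.arr (9 + α) (y + 1) = π.P (y + 1) α) rfl rfl rfl
    (fun s' hF => (hF.1 1 rfl).trans h1) (fun _ y hy => absurd hy (Nat.not_lt_zero _)) ?_
    (fun _ h _ _ => h)
  intro j hj s₁ h₁ hr₁ hF₁ _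
  have h2 : s₁.arr 2 (j + 1) = π.P (j + 1) 0 := by
    rw [hF₁.2 2 rfl]; exact hP 0 j hj
  have h3 : s₁.arr 3 (j + 1) = π.P (j + 1) 1 := by
    rw [hF₁.2 3 rfl]; exact hP 1 j hj
  refine Run.seq (T := 129) (T' := 129 + (129 + 129)) 
    (Q := fun s' => s'.arr 7 = Function.update (s₁.arr 7) (j + 1) (π.P (j + 1) 0))
    (Run.store hw rfl rfl (Run.tame hw rfl) (by simp [RamExpr.eval, hr₁, h2])) fun s₂ h₂ hF₂ _ => ?_
  refine Run.seq (T := 129) (T' := 129 + 129) 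
    (Q := fun s' => s'.arr 8 = Function.update (s₁.arr 8) (j + 1) (π.P (j + 1) 1))
    (Run.store hw rfl rfl (Run.tame hw rfl)
      (by simp [RamExpr.eval, hr₁, h3, hF₂.1 14 rfl, hF₂.2 3 rfl, hF₂.2 8 rfl])) fun s₃ h₃ hF₃ _ => ?_
  refine Run.seq (T := 129) (T' := 129) 
    (Q := fun s' => s'.arr 9 = Function.update (s₁.arr 9) (j + 1) (π.P (j + 1) 0))
    (Run.store hw rfl rfl (Run.tame hw rfl)
      (by simp [RamExpr.eval, hr₁, h2, hF₂.1 14 rfl, hF₂.2 2 rfl, hF₂.2 9 rfl, hF₃.1 14 rfl,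
        hF₃.2 2 rfl, hF₃.2 9 rfl])) fun s₄ h₄ hF₄ _ => ?_
  refine Run.store hw rfl rfl (Run.tame hw rfl) ?_
  have e14 : s₄.reg 14 = j := ((hF₄.1 14 rfl).trans ((hF₃.1 14 rfl).trans (hF₂.1 14 rfl))).trans hr₁
  have e3 : s₄.arr 3 (j + 1) = π.P (j + 1) 1 := by
    rw [hF₄.2 3 rfl, hF₃.2 3 rfl, hF₂.2 3 rfl, h3]
  have e7 := ((hF₄.2 7 rfl).trans (hF₃.2 7 rfl)).trans h₂
  have e8 := (hF₄.2 8 rfl).trans h₃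
  have e10 := (hF₄.2 10 rfl).trans ((hF₃.2 10 rfl).trans (hF₂.2 10 rfl))
  intro α y hy
  have hα := h₁ α y
  fin_cases α <;>
    · simp only [RamExpr.eval, RamState.setReg_arr, RamState.setArr_arr, e14, e3]
      simp [e7, e8, h₄, e10, Function.update_apply]
      by_cases hyj : y = j
      · simp [hyj]
      · simpa [hyj] using hα (by omega)

theorem minExpr_eval (a : ℕ) (s : RamState) : (minExpr a).eval s =
    min (s.arr a (s.arr 4 (s.reg 14))) (s.arr a (s.arr 5 (s.reg 14))) := by
  simp only [minExpr, RamExpr.eval]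
  omega

theorem maxExpr_eval (a : ℕ) (s : RamState) : (maxExpr a).eval s =
    max (s.arr a (s.arr 4 (s.reg 14))) (s.arr a (s.arr 5 (s.reg 14))) := by
  simp only [maxExpr, RamExpr.eval]
  omega

theorem maxExpr_eval_le (a : ℕ) (hs : s.Bounded V) : (maxExpr a).eval s ≤ V := by
  rw [maxExpr_eval]
  exact max_le (hs.2 _ _) (hs.2 _ _)

/-- Labels are never reused, so each step writes to fresh cells and one table serves the rectangles
of all stages at once. -/
theorem run_boxesProg (hw : RamBound V w) (h1 : s.reg 1 = π.length)
    (hI : ∀ p < D.s, s.arr 4 p = (D.step p).i) (hJ : ∀ p < D.s, s.arr 5 p = (D.step p).j)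
    (hK : ∀ p < D.s, s.arr 6 p = (D.step p).k)
    (hP : ∀ (α : Fin 2), ∀ y ∈ π.S, s.arr (7 + α) y = π.P y α ∧ s.arr (9 + α) y = π.P y α) :
    Run V w boxesProg s (D.s * (129 + (129 + (129 + 129)) + 200) + 200) fun s' =>
      ∀ (α : Fin 2), ∀ p ≤ D.s, ∀ y ∈ (D.fam p).S, s'.arr (7 + α) y = D.lo α y ∧
        s'.arr (9 + α) y = D.hi α y := by
  have hs := D.s_add_one
  refine Run.count hw D.s (fun j s' => ∀ (α : Fin 2), ∀ p ≤ j, ∀ y ∈ (D.fam p).S,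
    s'.arr (7 + α) y = D.lo α y ∧ s'.arr (9 + α) y = D.hi α y) rfl rfl rfl
    (fun s' hF => by simp only [RamExpr.eval, hF.1 1 rfl, h1]; omega) ?_ ?_
    (fun _ h _ _ => h)
  · intro α p hp y hy
    obtain rfl : p = 0 := by omega
    rw [D.start] at hy
    rw [D.lo_point hy, D.hi_point hy]
    exact hP α y hy
  intro j hj s₁ h₁ hr₁ hF₁ _
  have h4 : s₁.arr 4 j = (D.step j).i := by rw [hF₁.2 4 rfl]; exact hI j hj
  have h5 : s₁.arr 5 j = (D.step j).j := by rw [hF₁.2 5 rfl]; exact hJ j hj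
  have h6 : s₁.arr 6 j = (D.step j).k := by rw [hF₁.2 6 rfl]; exact hK j hj
  have hlo : ∀ α : Fin 2, min (s₁.arr (7 + α) (D.step j).i) (s₁.arr (7 + α) (D.step j).j) =
      D.lo α (D.step j).k := fun α => by
    rw [D.lo_step hj, (h₁ α j le_rfl _ (D.mem_i j hj)).1, (h₁ α j le_rfl _ (D.mem_j j hj)).1]
  have hhi : ∀ α : Fin 2, max (s₁.arr (9 + α) (D.step j).i) (s₁.arr (9 + α) (D.step j).j) =
      D.hi α (D.step j).k := fun α => by
    rw [D.hi_step hj, (h₁ α j le_rfl _ (D.mem_i j hj)).2, (h₁ α j le_rfl _ (D.mem_j j hj)).2]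
  have hlo0 := hlo 0
  have hlo1 := hlo 1
  have hhi0 := hhi 0
  have hhi1 := hhi 1
  simp only [Fin.coe_ofNat_eq_mod, Nat.zero_mod, Nat.add_zero, Nat.one_mod, Nat.reduceAdd]
    at hlo0 hlo1 hhi0 hhi1
  refine Run.seq (T := 129) (T' := 129 + (129 + 129)) 
    (Q := fun s' => s'.arr 7 =
      Function.update (s₁.arr 7) (D.step j).k (D.lo 0 (D.step j).k))
    (Run.store hw rfl rfl (Run.tame hw rfl)
      (by rw [minExpr_eval]; simp [RamExpr.eval, hr₁, h4, h5, h6, hlo0])) fun s₂ h₂ hF₂ _ => ?_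
  refine Run.seq (T := 129) (T' := 129 + 129) 
    (Q := fun s' => s'.arr 8 =
      Function.update (s₁.arr 8) (D.step j).k (D.lo 1 (D.step j).k))
    (Run.store hw rfl rfl (Run.tame hw rfl)
      (by rw [minExpr_eval]; simp [RamExpr.eval, hr₁, h4, h5, h6, hlo1, hF₂.1 14 rfl, hF₂.2 4 rfl,
        hF₂.2 5 rfl, hF₂.2 6 rfl, hF₂.2 8 rfl])) fun s₃ h₃ hF₃ _ => ?_
  have e14 : s₃.reg 14 = j := ((hF₃.1 14 rfl).trans (hF₂.1 14 rfl)).trans hr₁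
  have e4 : s₃.arr 4 = s₁.arr 4 := (hF₃.2 4 rfl).trans (hF₂.2 4 rfl)
  have e5 : s₃.arr 5 = s₁.arr 5 := (hF₃.2 5 rfl).trans (hF₂.2 5 rfl)
  have e6 : s₃.arr 6 = s₁.arr 6 := (hF₃.2 6 rfl).trans (hF₂.2 6 rfl)
  have e9 : s₃.arr 9 = s₁.arr 9 := (hF₃.2 9 rfl).trans (hF₂.2 9 rfl)
  have e10 : s₃.arr 10 = s₁.arr 10 := (hF₃.2 10 rfl).trans (hF₂.2 10 rfl)
  refine Run.seq (T := 129) (T' := 129) 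
    (Q := fun s' => s'.arr 9 =
      Function.update (s₁.arr 9) (D.step j).k (D.hi 0 (D.step j).k))
    (Run.store hw rfl rfl (maxExpr_eval_le 9)
      (by rw [maxExpr_eval]; simp [RamExpr.eval, e14, e4, e5, e6, e9, h4, h5, h6, hhi0]))
    fun s₄ h₄ hF₄ _ => ?_
  refine Run.store hw rfl rfl (maxExpr_eval_le 10) ?_
  have f7 := ((hF₄.2 7 rfl).trans (hF₃.2 7 rfl)).trans h₂
  have f8 := (hF₄.2 8 rfl).trans h₃
  have f14 : s₄.reg 14 = j := (hF₄.1 14 rfl).trans e14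
  have f4 : s₄.arr 4 = s₁.arr 4 := (hF₄.2 4 rfl).trans e4
  have f5 : s₄.arr 5 = s₁.arr 5 := (hF₄.2 5 rfl).trans e5
  have f6 : s₄.arr 6 = s₁.arr 6 := (hF₄.2 6 rfl).trans e6
  have f10 : s₄.arr 10 = s₁.arr 10 := (hF₄.2 10 rfl).trans e10
  rw [maxExpr_eval]
  simp only [RamExpr.eval, f14, f4, f5, f6, f10, h4, h5, h6, hhi1]
  intro α p hp y hy
  by_cases hyk : y = (D.step j).k
  · subst hyk
    fin_cases α <;> simp [f7, f8, h₄]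
  · have hy' : ∃ p' ≤ j, y ∈ (D.fam p').S := by
      rcases Nat.lt_or_ge p (j + 1) with h | h
      · exact ⟨p, by omega, hy⟩
      · obtain rfl : p = j + 1 := by omega
        exact ⟨j, le_rfl, D.mem_fam_of_mem_succ hj hy hyk⟩
    obtain ⟨p', hp', hyp⟩ := hy'
    have hold := h₁ α p' hp' y hyp
    fin_cases α <;> simpa [f7, f8, h₄, f10, hyk] using hold

theorem run_initProg (hw : RamBound V w) (hσ : σ.Reduced) (hπ : π.Reduced) (hK : D.top + 1 ≤ V)
    (hpow : 2 ^ σ.length ≤ V) :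
    Run V w initProg (patternInput σ π D) (π.length * 2000 + σ.length * 1000 + 1000)
      (InputTables D σ) := by
  have hs := D.s_add_one
  have hmem : ∀ y < π.length, y + 1 ∈ π.S := fun y hy => by
    rw [hπ.1, Finset.mem_Icc]; omega
  have hmemσ : ∀ y < σ.length, y + 1 ∈ σ.S := fun y hy => by
    rw [hσ.1, Finset.mem_Icc]; omega
  set s₀ := patternInput σ π D with hs₀
  have i0 : s₀.reg 0 = σ.length := rfl
  have i1 : s₀.reg 1 = π.length := rfl
  refine Run.le (Run.seq (run_pointsProg hw i1 ?_) (T' := D.s * (129 + (129 + (129 + 129)) + 200) +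
    200 + (65 + (65 + (σ.length * (65 + 200) + 200)))) fun s₁ h₁ hF₁ _ => ?_) (by omega)
  · intro α y hy
    fin_cases α <;> simp [hs₀, patternInput, hmem y hy]
  have a4 : s₁.arr 4 = s₀.arr 4 := hF₁.2 4 rfl
  have a5 : s₁.arr 5 = s₀.arr 5 := hF₁.2 5 rfl
  have a6 : s₁.arr 6 = s₀.arr 6 := hF₁.2 6 rfl
  have j4 : ∀ p < D.s, s₀.arr 4 p = (D.step p).i := fun p hp => by simp [hs₀, patternInput, hp]
  have j5 : ∀ p < D.s, s₀.arr 5 p = (D.step p).j := fun p hp => by simp [hs₀, patternInput, hp]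
  have j6 : ∀ p < D.s, s₀.arr 6 p = (D.step p).k := fun p hp => by simp [hs₀, patternInput, hp]
  refine Run.seq (run_boxesProg (D := D) hw ((hF₁.1 1 rfl).trans i1) (by rw [a4]; exact j4)
    (by rw [a5]; exact j5) (by rw [a6]; exact j6) ?_) fun s₂ h₂ hF₂ _ => ?_
  · intro α y hy
    rw [hπ.1, Finset.mem_Icc] at hy
    have := h₁ α (y - 1) (by omega)
    rwa [Nat.sub_add_cancel (by omega)] at this
  have b1 : s₂.reg 1 = π.length := ((hF₂.1 1 rfl).trans (hF₁.1 1 rfl)).trans i1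
  have b6 : s₂.arr 6 = s₀.arr 6 := (hF₂.2 6 rfl).trans a6
  -- The expression is `max n k + 1` for the last label `k`. For `n = 1` the truncated address is
  -- `0`, where the empty merge sequence reads `0`, leaving `n + 1`.
  have htop : (RamExpr.add (.add (.reg 1) (.sub (.get 6 (.sub (.reg 1) (.lit 2))) (.reg 1)))
      (.lit 1)).eval s₂ = D.top + 1 := by
    simp only [RamExpr.eval, b1, b6]
    by_cases h : D.s = 0
    · have : s₀.arr 6 (π.length - 2) = 0 := by simp [hs₀, patternInput, h]
      simp [this, top, h]
    · have h3 : π.length - 2 = D.s - 1 := by omega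
      have h4 := D.length_lt_k hπ (p := D.s - 1) (by omega)
      rw [h3, j6 _ (by omega)]
      simp only [top, h, if_false]
      omega
  refine Run.seq (Q := fun s' => s'.reg 2 = D.top + 1) (Run.assign hw rfl (fun _ => htop ▸ hK)
    (by rw [htop]; simp)) fun s₃ h₃ hF₃ _ => ?_
  refine Run.seq (Q := fun s' => s'.reg 4 = 1) (Run.assign hw rfl (Run.tame hw rfl)
    (by simp [RamExpr.eval])) fun s₄ h₄ hF₄ _ => ?_
  have d0 : s₄.reg 0 = σ.length := (hF₄.1 0 rfl).trans ((hF₃.1 0 rfl).trans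
    ((hF₂.1 0 rfl).trans (hF₁.1 0 rfl)))
  refine Run.count hw σ.length (fun j s' => s'.reg 4 = 2 ^ j) rfl rfl rfl
    (fun s' hF => (hF.1 0 rfl).trans d0) (by simp [h₄]) ?_ ?_
  · intro j hj s₅ h₅ _ _ _
    refine Run.assign hw rfl (fun _ => ?_) (by simp [RamExpr.eval, h₅, pow_succ])
    simp only [RamExpr.eval, h₅, ← pow_succ]
    exact (Nat.pow_le_pow_right (by norm_num) hj).trans hpow
  · intro s₅ h₅ _ hF₅
    have harr : ∀ a < 11, s₅.arr a = s₂.arr a := by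
      intro a ha
      interval_cases a <;> exact (hF₅.2 _ rfl).trans ((hF₄.2 _ rfl).trans (hF₃.2 _ rfl))
    have harr' : ∀ a < 7, s₅.arr a = s₀.arr a := by
      intro a ha
      rw [harr a (by omega)]
      interval_cases a <;> exact (hF₂.2 _ rfl).trans (hF₁.2 _ rfl)
    refine ⟨(hF₅.1 0 rfl).trans d0, ((hF₅.1 1 rfl).trans ((hF₄.1 1 rfl).trans (hF₃.1 1 rfl))).trans
      b1, ((hF₅.1 2 rfl).trans (hF₄.1 2 rfl)).trans h₃, h₅, fun α q hq => ?_, fun α p hp y hy => ?_,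
      fun α p hp y hy => ?_, by rw [harr' 4 (by omega)]; exact j4,
      by rw [harr' 5 (by omega)]; exact j5, by rw [harr' 6 (by omega)]; exact j6⟩
    · rw [harr' α (by omega)]
      fin_cases α <;> simp [hs₀, patternInput, hmemσ q hq]
    · rw [harr _ (by omega)]
      exact (h₂ α p hp y hy).1
    · rw [harr _ (by omega)]
      exact (h₂ α p hp y hy).2

/-! ### The two passes -/

theorem Grows.mono {k k' : ℕ} (h : Grows D σ k s s') (hk : k ≤ k') : Grows D σ k' s s' :=
  ⟨h.seen, fun v hv => (h.new v hv).imp_right fun h q hq => (h q hq).trans_le hk, h.entries⟩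

/-- Handling step `p` registers only labels below those of the steps from `p` on, so the buckets
finished earlier in the downward pass stay finished. -/
theorem Closed.grows {p p' : ℕ} (h : Closed D σ p' s) (hg : Grows D σ (D.step p).k s s')
    (hpp : p ≤ p') (hp' : p' < D.s) : Closed D σ p' s' := by
  intro v hv hgood
  rcases hg.new v hv with h1 | h1
  · exact (h v h1 (hgood.congr fun q hq => (hg.seen v h1).2 q hq)).grows hg h1
  · obtain ⟨q, hq, hk⟩ := hgood.uses
    have := h1 q hq
    have := D.step_k_le hpp hp'
    omega

theorem Closed.of_same {p : ℕ} (h : Closed D σ p s) (hS : SameTables s s') :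
    Closed D σ p s' := by
  intro v hv hgood
  rw [hS.arr 12 (by omega) (by omega)] at hv
  rw [hS.row] at hgood
  exact (h v hv hgood).grows (hS.grows 0) hv

theorem Complete.of_same {p : ℕ} (h : Complete D σ p s) (hS : SameTables s s')
    (hm : ∀ u, s.arr 16 u ≠ 0 → s'.arr 16 u ≠ 0) : Complete D σ p s' := by
  intro v hv hgood hre
  rw [hS.arr 12 (by omega) (by omega)] at hv
  rw [hS.row] at hgood hre
  exact hm v (h v hv hgood hre)

/-- A bound for the time to handle a merge step. -/
def bucketTime (σ : PointPerm) (S : ℕ) : ℕ :=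
  S * (2 ^ σ.length * (13000 * (σ.length + 1) ^ 3) + 465) + 330

theorem run_downProg (hw : RamBound V w) (hπ : π.Reduced) {d : ℕ} (hd : D.IsWide d)
    (hB : InputTables D σ s) (hT : Tables D σ s) {S : ℕ}
    (hSdef : S = (2 * d * σ.length + 1) ^ σ.length)
    (hV : (s.reg 3 + D.s * (S * (2 ^ σ.length * (σ.length * σ.length))) + 1) * (D.top + 1) ≤ V)
    (hS : S + 1 ≤ V) :
    Run V w downProg s (D.s * (65 + bucketTime σ S + 200) + 200) fun s' =>
      Tables D σ s' ∧ Grows D σ (D.top + 1) s s' ∧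
      s'.reg 3 ≤ s.reg 3 + D.s * (S * (2 ^ σ.length * (σ.length * σ.length))) ∧
      ∀ p < D.s, Closed D σ p s' := by
  have hs := D.s_add_one
  refine Run.count hw D.s (fun j s' => Tables D σ s' ∧ Grows D σ (D.top + 1) s s' ∧
      s'.reg 3 ≤ s.reg 3 + j * (S * (2 ^ σ.length * (σ.length * σ.length))) ∧
      ∀ p < D.s, D.s ≤ p + j → Closed D σ p s') rfl rfl rfl
    (fun s' hF => by simp only [RamExpr.eval, hF.1 1 rfl, hB.size]; omega) ?_ ?_ ?_
  · have hS₁ : SameTables s (s.setReg 5 0) := ⟨rfl, fun _ _ _ => rfl⟩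
    exact ⟨hT.of_same hS₁ rfl, hS₁.grows _, by rw [hS₁.reg]; omega, fun p hp h => by omega⟩
  · intro j hj s₁ ⟨i₁, i₂, i₃, i₄⟩ hr₁ hF₁ _
    have hB₁ := hB.of_frame hF₁ rfl
    set p := D.s - 1 - j with hp
    have hps : p < D.s := by omega
    refine Run.seq (Q := fun s' => s'.reg 6 = p) (Run.assign hw rfl (Run.tame hw rfl)
      (by simp [RamExpr.eval, hr₁, hB₁.size]; omega)) fun s₂ h₂ hF₂ _ => ?_
    have hB₂ := hB₁.of_frame hF₂ rfl
    have hS₂ : SameTables s₁ s₂ := .of_frame hF₂ rfl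
    have hT₂ := i₁.of_same hS₂ (hF₂.2 16 rfl)
    have hmul : (j + 1) * (S * (2 ^ σ.length * (σ.length * σ.length))) ≤
      D.s * (S * (2 ^ σ.length * (σ.length * σ.length))) := Nat.mul_le_mul_right _ hj
    rw [Nat.add_mul, one_mul] at hmul
    refine (run_bucketProg hw hπ hd hB₂ hT₂ hps h₂ hSdef
      (le_trans (Nat.mul_le_mul_right _ (by rw [hS₂.reg]; omega)) hV) hS).conseq le_rfl
      fun s₃ h₃ hF₃ _ => ?_
    have hS₄ : SameTables s₃ (s₃.setReg 5 (j + 1)) := ⟨rfl, fun _ _ _ => rfl⟩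
    have hg₄ : Grows D σ (D.step p).k s₁ (s₃.setReg 5 (j + 1)) :=
      ((hS₂.grows _).trans h₃.grows).trans (hS₄.grows _)
    refine ⟨h₃.tables.of_same hS₄ rfl, i₂.trans (hg₄.mono
      ((D.le_top hπ hps (D.step_k_mem hps)).trans (Nat.le_succ _))), ?_, fun p' hp' h => ?_⟩
    · have h4 := h₃.count_le
      rw [hS₂.reg] at h4
      rw [hS₄.reg, Nat.add_mul, one_mul]
      omega
    · by_cases hpp : p' = p
      · rw [hpp]
        exact h₃.closed.of_same hS₄
      · exact (i₄ p' hp' (by omega)).grows hg₄ (by omega) hp'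
  · intro s₁ ⟨i₁, i₂, i₃, i₄⟩ _ _
    exact ⟨i₁, i₂, i₃, fun p hp => i₄ p hp (by omega)⟩

/-- All buckets are closed, so the tables stay fixed, and completeness spreads from the smaller
steps to `p`. The room required by `hV` for new nodes is demanded by `run_bucketProg` but not used
up. -/
theorem run_upProg (hw : RamBound V w) (hπ : π.Reduced) {d : ℕ} (hd : D.IsWide d)
    (hB : InputTables D σ s) (hT : Tables D σ s) (hC : ∀ p < D.s, Closed D σ p s) {S : ℕ}
    (hSdef : S = (2 * d * σ.length + 1) ^ σ.length)
    (hV : (s.reg 3 + S * (2 ^ σ.length * (σ.length * σ.length)) + 1) * (D.top + 1) ≤ V)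
    (hS : S + 1 ≤ V) :
    Run V w upProg s (D.s * (65 + bucketTime σ S + 200) + 200) fun s' =>
      Tables D σ s' ∧ SameTables s s' ∧ ∀ p < D.s, Complete D σ p s' := by
  have hs := D.s_add_one
  refine Run.count hw D.s (fun j s' => Tables D σ s' ∧ SameTables s s' ∧
      ∀ p < j, Complete D σ p s') rfl rfl rfl
    (fun s' hF => by simp only [RamExpr.eval, hF.1 1 rfl, hB.size]; omega) ?_ ?_
    (fun _ h _ _ => h)
  · have hS₁ : SameTables s (s.setReg 5 0) := ⟨rfl, fun _ _ _ => rfl⟩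
    exact ⟨hT.of_same hS₁ rfl, hS₁, fun p hp => absurd hp (Nat.not_lt_zero _)⟩
  · intro p hp s₁ ⟨i₁, i₂, i₃⟩ hr₁ hF₁ _
    have hB₁ := hB.of_frame hF₁ rfl
    refine Run.seq (Q := fun s' => s'.reg 6 = p) (Run.assign hw rfl (Run.tame hw rfl)
      (by simp [RamExpr.eval, hr₁])) fun s₂ h₂ hF₂ _ => ?_
    have hB₂ := hB₁.of_frame hF₂ rfl
    have hS₂ : SameTables s₁ s₂ := .of_frame hF₂ rfl
    have h16₂ : s₂.arr 16 = s₁.arr 16 := hF₂.2 16 rfl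
    have hT₂ := i₁.of_same hS₂ h16₂
    refine (run_bucketProg hw hπ hd hB₂ hT₂ hp h₂ hSdef
      (by rw [hS₂.reg, i₂.reg]; exact hV) hS).conseq le_rfl fun s₃ h₃ hF₃ _ => ?_
    have hS₄ : SameTables s₃ (s₃.setReg 5 (p + 1)) := ⟨rfl, fun _ _ _ => rfl⟩
    have hclosed : Closed D σ p s₂ := (hC p hp).of_same (i₂.trans hS₂)
    have hco : ∀ p' < p, Complete D σ p' s₂ := fun p' hp' =>
      (i₃ p' hp').of_same hS₂ (fun u hu => by rw [h16₂]; exact hu)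
    have hS₃ := h₃.same hclosed
    refine ⟨h₃.tables.of_same hS₄ rfl, ((i₂.trans hS₂).trans hS₃).trans hS₄, fun p' hp' => ?_⟩
    rcases Nat.lt_succ_iff_lt_or_eq.1 hp' with h | rfl
    · exact (hco p' h).of_same (hS₃.trans hS₄) h₃.mono
    · exact (h₃.complete hclosed hco).of_same hS₄ fun _ h => h

theorem run_topProg (hw : RamBound V w) (hB : InputTables D σ s) :
    Run V w topProg s (σ.length * (129 + 200) + 200) fun s' =>
      ∀ q < σ.length, s'.arr 17 q = D.top := by
  refine Run.count hw σ.length (fun j s' => ∀ q < j, s'.arr 17 q = D.top) rfl rfl rfl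
    (fun s' hF => (hB.of_frame hF rfl).len) (fun q hq => absurd hq (Nat.not_lt_zero _)) ?_
    (fun _ h _ _ => h)
  intro j hj s₁ h₁ hr₁ hF₁ _
  refine Run.store hw rfl rfl (Run.tame hw rfl) fun q hq => ?_
  simp only [RamExpr.eval, RamState.setReg_arr, RamState.setArr_arr, if_true, hr₁,
    (hB.of_frame hF₁ rfl).bound, Function.update_apply]
  split
  · rfl
  · exact h₁ q (by omega)

/-- Zero encodes a missing edge, mark or entry, so the large arrays need no initialization time. -/
theorem tables_of_zero (h3 : s.reg 3 = 0) (ha : ∀ a, 11 ≤ a → a ≤ 16 → s.arr a = fun _ => 0) :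
    Tables D σ s := by
  have h12 := ha 12 (by omega) (by omega)
  have h14 := ha 14 (by omega) (by omega)
  refine ⟨?_, fun v hv => absurd (congrFun h12 v) hv, fun v hv => absurd (congrFun h12 v) hv,
    fun p hp i hi => ?_, fun p hp i hi => ?_, fun v hv => ?_⟩
  · rw [h3, ha 11 (by omega) (by omega)]
    exact ⟨fun _ => le_rfl, fun _ _ _ h => absurd rfl h⟩
  · simp [h14] at hi
  · simp [h14] at hi
  · simp [ha 16 (by omega) (by omega)] at hv

/-- The constant assignment is checked twice: first to register its components as seeds of the
downward pass, finally to read off the answer. The two checks account for `2 * (ℓ * ℓ)` nodes in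
`hV`. -/
theorem run_mainProg (hw : RamBound V w) (hσ : σ.Reduced) (hπ : π.Reduced) {d : ℕ}
    (hd : D.IsWide d) {S : ℕ} (hSdef : S = (2 * d * σ.length + 1) ^ σ.length)
    (hpow : 2 ^ σ.length ≤ V) (hS : S + 1 ≤ V)
    (hV : (2 * (σ.length * σ.length) + π.length * (S * (2 ^ σ.length * (σ.length * σ.length))) + 1)
      * (D.top + 1) ≤ V) :
    Run V w mainProg (patternInput σ π D)
      (100000 * (S * 2 ^ σ.length * (σ.length + 1) ^ 3 * π.length)) fun s' =>
      (σ.IsSubpattern π → s'.reg 0 = 1) ∧ (¬ σ.IsSubpattern π → s'.reg 0 = 0) := by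
  have hs := D.s_add_one
  have hK : D.top + 1 ≤ V := by
    refine le_trans ?_ hV
    exact Nat.le_mul_of_pos_left _ (by omega)
  -- There are `n - 1` merges; the remaining share of nodes is the slack that the upward pass asks
  -- for.
  have hnM : π.length * (S * (2 ^ σ.length * (σ.length * σ.length))) =
      D.s * (S * (2 ^ σ.length * (σ.length * σ.length))) +
        S * (2 ^ σ.length * (σ.length * σ.length)) := by
    rw [← hs, Nat.add_mul, one_mul]
  refine Run.le (Run.seq (run_initProg hw hσ hπ hK hpow) (T' := σ.length * (129 + 200) + 200 +
    (10000 * (σ.length + 1) ^ 3 + (D.s * (65 + bucketTime σ S + 200) + 200 +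
    (D.s * (65 + bucketTime σ S + 200) + 200 + (σ.length * (129 + 200) + 200 +
    (10000 * (σ.length + 1) ^ 3 + 65)))))) fun s₁ hB₁ hF₁ _ => ?_) ?_
  swap
  · have hX1 : 1 ≤ (σ.length + 1) ^ 3 := Nat.one_le_pow _ _ (by omega)
    have hlX : σ.length ≤ (σ.length + 1) ^ 3 :=
      (Nat.le_succ _).trans (Nat.le_self_pow (by norm_num) _)
    have hP1 : 1 ≤ 2 ^ σ.length := Nat.one_le_two_pow
    have hS1 : 1 ≤ S := hSdef ▸ Nat.one_le_pow _ _ (by omega)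
    set X := (σ.length + 1) ^ 3
    set P := 2 ^ σ.length
    have h1 : S ≤ S * P * X := by
      rw [mul_assoc]; exact Nat.le_mul_of_pos_right _ (by positivity)
    have h2 : X ≤ S * P * X := Nat.le_mul_of_pos_left _ (by positivity)
    have h3 : bucketTime σ S ≤ 13795 * (S * P * X) := by
      have h : bucketTime σ S = 13000 * (S * P * X) + 465 * S + 330 := by
        simp only [bucketTime, P, X]; ring
      omega
    set B := S * P * X
    have h4 : D.s * (65 + bucketTime σ S + 200) ≤ D.s * (14060 * B) :=
      Nat.mul_le_mul_left _ (by omega)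
    have h5 : D.s * (14060 * B) = 14060 * (D.s * B) := by ring
    have h6 : B * π.length = D.s * B + B := by rw [← hs]; ring
    have h7 : π.length ≤ B * π.length := Nat.le_mul_of_pos_left _ (by omega)
    omega
  have z3 : s₁.reg 3 = 0 := hF₁.1 3 rfl
  have hT₁ : Tables D σ s₁ := by
    refine tables_of_zero z3 fun a h1 h2 => ?_
    interval_cases a <;> exact hF₁.2 _ rfl
  refine Run.seq (run_topProg hw hB₁) fun s₂ h₂ hF₂ _ => ?_
  have hB₂ := hB₁.of_frame hF₂ rfl
  have hS₂ : SameTables s₁ s₂ := .of_frame hF₂ rfl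
  have hT₂ := hT₁.of_same hS₂ (hF₂.2 16 rfl)
  have htop : D.top ∈ (D.fam D.s).S := by
    rw [D.fam_last hπ]; exact Finset.mem_singleton_self _
  refine Run.seq (run_checkProg hw hπ hd hB₂ hT₂ le_rfl (fun q hq _ => by rw [h₂ q hq]; exact htop)
    (k := D.top + 1) (fun q hq => by rw [h₂ q hq]; omega)
    (le_trans (Nat.mul_le_mul_right _ (by rw [hS₂.reg]; omega)) hV) (hSdef ▸ hS))
    fun s₃ h₃' hF₃ _ => ?_
  have h₃ := h₃'.congr (m' := fun _ => D.top) h₂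
  have hB₃ := hB₂.of_frame hF₃ rfl
  have c₃ := h₃.count_le
  rw [hS₂.reg, z3] at c₃
  refine Run.seq (run_downProg hw hπ hd hB₃ h₃.tables hSdef
    (le_trans (Nat.mul_le_mul_right _ (by omega)) hV) hS)
    fun s₄ ⟨t₄, g₄, c₄, cl₄⟩ hF₄ _ => ?_
  have hB₄ := hB₃.of_frame hF₄ rfl
  refine Run.seq (run_upProg hw hπ hd hB₄ t₄ cl₄ hSdef
    (le_trans (Nat.mul_le_mul_right _ (by omega)) hV) hS) fun s₅ ⟨t₅, sm₅, co₅⟩ hF₅ _ => ?_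
  have hB₅ := hB₄.of_frame hF₅ rfl
  refine Run.seq (run_topProg hw hB₅) fun s₆ h₆ hF₆ _ => ?_
  have hB₆ := hB₅.of_frame hF₆ rfl
  have hS₆ : SameTables s₅ s₆ := .of_frame hF₆ rfl
  have h16₆ : s₆.arr 16 = s₅.arr 16 := hF₆.2 16 rfl
  have hT₆ := t₅.of_same hS₆ h16₆
  refine Run.seq (run_checkProg hw hπ hd hB₆ hT₆ le_rfl (fun q hq _ => by rw [h₆ q hq]; exact htop)
    (k := D.top + 1) (fun q hq => by rw [h₆ q hq]; omega)
    (le_trans (Nat.mul_le_mul_right _ (by rw [hS₆.reg, sm₅.reg]; omega)) hV) (hSdef ▸ hS))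
    fun s₇ h₇' hF₇ _ => ?_
  have h₇ := h₇'.congr (m' := fun _ => D.top) h₆
  refine Run.assign hw rfl (Run.tame hw rfl) ?_
  -- Registered by the first check and kept by both passes, so the second check alters nothing and
  -- can use the completed marks.
  have hreg : CompsRegistered D σ s₆ (fun _ => D.top) :=
    (CompsRegistered.grows h₃.registered g₄).grows ((sm₅.trans hS₆).grows 0)
  have hiff : σ.IsSubpattern π ↔ s₇.reg 13 ≠ 0 := by
    rw [isSubpattern_iff (D := D) hσ hπ]
    refine ⟨fun hre => h₇.complete hre fun r hr v hv hvr => ?_, h₇.sound⟩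
    have hS₇ := h₇.same hreg
    rw [hS₇.arr 12 (by omega) (by omega)] at hv
    rw [hS₇.row] at hvr
    obtain ⟨p, hp, hg, _⟩ := hT₆.entry v hv
    have hco : Complete D σ p s₆ := (co₅ p hp).of_same hS₆ fun u hu => by rw [h16₆]; exact hu
    exact hco v hv hg ((hre.comp r).congr fun q hq => (hvr q hq).symm)
  rw [hiff]
  by_cases h : s₇.reg 13 = 0 <;> simp [RamExpr.eval, h, Nat.pos_of_ne_zero]

end PatternProg

namespace PatternProg

open RamProg Decomposition

/-! ### Size and time bounds -/

theorem pow_mul_two_pow_le {l d : ℕ} (hl : 1 ≤ l) (hd : 1 ≤ d) :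
    (2 * d * l + 1) ^ l * 2 ^ l ≤ (6 * (d * l)) ^ l := by
  rw [← mul_pow]
  have : 1 ≤ d * l := Nat.mul_pos hd hl
  exact Nat.pow_le_pow_left (by rw [mul_assoc 2 d l]; omega) l

theorem pow_mul_two_pow_mul_sq_le {l d : ℕ} (hd : 1 ≤ d) :
    (2 * d * l + 1) ^ l * (2 ^ l * (l * l)) ≤ (16 * l * d) ^ l * l ^ 2 := by
  rcases Nat.eq_zero_or_pos l with rfl | hl
  · simp
  rw [← mul_assoc, ← sq]
  refine Nat.mul_le_mul_right _ ((pow_mul_two_pow_le hl hd).trans (Nat.pow_le_pow_left ?_ l))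
  rw [mul_comm d l, mul_assoc]
  omega

/-- `2 * (2dl + 1) ≤ 6dl`, and `(l + 1) ^ 3 ≤ 8 * l ^ 2 * l` with the last factor at most `2 ^ l`;
the base becomes `12dl`, below `16dl`. -/
theorem pow_mul_two_pow_mul_cube_le {l d : ℕ} (hl : 1 ≤ l) (hd : 1 ≤ d) :
    (2 * d * l + 1) ^ l * 2 ^ l * (l + 1) ^ 3 ≤ 8 * ((16 * l * d) ^ l * l ^ 2) := by
  have h1 : (l + 1) ^ 3 ≤ (2 * l) ^ 3 := Nat.pow_le_pow_left (by omega) 3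
  have h2 : (2 * l) ^ 3 ≤ 8 * l ^ 2 * 2 ^ l := by
    have : (2 * l) ^ 3 = 8 * l ^ 2 * l := by ring
    rw [this]
    exact Nat.mul_le_mul_left _ Nat.lt_two_pow_self.le
  calc (2 * d * l + 1) ^ l * 2 ^ l * (l + 1) ^ 3
      ≤ (6 * (d * l)) ^ l * (8 * l ^ 2 * 2 ^ l) :=
        Nat.mul_le_mul (pow_mul_two_pow_le hl hd) (h1.trans h2)
    _ = 8 * ((6 * (d * l) * 2) ^ l * l ^ 2) := by rw [mul_pow _ 2 l]; ring
    _ ≤ 8 * ((16 * l * d) ^ l * l ^ 2) := by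
        refine Nat.mul_le_mul_left _ (Nat.mul_le_mul_right _ (Nat.pow_le_pow_left ?_ l))
        rw [mul_comm d l, mul_assoc 16]
        omega

/-- For `dl ≥ 2` one has `16 ≤ (dl) ^ 4` and `l ^ 2 ≤ (dl) ^ (2 * l)`, whence the exponent `4 + 1 +
2 = 7`. The factor `16` is needed for `d = l = 1`. -/
theorem sixteen_pow_mul_sq_le {l d : ℕ} (hl : 1 ≤ l) (hd : 1 ≤ d) :
    (16 * l * d) ^ l * l ^ 2 ≤ 16 * (d * l) ^ (7 * l) := by
  have hdl : 1 ≤ d * l := Nat.mul_pos hd hl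
  rcases Nat.lt_or_ge 1 (d * l) with h | h
  · have h1 : 16 ≤ (d * l) ^ 4 := Nat.pow_le_pow_left h 4
    have h2 : l ^ 2 ≤ (d * l) ^ (2 * l) := by
      rw [mul_comm 2 l, pow_mul]
      exact Nat.pow_le_pow_left (Nat.lt_two_pow_self.le.trans (Nat.pow_le_pow_left h l)) 2
    calc (16 * l * d) ^ l * l ^ 2 = (16 * (d * l)) ^ l * l ^ 2 := by ring
      _ ≤ ((d * l) ^ 4 * (d * l)) ^ l * (d * l) ^ (2 * l) := by gcongr
      _ = (d * l) ^ (7 * l) := by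
        rw [← pow_succ, ← pow_mul, ← pow_add]
        congr 1
        ring
      _ ≤ 16 * (d * l) ^ (7 * l) := Nat.le_mul_of_pos_left _ (by norm_num)
  · obtain ⟨rfl, rfl⟩ := mul_eq_one.1 (le_antisymm h hdl)
    norm_num

theorem patternInput_bounded {V : ℕ} {σ π : PointPerm} {D : Decomposition π} (hσ : σ.Reduced)
    (hπ : π.Reduced) (hl : σ.length ≤ V) (hn : π.length ≤ V) (hK : D.top ≤ V) :
    (patternInput σ π D).Bounded V := by
  have hσP : ∀ m α, (if m ∈ σ.S then σ.P m α else 0) ≤ V := fun m α => by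
    split_ifs with h
    · exact (Finset.mem_Icc.1 (hσ.2 m h α)).2.trans hl
    · exact Nat.zero_le _
  have hπP : ∀ m α, (if m ∈ π.S then π.P m α else 0) ≤ V := fun m α => by
    split_ifs with h
    · exact (Finset.mem_Icc.1 (hπ.2 m h α)).2.trans hn
    · exact Nat.zero_le _
  have hstep : ∀ (f : MergeStep → ℕ), (∀ m < D.s, ∃ p ≤ D.s, f (D.step m) ∈ (D.fam p).S) →
      ∀ m, (if m < D.s then f (D.step m) else 0) ≤ V := fun f hf m => by
    split_ifs with h
    · obtain ⟨p, hp, hm⟩ := hf m h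
      exact (D.le_top hπ hp hm).trans hK
    · exact Nat.zero_le _
  refine ⟨fun x => ?_, fun a m => ?_⟩
  · simp only [patternInput]
    split_ifs
    exacts [hl, hn, Nat.zero_le _]
  · simp only [patternInput]
    by_cases h0 : a = 0
    · rw [if_pos h0]; exact hσP m 0
    rw [if_neg h0]
    by_cases h1 : a = 1
    · rw [if_pos h1]; exact hσP m 1
    rw [if_neg h1]
    by_cases h2 : a = 2
    · rw [if_pos h2]; exact hπP m 0
    rw [if_neg h2]
    by_cases h3 : a = 3
    · rw [if_pos h3]; exact hπP m 1
    rw [if_neg h3]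
    by_cases h4 : a = 4
    · rw [if_pos h4]; exact hstep (·.i) (fun m hm => ⟨m, hm.le, D.mem_i m hm⟩) m
    rw [if_neg h4]
    by_cases h5 : a = 5
    · rw [if_pos h5]; exact hstep (·.j) (fun m hm => ⟨m, hm.le, D.mem_j m hm⟩) m
    rw [if_neg h5]
    by_cases h6 : a = 6
    · rw [if_pos h6]
      refine hstep (·.k) (fun m hm => ⟨m + 1, hm, ?_⟩) m
      rw [D.next m hm]
      exact Finset.mem_insert_self _ _
    · rw [if_neg h6]; exact Nat.zero_le _

/-- The memory bound is `V = N ^ 3`: the number of trie nodes is at most `3 * N ≤ N ^ 2`, times the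
base `top + 1 ≤ N` of the addresses. Then `V ^ 64 = N ^ 192 < N ^ 193`. -/
theorem decidesPattern_mainProg {σ π : PointPerm} (hσ : σ.Reduced) (hπ : π.Reduced)
    {D : Decomposition π} {d : ℕ} (hd : 1 ≤ d) (hD : D.IsWide d) {w : ℕ}
    (hw : ((16 * σ.length * d) ^ σ.length * σ.length ^ 2 * π.length
      + π.length + D.maxLabel + 2) ^ 193 ≤ 2 ^ w) :
    DecidesPattern mainProg w σ π D (100000 * ((2 * d * σ.length + 1) ^ σ.length *
      2 ^ σ.length * (σ.length + 1) ^ 3 * π.length)) := by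
  have hn : 1 ≤ π.length := by have := D.s_add_one; omega
  have htop := D.top_le
  set l := σ.length with hl
  have hA := pow_mul_two_pow_mul_sq_le (l := l) hd
  set A := (16 * l * d) ^ l * l ^ 2 with hAdef
  obtain ⟨N, hN⟩ : ∃ N, N = A * π.length + π.length + D.maxLabel + 2 := ⟨_, rfl⟩
  rw [← hN] at hw
  have hAn : A ≤ A * π.length := Nat.le_mul_of_pos_right _ hn
  -- The `+ 1` is for the empty pattern, where `A = 0`.
  have hpowA : (2 * d * l + 1) ^ l * 2 ^ l ≤ A + 1 := by
    rcases Nat.eq_zero_or_pos l with h | h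
    · simp [h]
    · exact ((Nat.le_mul_of_pos_right _ (Nat.mul_pos h h)).trans
        ((mul_assoc _ _ _).trans_le hA)).trans (Nat.le_succ _)
  have hSN : (2 * d * l + 1) ^ l ≤ A + 1 :=
    (Nat.le_mul_of_pos_right _ (Nat.two_pow_pos l)).trans hpowA
  have hpN : 2 ^ l ≤ A + 1 :=
    (Nat.le_mul_of_pos_left _ (Nat.pow_pos (Nat.succ_pos _))).trans hpowA
  have hllA : l * l ≤ A := by
    refine le_trans ?_ hA
    rw [← mul_assoc]
    exact Nat.le_mul_of_pos_left _ (by positivity)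
  have hlA : l ≤ A := (Nat.le_mul_self l).trans hllA
  have hV : N ≤ N ^ 3 := Nat.le_self_pow (by norm_num) N
  have hwV : RamBound (N ^ 3) w := by
    refine ⟨by omega, lt_of_lt_of_le ?_ hw⟩
    rw [← pow_mul]
    exact Nat.pow_lt_pow_right (by omega) (by norm_num)
  have hsize : (2 * (l * l) + π.length * ((2 * d * l + 1) ^ l * (2 ^ l * (l * l))) + 1) *
      (D.top + 1) ≤ N ^ 3 := by
    have h1 : π.length * ((2 * d * l + 1) ^ l * (2 ^ l * (l * l))) ≤ A * π.length := by
      rw [mul_comm A]; exact Nat.mul_le_mul_left _ hA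
    calc _ ≤ (N * N) * N := by
          refine Nat.mul_le_mul ?_ (by omega)
          have : 3 * N ≤ N * N := Nat.mul_le_mul_right _ (by omega)
          omega
      _ = N ^ 3 := by ring
  obtain ⟨t, s', hex, ht, _, hQ⟩ := run_mainProg hwV hσ hπ hD rfl (by rw [← hl]; omega)
    (by rw [← hl]; omega) hsize
    (patternInput_bounded hσ hπ (by rw [← hl]; omega) (by omega) (by omega))
  exact ⟨t, s', hex, ht, hQ⟩

end PatternProg

/-! ### The theorem -/

theorem Decomposition.IsWide.one_le {π : PointPerm} {D : Decomposition π} {d : ℕ}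
    (hD : D.IsWide d) : 1 ≤ d := by
  obtain ⟨i, hi⟩ := Finset.card_pos.1 (D.final ▸ Nat.one_pos : 0 < (D.fam D.s).S.card)
  exact Nat.one_le_of_lt (hD D.s le_rfl i hi)

theorem DecidesPattern.mono {prog : RamProg} {w : ℕ} {σ π : PointPerm} {D : Decomposition π}
    {T T' : ℕ} (h : DecidesPattern prog w σ π D T) (hT : T ≤ T') :
    DecidesPattern prog w σ π D T' := by
  obtain ⟨t, s', hex, ht, hQ⟩ := h
  exact ⟨t, s', hex, ht.trans hT, hQ⟩

theorem mainTheorem3 :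
    ∃ (prog : RamProg) (C c b : ℕ),
      ∀ (σ π : PointPerm), σ.Reduced → π.Reduced →
      ∀ (D : Decomposition π) (d : ℕ), D.IsWide d →
      -- words of `O(log N)` bits, where `N` bounds the running time and the numbers in the input
      ∀ w : ℕ, ((16 * σ.length * d) ^ σ.length * σ.length ^ 2 * π.length
          + π.length + D.maxLabel + 2) ^ b ≤ 2 ^ w →
        DecidesPattern prog w σ π D (C * (d * σ.length) ^ (c * σ.length) * π.length) ∧
        (1 ≤ σ.length →
          DecidesPattern prog w σ π D
            (C * ((16 * σ.length * d) ^ σ.length * σ.length ^ 2 * π.length))) := by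
  -- `12800000 = 100000 * 8 * 16`: the factor of the running time, that of
  -- `pow_mul_two_pow_mul_cube_le` and that of `sixteen_pow_mul_sq_le`.
  refine ⟨PatternProg.mainProg, 12800000, 7, 193, fun σ π hσ hπ D d hD w hw => ?_⟩
  have hd := hD.one_le
  have key := PatternProg.decidesPattern_mainProg hσ hπ hd hD hw
  have hcube : 1 ≤ σ.length → (2 * d * σ.length + 1) ^ σ.length * 2 ^ σ.length *
      (σ.length + 1) ^ 3 * π.length ≤
      8 * ((16 * σ.length * d) ^ σ.length * σ.length ^ 2 * π.length) := fun hl => by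
    rw [← mul_assoc 8]
    exact Nat.mul_le_mul_right _ (PatternProg.pow_mul_two_pow_mul_cube_le hl hd)
  refine ⟨key.mono ?_, fun hl => key.mono ?_⟩
  -- For the empty pattern both powers are `1` and the time is linear in `n`; the second bound would
  -- be `0` there.
  · rcases Nat.eq_zero_or_pos σ.length with h0 | hl
    · simp only [h0, mul_zero, pow_zero, mul_one, zero_add, one_pow, one_mul]
      omega
    · have h1 := hcube hl
      have h2 := Nat.mul_le_mul_right π.length (PatternProg.sixteen_pow_mul_sq_le hl hd)
      rw [mul_assoc 16 (_ ^ _)] at h2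
      rw [mul_assoc 12800000]
      omega
  · have h1 := hcube hl
    omega
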